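/- All graphs are finite and simple. A fall $k$-colouring of a graph $G$ is a proper colouring of $G$ that uses exactly $k$ colours and in which every vertex is adjacent to a vertex of every colour other than its own. The fall spectrum $\mathcal{F}(G)$ is the set of all integers $k$ for which $G$ has a fall $k$-colouring, and $G$ is fall-unique if $\mathcal{F}(G)$ is a singleton. Fall Colouring is the problem to decide, given a graph $G$ and an integer $k\ge 0$, whether $k\in\mathcal{F}(G)$. Fall Chromatic Number and Fall Achromatic Number are the problems to compute the minimum, respectively the maximum, of $\mathcal{F}(G)$ for a given graph $G$ (and $0$ if $\mathcal{F}(G)=\emptyset$). A graph is $H$-free if it does not contain $H$ as an induced subgraph; $P_3+P_1$ is the disjoint union of a path on three vertices and a single vertex, and $3P_1$ is the graph of three isolated vertices. A co-component of $G$ is the subgraph of $G$ induced by the vertex set of a connected component of the complement $\overline{G}$. (1) Fall Colouring, Fall Chromatic Number and Fall Achromatic Number, restricted to $(P_3+P_1)$-free input graphs, are solvable in polynomial time (on a random access machine with addition and subtraction). (2) Let $G$ be a $(P_3+P_1)$-free graph. If $G$ has a fall colouring, then $G$ is fall-unique. If $G_1,\dots,G_r$ are the co-components of $G$, then $\mathcal{F}(G)=\{k_1+\dots+k_r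 : k_i\in\mathcal{F}(G_i)\text{ for all } i\}$. Every $G_i$ is $3P_1$-free or a disjoint union of complete graphs, and: (a) if $G_i$ is $3P_1$-free, let $S$ be the set of vertices of $G_i$ that are adjacent to all other vertices of $G_i$. If $\overline{G_i-S}$ has a perfect matching, then $\mathcal{F}(G_i)=\{|S|+\tfrac12|V(G_i)\setminus S|\}$; otherwise $\mathcal{F}(G_i)=\emptyset$. (b) if $G_i$ is a disjoint union of complete graphs, then $\mathcal{F}(G_i)=\{p\}$ if all connected components of $G_i$ have the same number $p$ of vertices, and $\mathcal{F}(G_i)=\emptyset$ otherwise. -/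

import Mathlib

open SimpleGraph

/-! ### Fall colourings -/

namespace FallColouring

variable {V W : Type*}

/-- `c` is a fall colouring with exactly `k` colours: every colour is used, and every vertex is
adjacent to a vertex of every colour different from its own. -/
def IsFallColouring {G : SimpleGraph V} {k : ℕ} (c : G.Coloring (Fin k)) : Prop :=
  Function.Surjective c ∧ ∀ (v : V) (j : Fin k), j ≠ c v → ∃ w, G.Adj v w ∧ c w = j

/-- The fall spectrum of `G`: the set of all `k` for which `G` has a fall `k`-colouring. -/
def fallSpectrum (G : SimpleGraph V) : Set ℕ :=
  {k | ∃ c : G.Coloring (Fin k), IsFallColouring c}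

/-- `G` is fall-unique: its fall spectrum is a singleton. -/
def FallUnique (G : SimpleGraph V) : Prop :=
  ∃ k, fallSpectrum G = {k}

/-- The fall chromatic number of a finite graph, `0` if there is no fall colouring. -/
noncomputable def fallChromaticNumber (G : SimpleGraph V) : ℕ :=
  sInf (fallSpectrum G)

/-- The fall achromatic number of a finite graph, `0` if there is no fall colouring. -/
noncomputable def fallAchromaticNumber (G : SimpleGraph V) : ℕ :=
  sSup (fallSpectrum G)

/-! ### Graph classes -/

/-- `G` is `H`-free: it does not contain `H` as an induced subgraph. -/
def IsFree (H : SimpleGraph W) (G : SimpleGraph V) : Prop :=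
  ¬ H ⊴ G

/-- The graph `P₃ + P₁`. -/
abbrev P3addP1 : SimpleGraph (Fin 3 ⊕ Fin 1) :=
  pathGraph 3 ⊕g pathGraph 1

/-- The graph `3P₁`: three pairwise non-adjacent vertices. -/
abbrev threeP1 : SimpleGraph (Fin 3) :=
  ⊥

/-- `G` is a disjoint union of complete graphs. -/
def IsDisjointUnionOfCliques (G : SimpleGraph V) : Prop :=
  ∀ D : G.ConnectedComponent, G.IsClique D.supp

/-- The co-component of `G` on the vertex set of a connected component of the complement. -/
abbrev coComponent (G : SimpleGraph V) (C : Gᶜ.ConnectedComponent) : SimpleGraph C.supp :=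
  G.induce C.supp

/-- The graph obtained from `G` by deleting all its dominating vertices. -/
abbrev deleteDominating (G : SimpleGraph V) : SimpleGraph ↥(G.universalVertsᶜ) :=
  G.induce G.universalVertsᶜ

/-- `G` has a perfect matching. -/
def HasPerfectMatching (G : SimpleGraph V) : Prop :=
  ∃ M : G.Subgraph, M.IsPerfectMatching

end FallColouring

/-! ### Random access machines

Programs of a random access machine in structured form, with natural-number variables and
finitely many arrays (all those that the program mentions).  The arithmetic operations are addition
and truncated subtraction; there is no multiplication, so that one unit of time increases the
largest bit length of a stored number by at most a constant, and the unit-cost time below is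
polynomially related to the time of a Turing machine. -/

namespace RAM

/-- The contents of the variables and of the (infinitely long) arrays. -/
structure State where
  /-- value of a variable -/
  var : ℕ → ℕ
  /-- entry of an array -/
  arr : ℕ → ℕ → ℕ

/-- Arithmetic expressions; `get a e` is the entry of array `a` at the index given by `e`. -/
inductive Expr
  | lit (n : ℕ)
  | var (x : ℕ)
  | get (a : ℕ) (e : Expr)
  | add (e₁ e₂ : Expr)
  | sub (e₁ e₂ : Expr)

namespace Expr

/-- The value of an expression. -/
def eval (s : State) : Expr → ℕ
  | lit n => n
  | var x => s.var x
  | get a e => s.arr a (e.eval s)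
  | add e₁ e₂ => e₁.eval s + e₂.eval s
  | sub e₁ e₂ => e₁.eval s - e₂.eval s

/-- The time for the evaluation of an expression: the number of its operations. -/
def cost : Expr → ℕ
  | lit _ => 1
  | var _ => 1
  | get _ e => e.cost + 1
  | add e₁ e₂ => e₁.cost + e₂.cost + 1
  | sub e₁ e₂ => e₁.cost + e₂.cost + 1

end Expr

/-- Programs. A condition `e` holds if its value is not zero. -/
inductive Prog
  | skip
  | assign (x : ℕ) (e : Expr)
  | store (a : ℕ) (i e : Expr)
  | seq (p q : Prog)
  | cond (e : Expr) (p q : Prog)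
  | loop (e : Expr) (p : Prog)

/-- The state after the assignment of `n` to the variable `x`. -/
def State.setVar (s : State) (x n : ℕ) : State where
  var := Function.update s.var x n
  arr := s.arr

/-- The state after the assignment of `n` to the entry with index `i` of the array `a`. -/
def State.setArr (s : State) (a i n : ℕ) : State where
  var := s.var
  arr := Function.update s.arr a (Function.update (s.arr a) i n)

/-- `Runs p s t s'`: started in the state `s`, the program `p` halts after time `t` in the
state `s'`. -/
inductive Runs : Prog → State → ℕ → State → Prop
  | skip (s : State) : Runs .skip s 1 s
  | assign (x : ℕ) (e : Expr) (s : State) :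
      Runs (.assign x e) s (e.cost + 1) (s.setVar x (e.eval s))
  | store (a : ℕ) (i e : Expr) (s : State) :
      Runs (.store a i e) s (i.cost + e.cost + 1) (s.setArr a (i.eval s) (e.eval s))
  | seq {p q : Prog} {s s' s'' : State} {t t' : ℕ} :
      Runs p s t s' → Runs q s' t' s'' → Runs (.seq p q) s (t + t') s''
  | cond_true {e : Expr} {p q : Prog} {s s' : State} {t : ℕ} :
      e.eval s ≠ 0 → Runs p s t s' → Runs (.cond e p q) s (e.cost + 1 + t) s'
  | cond_false {e : Expr} {p q : Prog} {s s' : State} {t : ℕ} :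
      e.eval s = 0 → Runs q s t s' → Runs (.cond e p q) s (e.cost + 1 + t) s'
  | loop_true {e : Expr} {p : Prog} {s s' s'' : State} {t t' : ℕ} :
      e.eval s ≠ 0 → Runs p s t s' → Runs (.loop e p) s' t' s'' →
        Runs (.loop e p) s (e.cost + 1 + t + t') s''
  | loop_false {e : Expr} {p : Prog} {s : State} :
      e.eval s = 0 → Runs (.loop e p) s (e.cost + 1) s

/-- The machine is deterministic: running time and final state are determined by the program and
the initial state. -/
theorem Runs.det {p : Prog} {s s₁ s₂ : State} {t₁ t₂ : ℕ} (h₁ : Runs p s t₁ s₁)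
    (h₂ : Runs p s t₂ s₂) : t₁ = t₂ ∧ s₁ = s₂ := by
  induction h₁ generalizing t₂ s₂ with
  | skip | assign | store => cases h₂; exact ⟨rfl, rfl⟩
  | seq _ _ ih ih' =>
    cases h₂ with
    | seq g g' =>
      obtain ⟨rfl, rfl⟩ := ih g
      obtain ⟨rfl, rfl⟩ := ih' g'
      exact ⟨rfl, rfl⟩
  | cond_true he _ ih =>
    cases h₂ with
    | cond_true _ g => obtain ⟨rfl, rfl⟩ := ih g; exact ⟨rfl, rfl⟩
    | cond_false he' _ => exact absurd he' he
  | cond_false he _ ih =>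
    cases h₂ with
    | cond_true he' _ => exact absurd he he'
    | cond_false _ g => obtain ⟨rfl, rfl⟩ := ih g; exact ⟨rfl, rfl⟩
  | loop_true he _ _ ih ih' =>
    cases h₂ with
    | loop_true _ g g' =>
      obtain ⟨rfl, rfl⟩ := ih g
      obtain ⟨rfl, rfl⟩ := ih' g'
      exact ⟨rfl, rfl⟩
    | loop_false he' => exact absurd he' he
  | loop_false he =>
    cases h₂ with
    | loop_true he' _ _ => exact absurd he he'
    | loop_false _ => exact ⟨rfl, rfl⟩

/-- The initial state on the input `l`: array `0` holds `l`, variable `0` holds its length, and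
everything else is `0`. -/
def start (l : List ℕ) : State where
  var x := if x = 0 then l.length else 0
  arr a i := if a = 0 then l.getD i 0 else 0

/-- The size of an input: the total bit length of its entries, plus one for each entry. -/
def inputSize (l : List ℕ) : ℕ :=
  (l.map fun x => Nat.size x + 1).sum

/-- The function `f` can be computed in polynomial time on the instances in the class `P`, where
instances are presented to the machine through `enc`: there are one program and one polynomial such
that on every instance `x` in `P` the program halts, within a time bounded by the polynomial in the
size of the input, with the value `f x` in variable `0`. -/
def PolyTimeOn {I : Type*} (P : I → Prop) (enc : I → List ℕ) (f : I → ℕ) : Prop :=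
  ∃ (prog : Prog) (b : Polynomial ℕ), ∀ x, P x →
    ∃ (t : ℕ) (s : State), Runs prog (start (enc x)) t s ∧
      t ≤ b.eval (inputSize (enc x)) ∧ s.var 0 = f x

open Classical in
/-- The decision problem `Q` can be solved in polynomial time on the instances in the class `P`
(answer `1` for yes and `0` for no). -/
def PolyTimeDecidableOn {I : Type*} (P : I → Prop) (enc : I → List ℕ) (Q : I → Prop) : Prop :=
  PolyTimeOn P enc fun x => if Q x then 1 else 0

end RAM

namespace FallColouring

/-- Finite graphs as inputs of algorithms: the vertices are `0, …, n - 1`. -/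
abbrev InputGraph : Type :=
  Σ n : ℕ, SimpleGraph (Fin n)

open Classical in
/-- A graph is given by its number `n` of vertices and its adjacency matrix, row by row. -/
noncomputable def encodeGraph (G : InputGraph) : List ℕ :=
  G.1 :: List.ofFn fun t : Fin (G.1 * G.1) => if G.2.Adj t.divNat t.modNat then 1 else 0

/-- A graph together with a number `k`. -/
noncomputable def encodeGraphNat (x : InputGraph × ℕ) : List ℕ :=
  x.2 :: encodeGraph x.1

end FallColouring

/-! Everything is read off the complement. The complement of `P₃ + P₁` is the paw, a triangle with a
pendant edge (`IsFree.adj_or_adj`). If a component of a paw-free graph contains a triangle, every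
vertex of that component sees two corners of it (`IsFree.adj_two`), and it follows that the
component is complete multipartite. Hence a co-component of `G` is `3P₁`-free or a disjoint union of
complete graphs.

Distinct co-components are completely joined, so they share no colour, and fall colourings split and
combine freely (`mem_fallSpectrum_iff`). In a `3P₁`-free graph a colour class has at most two
vertices, and the fall condition makes the vertex of a singleton class dominating. Conversely, any
pairing of the non-dominating vertices with non-neighbours gives a fall colouring, because a vertex
that misses both ends of a pair would complete an independent triple (`exists_isCoMatching`,
`IsCoMatching.mem_fallSpectrum`). In a disjoint union of complete graphs every component carries
each colour exactly once. So every co-component admits at most one number of colours, and therefore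
so does `G`.

The algorithm computes no components. Lying in a triangle of the complement is a property of whole
components, and the parts of a multipartite component are visible through common neighbours. It
remains to test that `offTriangles Gᶜ` has a matching covering all its non-isolated vertices and
that adjacent triangle vertices have parts of equal size. If both hold, the sum of `weight` is the
number of colours (`fallCmd_spec`).

The matching comes from Edmonds' blossom search, without contracting blossoms or tracing paths:
every even vertex `u` carries a full matching `M u` that misses `u` instead of the root, and the set
`P u` of odd vertices on its path. `Search.Inv.grow` and `Search.Inv.merge` keep this up. A search
that is stuck exhibits a Tutte barrier (`Search.Inv.not_perfect`).

For the running time, the algorithm is an array program over `Fin n` whose entries are given by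
terms with sums over the domain. All its loops have `n` rounds, so one structural induction
(`Cmd.runs_compile`) yields a machine program with a polynomial bound. -/

namespace RAM

/-! ### Counted loops on the machine -/

/-- A counted loop: `c` is the counter, the number of rounds is held by the variable `b`. -/
theorem Runs.for {p : Prog} {b c n B : ℕ} (I : ℕ → State → Prop)
    (h : ∀ i s, i < n → I i s → s.var c = i → s.var b = n →
      ∃ t s', Runs p s t s' ∧ t ≤ B ∧ I (i + 1) s' ∧ s'.var c = i + 1 ∧ s'.var b = n)
    {s : State} (h0 : I 0 s) (hc : s.var c = 0) (hb : s.var b = n) :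
    ∃ t s', Runs (.loop (.sub (.var b) (.var c)) p) s t s' ∧ t ≤ (n + 1) * (B + 4) ∧
      I n s' ∧ s'.var b = n := by
  -- Induction on the number `m` of rounds that remain. Each test of the loop condition costs 4,
  -- also the last one that fails.
  have key : ∀ m i s, i + m = n → I i s → s.var c = i → s.var b = n →
      ∃ t s', Runs (.loop (.sub (.var b) (.var c)) p) s t s' ∧ t ≤ (m + 1) * (B + 4) ∧
        I n s' ∧ s'.var b = n := by
    intro m
    induction m with
    | zero =>
      intro i s hi hI hc hb
      refine ⟨_, s, Runs.loop_false ?_, ?_, ?_, hb⟩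
      · simp only [Expr.eval]; omega
      · simp [Expr.cost]
      · obtain rfl : i = n := by omega
        exact hI
    | succ m ih =>
      intro i s hi hI hc hb
      obtain ⟨t, s', hr, ht, hI', hc', hb'⟩ := h i s (by omega) hI hc hb
      obtain ⟨t', s'', hr', ht', hI'', hb''⟩ := ih (i + 1) s' (by omega) hI' hc' hb'
      refine ⟨_, s'', Runs.loop_true ?_ hr hr', ?_, hI'', hb''⟩
      · simp only [Expr.eval]; omega
      · simp only [Expr.cost]
        have : (m + 1 + 1) * (B + 4) = (m + 1) * (B + 4) + (B + 4) := by ring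
        omega
  exact key n 0 s (by omega) h0 hc hb

/-! ### Terms over finite structures -/

/-- Terms over a structure with domain `Fin n` and number-valued binary arrays. Variables are
named and range over the domain. -/
inductive Tm
  | lit (c : ℕ)
  | idx (x : ℕ)
  | get (a x y : ℕ)
  | add (t u : Tm)
  | sub (t u : Tm)
  | ite (c t u : Tm)
  | sum (x : ℕ) (t : Tm)

/-- Number-valued binary arrays over `Fin n`. -/
abbrev Arrays (n : ℕ) := ℕ → Fin n → Fin n → ℕ

/-- The value of a term. -/
def Tm.eval {n : ℕ} (X : Arrays n) : Tm → (ℕ → Fin n) → ℕ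
  | .lit c, _ => c
  | .idx x, e => e x
  | .get a x y, e => X a (e x) (e y)
  | .add t u, e => t.eval X e + u.eval X e
  | .sub t u, e => t.eval X e - u.eval X e
  | .ite c t u, e => if c.eval X e ≠ 0 then t.eval X e else u.eval X e
  | .sum x t, e => ∑ i : Fin n, t.eval X (Function.update e x i)

/-- The machine program for a term: `ρ` tells where the variables are kept, the value is left in
the variable `k`, and no variable below `k` is changed. -/
def Tm.compile : Tm → (ℕ → ℕ) → ℕ → Prog
  | .lit c, _, k => .assign k (.lit c)
  | .idx x, ρ, k => .assign k (.var (ρ x))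
  | .get a x y, ρ, k => .assign k (.get (a + 3) (.add (.get 1 (.var (ρ x))) (.var (ρ y))))
  | .add t u, ρ, k => .seq (t.compile ρ k) (.seq (u.compile ρ (k + 1))
      (.assign k (.add (.var k) (.var (k + 1)))))
  | .sub t u, ρ, k => .seq (t.compile ρ k) (.seq (u.compile ρ (k + 1))
      (.assign k (.sub (.var k) (.var (k + 1)))))
  | .ite c t u, ρ, k => .seq (c.compile ρ k) (.cond (.var k) (t.compile ρ k) (u.compile ρ k))
  | .sum x t, ρ, k => .seq (.assign k (.lit 0)) (.seq (.assign (k + 1) (.lit 0))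
      (.loop (.sub (.var 1) (.var (k + 1)))
        (.seq (t.compile (Function.update ρ x (k + 1)) (k + 2))
          (.seq (.assign k (.add (.var k) (.var (k + 2))))
            (.assign (k + 1) (.add (.var (k + 1)) (.lit 1)))))))

/-- The state `s` represents the structure with the arrays `X`: variable `1` holds the size of the
domain, array `1` its multiples, and array `a + 3` the entries of `X a` row by row. -/
structure Represents {n : ℕ} (X : Arrays n) (s : State) : Prop where
  size : s.var 1 = n
  row : ∀ i < n, s.arr 1 i = i * n
  entry : ∀ a (i j : Fin n), s.arr (a + 3) (i * n + j) = X a i j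

theorem Represents.congr {n : ℕ} {X : Arrays n} {s s' : State} (h : Represents X s)
    (hv : s'.var 1 = s.var 1) (ha : s'.arr = s.arr) : Represents X s' :=
  ⟨hv.trans h.size, fun i hi => by rw [ha, h.row i hi], fun a i j => by rw [ha, h.entry]⟩

/-- Structural induction on the term. The polynomial is chosen before `n`, the arrays and the
environment, so it depends on the term and its registers only. Subterms work in registers from `k`
upwards, so the variables located by `ρ` keep their values; a bound variable lives in the loop
counter `k + 1`. -/
theorem Tm.runs_compile (τ : Tm) (ρ : ℕ → ℕ) (k : ℕ) (hρ : ∀ x, ρ x < k) (hk : 1 < k) :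
    ∃ b : Polynomial ℕ, ∀ {n : ℕ} (X : Arrays n) (e : ℕ → Fin n) (s : State), Represents X s →
      (∀ x, s.var (ρ x) = e x) → ∃ t s', Runs (τ.compile ρ k) s t s' ∧ t ≤ b.eval n ∧
        s'.var k = τ.eval X e ∧ s'.arr = s.arr ∧ ∀ x < k, s'.var x = s.var x := by
  induction τ generalizing ρ k with
  | lit c =>
    refine ⟨Polynomial.C 2, fun X e s hX he => ⟨_, _, Runs.assign _ _ _, ?_, ?_, rfl, ?_⟩⟩
    · simp [Expr.cost]
    · simp [State.setVar, Expr.eval, Tm.eval]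
    · intro x hx; simp [State.setVar, hx.ne]
  | idx y =>
    refine ⟨Polynomial.C 2, fun X e s hX he => ⟨_, _, Runs.assign _ _ _, ?_, ?_, rfl, ?_⟩⟩
    · simp [Expr.cost]
    · simp [State.setVar, Expr.eval, Tm.eval, he]
    · intro x hx; simp [State.setVar, hx.ne]
  | get a x y =>
    refine ⟨Polynomial.C 6, fun X e s hX he => ⟨_, _, Runs.assign _ _ _, ?_, ?_, rfl, ?_⟩⟩
    · simp [Expr.cost]
    · simp [State.setVar, Expr.eval, Tm.eval, he, hX.row, hX.entry]
    · intro x hx; simp [State.setVar, hx.ne]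
  | add t u iht ihu =>
    obtain ⟨b, hb⟩ := iht ρ k hρ hk
    obtain ⟨b', hb'⟩ := ihu ρ (k + 1) (fun x => (hρ x).trans (by omega)) (by omega)
    refine ⟨b + b' + Polynomial.C 4, fun X e s hX he => ?_⟩
    obtain ⟨t₁, s₁, r₁, h₁, v₁, a₁, f₁⟩ := hb X e s hX he
    obtain ⟨t₂, s₂, r₂, h₂, v₂, a₂, f₂⟩ := hb' X e s₁ (hX.congr (f₁ 1 hk) a₁)
      (fun x => by rw [f₁ _ (hρ x), he])
    refine ⟨_, _, r₁.seq (r₂.seq (Runs.assign _ _ _)), ?_, ?_, a₂.trans a₁, ?_⟩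
    · simp [Expr.cost]; omega
    · simp [State.setVar, Expr.eval, Tm.eval, v₂, f₂ k, v₁]
    · intro x hx; simp [State.setVar, hx.ne, f₂ x (by omega), f₁ x hx]
  | sub t u iht ihu =>
    obtain ⟨b, hb⟩ := iht ρ k hρ hk
    obtain ⟨b', hb'⟩ := ihu ρ (k + 1) (fun x => (hρ x).trans (by omega)) (by omega)
    refine ⟨b + b' + Polynomial.C 4, fun X e s hX he => ?_⟩
    obtain ⟨t₁, s₁, r₁, h₁, v₁, a₁, f₁⟩ := hb X e s hX he
    obtain ⟨t₂, s₂, r₂, h₂, v₂, a₂, f₂⟩ := hb' X e s₁ (hX.congr (f₁ 1 hk) a₁)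
      (fun x => by rw [f₁ _ (hρ x), he])
    refine ⟨_, _, r₁.seq (r₂.seq (Runs.assign _ _ _)), ?_, ?_, a₂.trans a₁, ?_⟩
    · simp [Expr.cost]; omega
    · simp [State.setVar, Expr.eval, Tm.eval, v₂, f₂ k, v₁]
    · intro x hx; simp [State.setVar, hx.ne, f₂ x (by omega), f₁ x hx]
  | ite c t u ihc iht ihu =>
    obtain ⟨b₀, hb₀⟩ := ihc ρ k hρ hk
    obtain ⟨b, hb⟩ := iht ρ k hρ hk
    obtain ⟨b', hb'⟩ := ihu ρ k hρ hk
    refine ⟨b₀ + b + b' + Polynomial.C 4, fun X e s hX he => ?_⟩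
    obtain ⟨t₁, s₁, r₁, h₁, v₁, a₁, f₁⟩ := hb₀ X e s hX he
    have hX₁ := hX.congr (f₁ 1 hk) a₁
    have he₁ : ∀ x, s₁.var (ρ x) = e x := fun x => by rw [f₁ _ (hρ x), he]
    by_cases hc : c.eval X e = 0
    · obtain ⟨t₂, s₂, r₂, h₂, v₂, a₂, f₂⟩ := hb' X e s₁ hX₁ he₁
      refine ⟨_, _, r₁.seq (Runs.cond_false (by simp [Expr.eval, v₁, hc]) r₂), ?_, ?_,
        a₂.trans a₁, fun x hx => (f₂ x hx).trans (f₁ x hx)⟩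
      · simp [Expr.cost]; omega
      · simp [v₂, Tm.eval, hc]
    · obtain ⟨t₂, s₂, r₂, h₂, v₂, a₂, f₂⟩ := hb X e s₁ hX₁ he₁
      refine ⟨_, _, r₁.seq (Runs.cond_true (by simp [Expr.eval, v₁, hc]) r₂), ?_, ?_,
        a₂.trans a₁, fun x hx => (f₂ x hx).trans (f₁ x hx)⟩
      · simp [Expr.cost]; omega
      · simp [v₂, Tm.eval, hc]
  | sum y t ih =>
    obtain ⟨b, hb⟩ := ih (Function.update ρ y (k + 1)) (k + 2) (fun x => by
      by_cases hx : x = y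
      · subst hx; simp
      · simp only [Function.update_of_ne hx]; have := hρ x; omega) (by omega)
    refine ⟨(Polynomial.X + 1) * (b + Polynomial.C 12) + Polynomial.C 4, fun {n} X e s hX he => ?_⟩
    set s₀ : State := (s.setVar k 0).setVar (k + 1) 0 with hs₀
    obtain ⟨t', s', r, ht, ⟨hv, ha, hf⟩, -⟩ := Runs.for (b := 1) (c := k + 1) (n := n)
      (B := b.eval n + 8)
      (p := (.seq (t.compile (Function.update ρ y (k + 1)) (k + 2))
          (.seq (.assign k (.add (.var k) (.var (k + 2))))
            (.assign (k + 1) (.add (.var (k + 1)) (.lit 1))))))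
      -- The partial sum is written as a full sum with an indicator, since the round number `i`
      -- reaches `n` and is then no element of `Fin n`.
      (fun i s' => s'.var k = ∑ j : Fin n, (if j.1 < i then t.eval X (Function.update e y j) else 0)
        ∧ s'.arr = s.arr ∧ ∀ x < k, s'.var x = s.var x)
      (by
        rintro i s₁ hi ⟨h₁, h₂, h₃⟩ hc hn
        obtain ⟨t₂, s₂, r₂, h₂', v₂, a₂, f₂⟩ := hb X (Function.update e y ⟨i, hi⟩) s₁
          (hX.congr (h₃ 1 hk) h₂) (fun x => by
            by_cases hx : x = y
            · subst hx; simp [hc]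
            · simp only [Function.update_of_ne hx]; rw [h₃ _ (hρ x), he])
        refine ⟨_, _, r₂.seq ((Runs.assign _ _ _).seq (Runs.assign _ _ _)), ?_, ⟨?_, ?_, ?_⟩, ?_, ?_⟩
        · simp [Expr.cost]; omega
        · simp only [State.setVar, Expr.eval, f₂ k (by omega), h₁, v₂]
          rw [Function.update_of_ne (by omega), Function.update_self]
          rw [← Finset.sum_erase_add _ _ (Finset.mem_univ (⟨i, hi⟩ : Fin n)),
            ← Finset.sum_erase_add (a := (⟨i, hi⟩ : Fin n)) _ _ (Finset.mem_univ _)]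
          simp only [lt_irrefl, if_false, add_zero, Nat.lt_succ_self, if_true]
          congr 1
          refine Finset.sum_congr rfl fun j hj => ?_
          have : j.1 ≠ i := fun h => (Finset.mem_erase.1 hj).1 (Fin.ext h)
          have h' : j.1 < i ↔ j.1 < i + 1 := by omega
          simp only [h']
        · simp [State.setVar, a₂, h₂]
        · intro x hx
          simp only [State.setVar]
          rw [Function.update_of_ne (by omega), Function.update_of_ne (by omega), f₂ x (by omega),
            h₃ x hx]
        · simp [State.setVar, Expr.eval, f₂ (k + 1), hc]
        · simp only [State.setVar]
          rw [Function.update_of_ne (by omega), Function.update_of_ne (by omega), f₂ 1 (by omega),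
            hn])
      (s := s₀)
      (by
        refine ⟨?_, rfl, fun x hx => ?_⟩
        · simp [hs₀, State.setVar]
        · simp only [hs₀, State.setVar]
          rw [Function.update_of_ne (by omega), Function.update_of_ne (by omega)])
      (by simp [hs₀, State.setVar])
      (by
        simp only [hs₀, State.setVar]
        rw [Function.update_of_ne (by omega), Function.update_of_ne (by omega), hX.size])
    refine ⟨_, s', (Runs.assign _ _ _).seq ((Runs.assign _ _ _).seq r), ?_, ?_, ha, hf⟩
    · simp [Expr.cost] at ht ⊢
      nlinarith
    · rw [hv]; simp [Tm.eval]

/-! ### Programs over finite structures -/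

/-- Programs over finite structures: `set a t` redefines all entries of the array `a` at once,
where the variable `1` of `t` stands for the second index and the other ones for the first;
`iter c` repeats `c` as often as the domain has elements. -/
inductive Cmd
  | set (a : ℕ) (t : Tm)
  | seq (c d : Cmd)
  | iter (c : Cmd)

/-- The environment for the entry with indices `i` and `j`. -/
def pairEnv {n : ℕ} (i j : Fin n) : ℕ → Fin n :=
  fun x => if x = 1 then j else i

/-- The effect of a program on the arrays. -/
def Cmd.eval {n : ℕ} : Cmd → Arrays n → Arrays n
  | .set a t, X => Function.update X a fun i j => t.eval X (pairEnv i j)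
  | .seq c d, X => d.eval (c.eval X)
  | .iter c, X => c.eval^[n] X

/-- For all pairs of indices, run `p` and store the content of the variable `k + 2` in the
array `a`. -/
def fill (a k : ℕ) (p : Prog) : Prog :=
  .seq (.assign k (.lit 0)) (.loop (.sub (.var 1) (.var k))
    (.seq (.assign (k + 1) (.lit 0)) (.seq (.loop (.sub (.var 1) (.var (k + 1)))
      (.seq p (.seq (.store a (.add (.get 1 (.var k)) (.var (k + 1))) (.var (k + 2)))
        (.assign (k + 1) (.add (.var (k + 1)) (.lit 1))))))
      (.assign k (.add (.var k) (.lit 1))))))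

theorem index_inj {n i j i' j' : ℕ} (hj : j < n) (hj' : j' < n) (h : i * n + j = i' * n + j') :
    i = i' ∧ j = j' := by
  have hn : 0 < n := by omega
  have h₁ := congrArg (· / n) h
  have h₂ := congrArg (· % n) h
  simp only [mul_comm _ n, Nat.mul_add_div hn, Nat.div_eq_of_lt hj, Nat.div_eq_of_lt hj'] at h₁
  simp only [mul_comm _ n, Nat.mul_add_mod, Nat.mod_eq_of_lt hj, Nat.mod_eq_of_lt hj'] at h₂
  exact ⟨by simpa using h₁, h₂⟩

/-- `J` is what the body `p` has to know about the state. It must survive changes of the array `a`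
and of the registers from `k` on, because the two nested loops modify nothing else. -/
theorem runs_fill {a k n B : ℕ} {p : Prog} (hk : 1 < k) (ha : a ≠ 1) (v : ℕ → ℕ → ℕ)
    (J : State → Prop) {s : State} (hn : s.var 1 = n) (hrow : ∀ i < n, s.arr 1 i = i * n)
    (hJ : J s)
    (hJs : ∀ s s' : State, J s → (∀ x < k, s'.var x = s.var x) →
      (∀ b, b ≠ a → s'.arr b = s.arr b) → J s')
    (hp : ∀ i j s, i < n → j < n → J s → s.var 1 = n → s.var k = i → s.var (k + 1) = j →
      (∀ i < n, s.arr 1 i = i * n) →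
      ∃ t s', Runs p s t s' ∧ t ≤ B ∧ s'.var (k + 2) = v i j ∧ s'.arr = s.arr ∧
        ∀ x < k + 2, s'.var x = s.var x) :
    ∃ t s', Runs (fill a k p) s t s' ∧
      t ≤ (n + 1) * ((n + 1) * (B + 14) + 10) + 2 ∧
      (∀ i < n, ∀ j < n, s'.arr a (i * n + j) = v i j) ∧
      (∀ b, b ≠ a → s'.arr b = s.arr b) ∧ ∀ x < k, s'.var x = s.var x := by
  set s₀ : State := s.setVar k 0 with hs₀
  obtain ⟨t', s', r, ht, ⟨hv, harr, hvar⟩, -⟩ := Runs.for (b := 1) (c := k) (n := n)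
    (B := (n + 1) * (B + 14) + 6)
    (p := (.seq (.assign (k + 1) (.lit 0)) (.seq (.loop (.sub (.var 1) (.var (k + 1)))
      (.seq p (.seq (.store a (.add (.get 1 (.var k)) (.var (k + 1))) (.var (k + 2)))
        (.assign (k + 1) (.add (.var (k + 1)) (.lit 1))))))
      (.assign k (.add (.var k) (.lit 1))))))
    (fun i s' => (∀ i' < i, ∀ j < n, s'.arr a (i' * n + j) = v i' j) ∧
      (∀ b, b ≠ a → s'.arr b = s.arr b) ∧ ∀ x < k, s'.var x = s.var x)
    (by
      rintro i s₁ hi ⟨h₁, h₂, h₃⟩ hc hn₁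
      obtain ⟨t₂, s₂, r₂, ht₂, ⟨g₁, g₀, g₂, g₃⟩, hn₂⟩ := Runs.for (b := 1) (c := k + 1) (n := n)
        (B := B + 10)
        (p := (.seq p (.seq (.store a (.add (.get 1 (.var k)) (.var (k + 1))) (.var (k + 2)))
          (.assign (k + 1) (.add (.var (k + 1)) (.lit 1))))))
        -- The entries are correct at all pairs that precede `(i, j)` lexicographically.
        (fun j s' => (∀ i' j', j' < n → (i' < i ∨ i' = i ∧ j' < j) →
            s'.arr a (i' * n + j') = v i' j') ∧ s'.var k = i ∧
          (∀ b, b ≠ a → s'.arr b = s.arr b) ∧ ∀ x < k, s'.var x = s.var x)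
        (by
          rintro j s₂ hj ⟨g₁, g₀, g₂, g₃⟩ hc₂ hn₂
          obtain ⟨t₃, s₃, r₃, ht₃, hv₃, ha₃, hf₃⟩ := hp i j s₂ hi hj (hJs _ _ hJ g₃ g₂) hn₂ g₀ hc₂
            (fun i hi => by rw [g₂ 1 (Ne.symm ha), hrow i hi])
          have hrow₃ : s₃.arr 1 i = i * n := by rw [ha₃, g₂ 1 (Ne.symm ha), hrow i hi]
          refine ⟨_, _, r₃.seq ((Runs.store _ _ _ _).seq (Runs.assign _ _ _)), ?_,
            ⟨?_, ?_, ?_, ?_⟩, ?_, ?_⟩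
          · simp [Expr.cost]; omega
          · intro i' j' hj' h
            simp only [State.setVar, State.setArr, Function.update_self, Expr.eval,
              hf₃ k (by omega), hf₃ (k + 1) (by omega), hv₃, g₀, hc₂, hrow₃]
            by_cases he : i' * n + j' = i * n + j
            · obtain ⟨rfl, rfl⟩ := index_inj hj' hj he
              simp
            · rw [Function.update_of_ne he, ha₃]
              refine g₁ i' j' hj' ?_
              rcases h with h | ⟨rfl, h⟩
              · exact Or.inl h
              · refine Or.inr ⟨rfl, ?_⟩
                have : j' ≠ j := fun h => he (by rw [h])
                omega
          · simp [State.setVar, State.setArr, hf₃ k, g₀]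
          · intro b hb
            simp [State.setVar, State.setArr, hb, ha₃, g₂ b hb]
          · intro x hx
            simp only [State.setVar, State.setArr]
            rw [Function.update_of_ne (by omega), hf₃ x (by omega), g₃ x hx]
          · simp [State.setVar, State.setArr, Expr.eval, hf₃ (k + 1), hc₂]
          · simp only [State.setVar, State.setArr]
            rw [Function.update_of_ne (by omega), hf₃ 1 (by omega), hn₂])
        (s := s₁.setVar (k + 1) 0)
        (by
          refine ⟨?_, ?_, h₂, ?_⟩
          · rintro i' j' hj' (h | ⟨_, h⟩)
            · exact h₁ i' h j' hj'
            · omega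
          · simp [State.setVar, hc]
          · intro x hx
            simp only [State.setVar]
            rw [Function.update_of_ne (by omega), h₃ x hx])
        (by simp [State.setVar])
        (by simp only [State.setVar]; rw [Function.update_of_ne (by omega), hn₁])
      refine ⟨_, _, (Runs.assign _ _ _).seq (r₂.seq (Runs.assign _ _ _)), ?_, ⟨?_, ?_, ?_⟩, ?_, ?_⟩
      · simp only [Expr.cost]; linarith
      · intro i' hi' j hj
        simp only [State.setVar]
        exact g₁ i' j hj (by omega)
      · exact g₂
      · intro x hx
        simp only [State.setVar]
        rw [Function.update_of_ne (by omega), g₃ x hx]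
      · simp [State.setVar, Expr.eval, g₀]
      · simp only [State.setVar]
        rw [Function.update_of_ne (by omega), hn₂])
    (s := s₀)
    (by
      refine ⟨by simp, fun _ _ => rfl, fun x hx => ?_⟩
      simp only [hs₀, State.setVar]
      rw [Function.update_of_ne (by omega)])
    (by simp [hs₀, State.setVar])
    (by
      simp only [hs₀, State.setVar]
      rw [Function.update_of_ne (by omega), hn])
  refine ⟨_, s', (Runs.assign _ _ _).seq r, ?_, hv, harr, hvar⟩
  simp only [Expr.cost]; linarith

/-- The location of the variables in the program of `set`. -/
def pairLoc (k : ℕ) : ℕ → ℕ :=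
  fun x => if x = 1 then k + 1 else k

/-- The machine program for a program over finite structures; no variable below `k` is changed. -/
def Cmd.compile : Cmd → ℕ → Prog
  | .set a t, k => .seq (fill 2 k (t.compile (pairLoc k) (k + 2)))
      (fill (a + 3) k (.assign (k + 2) (.get 2 (.add (.get 1 (.var k)) (.var (k + 1))))))
  | .seq c d, k => .seq (c.compile k) (d.compile k)
  | .iter c, k => .seq (.assign k (.lit 0)) (.loop (.sub (.var 1) (.var k))
      (.seq (c.compile (k + 1)) (.assign k (.add (.var k) (.lit 1)))))

/-- A `set` fills the scratch array 2 first and copies it afterwards, so all entries are computed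
from the old contents. An `iter` multiplies the time by about `n`, which keeps it polynomial for a
fixed program. -/
theorem Cmd.runs_compile (c : Cmd) (k : ℕ) (hk : 1 < k) :
    ∃ b : Polynomial ℕ, ∀ {n : ℕ} (X : Arrays n) (s : State), Represents X s →
      ∃ t s', Runs (c.compile k) s t s' ∧ t ≤ b.eval n ∧ Represents (c.eval X) s' ∧
        s'.arr 0 = s.arr 0 ∧ ∀ x < k, s'.var x = s.var x := by
  induction c generalizing k with
  | set a τ =>
    obtain ⟨b, hb⟩ := τ.runs_compile (pairLoc k) (k + 2)
      (fun x => by unfold pairLoc; split <;> omega) (by omega)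
    refine ⟨(Polynomial.X + 1) * ((Polynomial.X + 1) * (b + Polynomial.C 14) + Polynomial.C 10) +
      (Polynomial.X + 1) * ((Polynomial.X + 1) * (Polynomial.C 20) + Polynomial.C 10)
      + Polynomial.C 4, fun {n} X s hX => ?_⟩
    obtain ⟨t₁, s₁, r₁, ht₁, hv₁, ha₁, hf₁⟩ := runs_fill (a := 2) (k := k) (n := n)
      (B := b.eval n) (p := τ.compile (pairLoc k) (k + 2)) (s := s) hk (by omega)
      (fun i j => if h : i < n ∧ j < n then τ.eval X (pairEnv ⟨i, h.1⟩ ⟨j, h.2⟩) else 0)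
      (fun s => Represents X s) hX.size hX.row hX
      (fun s s' hs hv ha => ⟨(hv 1 hk).trans hs.size,
        fun i hi => by rw [ha 1 (by omega), hs.row i hi],
        fun a i j => by rw [ha _ (by omega), hs.entry]⟩)
      (by
        intro i j s hi hj hJ h₁ h₂ h₃ _
        obtain ⟨t, s', hr, ht, hv, ha, hf⟩ := hb X (pairEnv ⟨i, hi⟩ ⟨j, hj⟩) s hJ (fun x => by
          unfold pairLoc pairEnv; split <;> simp [h₂, h₃])
        exact ⟨t, s', hr, ht, by rw [hv]; simp [hi, hj], ha, hf⟩)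
    obtain ⟨t₂, s₂, r₂, ht₂, hv₂, ha₂, hf₂⟩ := runs_fill (a := a + 3) (k := k) (n := n)
      (B := 6) (p := .assign (k + 2) (.get 2 (.add (.get 1 (.var k)) (.var (k + 1))))) (s := s₁)
      hk (by omega)
      (fun i j => if h : i < n ∧ j < n then τ.eval X (pairEnv ⟨i, h.1⟩ ⟨j, h.2⟩) else 0)
      (fun s => s.arr 2 = s₁.arr 2) ((hf₁ 1 hk).trans hX.size)
      (fun i hi => by rw [ha₁ 1 (by omega), hX.row i hi]) rfl
      (fun s s' hs hv ha => (ha 2 (by omega)).trans hs)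
      (by
        intro i j s hi hj hJ h₁ h₂ h₃ h₄
        refine ⟨_, _, Runs.assign _ _ _, by simp [Expr.cost], ?_, rfl, ?_⟩
        · simp only [State.setVar, Function.update_self, Expr.eval, h₂, h₃, h₄ i hi, hJ]
          rw [hv₁ i hi j hj]
        · intro x hx
          simp only [State.setVar]
          rw [Function.update_of_ne (by omega)])
    refine ⟨_, s₂, r₁.seq r₂, ?_, ⟨?_, ?_, ?_⟩, ?_, ?_⟩
    · simp; linarith
    · rw [hf₂ 1 hk, hf₁ 1 hk, hX.size]
    · intro i hi; rw [ha₂ 1 (by omega), ha₁ 1 (by omega), hX.row i hi]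
    · intro a' i j
      by_cases h : a' = a
      · subst h
        rw [hv₂ i i.2 j j.2]
        simp [Cmd.eval]
      · rw [ha₂ _ (by omega), ha₁ _ (by omega), hX.entry]
        simp [Cmd.eval, h]
    · rw [ha₂ _ (by omega), ha₁ _ (by omega)]
    · intro x hx; rw [hf₂ x hx, hf₁ x hx]
  | seq c d ihc ihd =>
    obtain ⟨b, hb⟩ := ihc k hk
    obtain ⟨b', hb'⟩ := ihd k hk
    refine ⟨b + b', fun X s hX => ?_⟩
    obtain ⟨t₁, s₁, r₁, ht₁, hX₁, ha₁, hf₁⟩ := hb X s hX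
    obtain ⟨t₂, s₂, r₂, ht₂, hX₂, ha₂, hf₂⟩ := hb' _ s₁ hX₁
    refine ⟨_, s₂, r₁.seq r₂, ?_, hX₂, ha₂.trans ha₁, fun x hx => (hf₂ x hx).trans (hf₁ x hx)⟩
    simp; omega
  | iter c ih =>
    obtain ⟨b, hb⟩ := ih (k + 1) (by omega)
    refine ⟨(Polynomial.X + 1) * (b + Polynomial.C 8) + Polynomial.C 2, fun {n} X s hX => ?_⟩
    obtain ⟨t', s', r, ht, ⟨hv, harr, hvar⟩, -⟩ := Runs.for (b := 1) (c := k) (n := n)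
      (B := b.eval n + 4)
      (p := .seq (c.compile (k + 1)) (.assign k (.add (.var k) (.lit 1))))
      (fun i s' => Represents (c.eval^[i] X) s' ∧ s'.arr 0 = s.arr 0 ∧ ∀ x < k, s'.var x = s.var x)
      (by
        rintro i s₁ hi ⟨h₁, h₂, h₃⟩ hc hn
        obtain ⟨t₂, s₂, r₂, ht₂, hX₂, ha₂, hf₂⟩ := hb _ s₁ h₁
        refine ⟨_, _, r₂.seq (Runs.assign _ _ _), ?_, ⟨?_, ?_, ?_⟩, ?_, ?_⟩
        · simp only [Expr.cost]; omega
        · rw [Function.iterate_succ_apply']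
          refine hX₂.congr ?_ rfl
          simp only [State.setVar]
          rw [Function.update_of_ne (by omega)]
        · exact ha₂.trans h₂
        · intro x hx
          simp only [State.setVar]
          rw [Function.update_of_ne (by omega), hf₂ x (by omega), h₃ x hx]
        · simp [State.setVar, Expr.eval, hf₂ k, hc]
        · simp only [State.setVar]
          rw [Function.update_of_ne (by omega), hf₂ 1 (by omega), hn])
      (s := s.setVar k 0)
      (by
        refine ⟨hX.congr ?_ rfl, rfl, fun x hx => ?_⟩ <;> simp only [State.setVar] <;>
          rw [Function.update_of_ne (by omega)])
      (by simp [State.setVar])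
      (by
        simp only [State.setVar]
        rw [Function.update_of_ne (by omega), hX.size])
    refine ⟨_, s', (Runs.assign _ _ _).seq r, ?_, hv, harr, hvar⟩
    simp [Expr.cost]; linarith

end RAM

/-! ### Loading the input and reading off two diagonal sums -/

namespace RAM

theorem runs_diagSum (a k : ℕ) (hk : 2 < k) :
    ∃ b : Polynomial ℕ, ∀ {n : ℕ} (X : Arrays n) (s : State), Represents X s → s.var 2 = 0 →
      ∃ t s', Runs ((Tm.sum 0 (.get a 0 0)).compile (fun _ => 2) k) s t s' ∧ t ≤ b.eval n ∧
        s'.var k = ∑ i : Fin n, X a i i ∧ s'.arr = s.arr ∧ ∀ x < k, s'.var x = s.var x := by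
  obtain ⟨b, hb⟩ := (Tm.sum 0 (.get a 0 0)).runs_compile (fun _ => 2) k (fun _ => hk) (by omega)
  refine ⟨b + Polynomial.C 8, fun {n} X s hX h2 => ?_⟩
  -- For `n = 0` there is no environment `ℕ → Fin n`, so the run is written out. Otherwise the
  -- constant environment 0 fits the content of register 2.
  rcases Nat.eq_zero_or_pos n with rfl | hn
  · refine ⟨_, _, (Runs.assign _ _ _).seq ((Runs.assign _ _ _).seq (Runs.loop_false ?_)),
      ?_, ?_, rfl, ?_⟩
    · simp only [State.setVar, Expr.eval]
      rw [Function.update_of_ne (by omega), Function.update_of_ne (by omega), hX.size]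
      simp
    · simp [Expr.cost]
    · simp [State.setVar, Expr.eval]
    · intro x hx
      simp only [State.setVar]
      rw [Function.update_of_ne (by omega), Function.update_of_ne (by omega)]
  · obtain ⟨t, s', hr, ht, hv, ha, hf⟩ := hb X (fun _ => ⟨0, hn⟩) s hX (fun _ => h2)
    exact ⟨t, s', hr, by simp; omega, by rw [hv]; simp [Tm.eval], ha, hf⟩

/-- Array `0` holds `A`, the other arrays are zero. -/
def inputArrays {n : ℕ} (A : Fin n → Fin n → ℕ) : Arrays n :=
  fun a i j => if a = 0 then A i j else 0

/-- Make the tables that represent a matrix found in the input at the position `off + 1`, after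
its dimension. -/
def setup (off : ℕ) : Prog :=
  .seq (.assign 1 (.get 0 (.lit off))) (.seq
    (.loop (.sub (.var 1) (.var 2)) (.seq (.store 1 (.var 2) (.var 3))
      (.seq (.assign 3 (.add (.var 3) (.var 1))) (.assign 2 (.add (.var 2) (.lit 1))))))
    (.seq (fill 3 2 (.assign 4
      (.get 0 (.add (.lit (off + 1)) (.add (.get 1 (.var 2)) (.var 3))))))
      (.assign 2 (.lit 0))))

/-- In the absence of multiplication the row offsets `i * n` are accumulated in register 3. Register
2 ends as 0 because `runs_diagSum` takes its free variables from there. The arrays that are not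
written are 0 from the start, as `inputArrays` demands. -/
theorem runs_setup (off : ℕ) :
    ∃ b : Polynomial ℕ, ∀ {n : ℕ} (A : Fin n → Fin n → ℕ) (l : List ℕ), l.getD off 0 = n →
      (∀ i j : Fin n, l.getD (off + 1 + (i * n + j)) 0 = A i j) →
      ∃ t s', Runs (setup off) (start l) t s' ∧ t ≤ b.eval n ∧
        Represents (inputArrays A) s' ∧ s'.var 2 = 0 ∧ s'.arr 0 = (start l).arr 0 := by
  refine ⟨(Polynomial.X + 1) * Polynomial.C 16 + (Polynomial.X + 1) *
    ((Polynomial.X + 1) * (Polynomial.C 24) + Polynomial.C 10) + Polynomial.C 10,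
    fun {n} A l hl hA => ?_⟩
  obtain ⟨t₁, s₁, r₁, ht₁, ⟨hrow, hacc, h0, harr⟩, hn₁⟩ := Runs.for (b := 1) (c := 2) (n := n)
    (B := 12)
    (p := (.seq (.store 1 (.var 2) (.var 3))
      (.seq (.assign 3 (.add (.var 3) (.var 1))) (.assign 2 (.add (.var 2) (.lit 1))))))
    (fun i s => (∀ i' < i, s.arr 1 i' = i' * n) ∧ s.var 3 = i * n ∧
      s.arr 0 = (start l).arr 0 ∧ ∀ a x, s.arr (a + 2) x = 0)
    (by
      rintro i s hi ⟨h₁, h₂, h₃, h₄⟩ hc hn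
      refine ⟨_, _, (Runs.store _ _ _ _).seq ((Runs.assign _ _ _).seq (Runs.assign _ _ _)),
        ?_, ⟨?_, ?_, ?_, ?_⟩, ?_, ?_⟩
      · simp [Expr.cost]
      · intro i' hi'
        simp only [State.setVar, State.setArr, Function.update_self, Expr.eval, hc, h₂]
        by_cases h : i' = i
        · subst h; simp
        · rw [Function.update_of_ne h, h₁ i' (by omega)]
      · simp [State.setVar, State.setArr, Expr.eval, h₂, hn]; ring
      · simp [State.setVar, State.setArr, h₃]
      · intro a x; simp [State.setVar, State.setArr, h₄]
      · simp [State.setVar, State.setArr, Expr.eval, hc]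
      · simp [State.setVar, State.setArr, hn])
    (s := (start l).setVar 1 n)
    (by simp [State.setVar, start])
    (by simp [State.setVar, start])
    (by simp [State.setVar])
  obtain ⟨t₂, s₂, r₂, ht₂, hv₂, ha₂, hf₂⟩ := runs_fill (a := 3) (k := 2) (n := n) (B := 8)
    (p := .assign 4 (.get 0 (.add (.lit (off + 1)) (.add (.get 1 (.var 2)) (.var 3)))))
    (s := s₁) (by omega) (by omega) (fun i j => l.getD (off + 1 + (i * n + j)) 0)
    (fun s => s.arr 0 = (start l).arr 0) hn₁ hrow h0
    (fun s s' hs _ ha => (ha 0 (by omega)).trans hs)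
    (by
      intro i j s hi hj hJ h₁ h₂ h₃ h₄
      refine ⟨_, _, Runs.assign _ _ _, by simp [Expr.cost], ?_, rfl, ?_⟩
      · simp only [State.setVar, Function.update_self, Expr.eval, h₂, h₃, h₄ i hi, hJ]
        simp [start]
      · intro x hx
        simp only [State.setVar]
        rw [Function.update_of_ne (by omega)])
  have hinit : (Expr.get 0 (.lit off)).eval (start l) = n := by
    simpa [Expr.eval, start] using hl
  have r₀ := Runs.assign 1 (.get 0 (.lit off)) (start l)
  rw [hinit] at r₀
  refine ⟨_, _, r₀.seq (r₁.seq (r₂.seq (Runs.assign _ _ _))),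
    ?_, ⟨?_, ?_, ?_⟩, ?_, ?_⟩
  · simp [Expr.cost]
    nlinarith
  · simp [State.setVar, hf₂ 1, hn₁]
  · intro i hi
    simp [State.setVar, ha₂, hrow i hi]
  · intro a i j
    by_cases h : a = 0
    · subst h
      have := hv₂ i i.2 j j.2
      simp only [State.setVar, zero_add, this, hA]
      simp [inputArrays]
    · simp only [State.setVar]
      rw [ha₂ _ (by omega), show a + 3 = (a + 1) + 2 by ring, harr]
      simp [inputArrays, h]
  · simp [State.setVar, Expr.eval]
  · simp [State.setVar, ha₂, h0]

/-- The second sum is computed from base register 4 and so leaves the first one in register 3. Array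
0 is never written, which keeps the raw input available for a later test. -/
theorem runs_program (c : Cmd) (a₁ a₂ off : ℕ) :
    ∃ (prog : Prog) (b : Polynomial ℕ), ∀ {n : ℕ} (A : Fin n → Fin n → ℕ) (l : List ℕ),
      l.getD off 0 = n → (∀ i j : Fin n, l.getD (off + 1 + (i * n + j)) 0 = A i j) →
      ∃ t s', Runs prog (start l) t s' ∧ t ≤ b.eval n ∧
        s'.var 3 = ∑ i : Fin n, c.eval (inputArrays A) a₁ i i ∧
        s'.var 4 = ∑ i : Fin n, c.eval (inputArrays A) a₂ i i ∧
        s'.arr 0 = (start l).arr 0 := by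
  obtain ⟨b₁, h₁⟩ := runs_setup off
  obtain ⟨b₂, h₂⟩ := c.runs_compile 3 (by omega)
  obtain ⟨b₃, h₃⟩ := runs_diagSum a₁ 3 (by omega)
  obtain ⟨b₄, h₄⟩ := runs_diagSum a₂ 4 (by omega)
  refine ⟨.seq (setup off) (.seq (c.compile 3)
    (.seq ((Tm.sum 0 (.get a₁ 0 0)).compile (fun _ => 2) 3)
      ((Tm.sum 0 (.get a₂ 0 0)).compile (fun _ => 2) 4))), b₁ + b₂ + b₃ + b₄,
    fun {n} A l hl hA => ?_⟩
  obtain ⟨t₁, s₁, r₁, ht₁, hX₁, hz₁, ha₁⟩ := h₁ A l hl hA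
  obtain ⟨t₂, s₂, r₂, ht₂, hX₂, ha₂, hf₂⟩ := h₂ _ s₁ hX₁
  have hz₂ : s₂.var 2 = 0 := by rw [hf₂ 2 (by omega), hz₁]
  obtain ⟨t₃, s₃, r₃, ht₃, hv₃, ha₃, hf₃⟩ := h₃ _ s₂ hX₂ hz₂
  obtain ⟨t₄, s₄, r₄, ht₄, hv₄, ha₄, hf₄⟩ := h₄ _ s₃
    (hX₂.congr (hf₃ 1 (by omega)) ha₃) (by rw [hf₃ 2 (by omega), hz₂])
  refine ⟨_, s₄, r₁.seq (r₂.seq (r₃.seq r₄)), ?_, ?_, hv₄, ?_⟩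
  · simp; omega
  · rw [hf₄ 3 (by omega), hv₃]
  · rw [ha₄, ha₃, ha₂, ha₁]

end RAM

/-! ### From programs over finite structures to polynomial time -/

namespace FallColouring

open RAM

theorem inputSize_ge_length (l : List ℕ) : l.length ≤ inputSize l := by
  induction l with
  | nil => simp [inputSize]
  | cons a l ih =>
    simp only [inputSize, List.map_cons, List.sum_cons, List.length_cons] at *
    omega

theorem eval_le_eval (b : Polynomial ℕ) {m n : ℕ} (h : m ≤ n) : b.eval m ≤ b.eval n := by
  rw [Polynomial.eval_eq_sum, Polynomial.eval_eq_sum]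
  exact Finset.sum_le_sum fun i _ => Nat.mul_le_mul_left _ (Nat.pow_le_pow_left h i)

open Classical in
/-- The adjacency matrix as an array. -/
noncomputable def adjArray {n : ℕ} (G : SimpleGraph (Fin n)) : Fin n → Fin n → ℕ :=
  fun i j => if G.Adj i j then 1 else 0

theorem getD_encodeGraph_zero (G : InputGraph) : (encodeGraph G).getD 0 0 = G.1 := rfl

theorem getD_encodeGraph (G : InputGraph) (i j : Fin G.1) :
    (encodeGraph G).getD (0 + 1 + (i * G.1 + j)) 0 = adjArray G.2 i j := by
  have hlt : (i : ℕ) * G.1 + j < G.1 * G.1 := by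
    have := Nat.mul_le_mul_right G.1 (Nat.succ_le_of_lt i.2)
    have := j.2
    nlinarith
  have h1 : (⟨i * G.1 + j, hlt⟩ : Fin (G.1 * G.1)).divNat = i := by
    apply Fin.ext
    simp only [Fin.coe_divNat]
    rw [mul_comm, Nat.mul_add_div (by have := j.2; omega), Nat.div_eq_of_lt j.2, add_zero]
  have h2 : (⟨i * G.1 + j, hlt⟩ : Fin (G.1 * G.1)).modNat = j := by
    apply Fin.ext
    simp only [Fin.coe_modNat]
    rw [mul_comm, Nat.mul_add_mod, Nat.mod_eq_of_lt j.2]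
  rw [encodeGraph, show 0 + 1 + ((i : ℕ) * G.1 + j) = (i * G.1 + j) + 1 by ring,
    List.getD_cons_succ, List.getD_eq_getElem _ _ (by simpa using hlt), List.getElem_ofFn, h1, h2]
  rfl

theorem le_inputSize (G : InputGraph) : G.1 ≤ inputSize (encodeGraph G) := by
  refine le_trans ?_ (inputSize_ge_length _)
  simp only [encodeGraph, List.length_cons, List.length_ofFn]
  nlinarith [Nat.le_mul_self G.1]

/-- A function on graphs is computable in polynomial time if it is the sum of the diagonal entries
of `a₂` after the program `c`, or `0` if some diagonal entry of `a₁` is not `0`. -/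
theorem polyTimeOn_of_cmd {P : InputGraph → Prop} {f : InputGraph → ℕ} (c : Cmd) (a₁ a₂ : ℕ)
    (h : ∀ G, P G → f G = if ∑ i, c.eval (inputArrays (adjArray G.2)) a₁ i i = 0 then
      ∑ i, c.eval (inputArrays (adjArray G.2)) a₂ i i else 0) :
    PolyTimeOn P encodeGraph f := by
  obtain ⟨prog, b, hb⟩ := runs_program c a₁ a₂ 0
  refine ⟨.seq prog (.cond (.var 3) (.assign 0 (.lit 0)) (.assign 0 (.var 4))),
    b + Polynomial.C 4, fun G hG => ?_⟩
  obtain ⟨t, s, hr, ht, h₃, h₄, -⟩ := hb (adjArray G.2) (encodeGraph G)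
    (getD_encodeGraph_zero G) (getD_encodeGraph G)
  have hle := ht.trans (eval_le_eval b (le_inputSize G))
  rw [h G hG, ← h₃, ← h₄]
  by_cases h0 : s.var 3 = 0
  · refine ⟨_, _, hr.seq (Runs.cond_false h0 (Runs.assign _ _ _)), ?_, ?_⟩
    · simp [Expr.cost]; omega
    · simp [State.setVar, Expr.eval, h0]
  · refine ⟨_, _, hr.seq (Runs.cond_true h0 (Runs.assign _ _ _)), ?_, ?_⟩
    · simp [Expr.cost]; omega
    · simp [State.setVar, Expr.eval, h0]

/-- The number `k` heads the input list, so the matrix is read at offset 1 and `k` itself at the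
end. Equality with `k` is tested by adding the two truncated differences; register 3 is added as
well, so that the single test is zero exactly for a yes-instance. -/
theorem polyTimeDecidableOn_of_cmd {P : InputGraph → Prop} {Q : InputGraph × ℕ → Prop} (c : Cmd)
    (a₁ a₂ : ℕ)
    (h : ∀ G k, P G → (Q (G, k) ↔ ∑ i, c.eval (inputArrays (adjArray G.2)) a₁ i i = 0 ∧
      ∑ i, c.eval (inputArrays (adjArray G.2)) a₂ i i = k)) :
    PolyTimeDecidableOn (fun x => P x.1) encodeGraphNat Q := by
  obtain ⟨prog, b, hb⟩ := runs_program c a₁ a₂ 1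
  refine ⟨.seq prog (.cond (.add (.var 3) (.add (.sub (.var 4) (.get 0 (.lit 0)))
    (.sub (.get 0 (.lit 0)) (.var 4)))) (.assign 0 (.lit 0)) (.assign 0 (.lit 1))),
    b + Polynomial.C 20, fun x hx => ?_⟩
  obtain ⟨G, k⟩ := x
  obtain ⟨t, s, hr, ht, h₃, h₄, ha⟩ := hb (adjArray G.2) (encodeGraphNat (G, k))
    (getD_encodeGraph_zero G) (fun i j => by
      rw [encodeGraphNat, show 1 + 1 + ((i : ℕ) * G.1 + j) = (0 + 1 + (i * G.1 + j)) + 1 by ring,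
        List.getD_cons_succ, getD_encodeGraph])
  have hsize : inputSize (encodeGraph G) ≤ inputSize (encodeGraphNat (G, k)) := by
    simp [encodeGraphNat, inputSize]
  have hle := ht.trans (eval_le_eval b ((le_inputSize G).trans hsize))
  have hk : s.arr 0 0 = k := by rw [ha]; simp [start, encodeGraphNat]
  have hQ := h G k hx
  rw [← h₃, ← h₄] at hQ
  by_cases h0 : Q (G, k)
  · refine ⟨_, _, hr.seq (Runs.cond_false ?_ (Runs.assign _ _ _)), ?_, ?_⟩
    · have := hQ.1 h0
      simp [Expr.eval, hk, this]
    · simp [Expr.cost]; omega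
    · simp [State.setVar, Expr.eval, h0]
  · refine ⟨_, _, hr.seq (Runs.cond_true ?_ (Runs.assign _ _ _)), ?_, ?_⟩
    · simp only [Expr.eval, hk]
      intro h
      exact h0 (hQ.2 (by omega))
    · simp [Expr.cost]; omega
    · simp [State.setVar, Expr.eval, h0]

end FallColouring

/-! ### Searching for an augmenting path -/

namespace FallColouring

/-- A matching of `B` as an involution; the fixed points are the vertices that are not covered. -/
structure IsMate {α : Type*} (B : SimpleGraph α) (f : α → α) : Prop where
  invol : ∀ y, f (f y) = y
  adj : ∀ y, f y ≠ y → B.Adj y (f y)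

/-- The state of a search for an augmenting path. -/
structure Search (α : Type*) where
  /-- the vertices that can be reached from the root by an alternating path of even length -/
  even : α → Prop
  /-- the other vertices found so far -/
  odd : α → Prop
  /-- `M u` is a matching that misses the even vertex `u` instead of the root -/
  M : α → α → α
  /-- `P u a`: the odd vertex `a` is on the path to `u` -/
  P : α → α → Prop
  /-- the predecessor of an odd vertex -/
  p : α → α

/-- The invariant of the search with root `r` for the matching `mate`. Two even vertices `u` and `v`
belong to the same blossom if `P u = P v`. -/
structure Search.Inv {α : Type*} (B : SimpleGraph α) (mate : α → α) (r : α) (S : Search α) :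
    Prop where
  mate_mate : IsMate B mate
  mate_root : mate r = r
  even_root : S.even r
  not_odd : ∀ {y}, S.even y → ¬ S.odd y
  isMate : ∀ {u}, S.even u → IsMate B (S.M u)
  fixed : ∀ {u}, S.even u → ∀ y, S.M u y = y ↔ y = u ∨ (mate y = y ∧ y ≠ r)
  covered : ∀ {y}, S.even y ∨ S.odd y → mate y = y → y = r
  outside : ∀ {u y}, S.even u → ¬ S.even y → ¬ S.odd y → S.M u y = mate y
  closed : ∀ {y}, S.even y ∨ S.odd y → S.even (mate y) ∨ S.odd (mate y)
  even_p : ∀ {a}, S.odd a → S.even (S.p a)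
  even_mate : ∀ {a}, S.odd a → S.even (mate a)
  odd_of_P : ∀ {u a}, S.even u → S.P u a → S.odd a
  -- `M u` arises from `mate` by flipping the path to `u`: an odd vertex is matched backwards if it
  -- is on the path and keeps its partner otherwise.
  M_of_P : ∀ {u a}, S.even u → S.P u a → S.M u a = S.p a
  M_of_not_P : ∀ {u a}, S.even u → S.odd a → ¬ S.P u a → S.M u a = mate a
  not_P_root : ∀ a, ¬ S.P r a
  P_mate : ∀ {a}, S.odd a → ∀ z, S.P (mate a) z ↔ S.P (S.p a) z ∨ z = a
  not_P_p : ∀ {a}, S.odd a → ¬ S.P (S.p a) a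
  P_trans : ∀ {y a z}, S.even y → S.P y a → S.P (S.p a) z → S.P y z
  -- The odd vertices on one path are linearly ordered by precedence.
  P_linear : ∀ {y a z}, S.even y → S.P y a → S.P y z → z = a ∨ S.P (S.p a) z ∨ S.P (S.p z) a
  P_congr : ∀ {u y}, S.even u → S.even y → S.even (S.M u y) → ∀ z, S.P y z ↔ S.P (S.M u y) z

open Classical in
/-- Exchange the partners so that `v` and `w` are matched. -/
noncomputable def join {α : Type*} (f : α → α) (v w : α) : α → α :=
  fun y => if y = v then w else if y = w then v else f y

theorem IsMate.join {α : Type*} {B : SimpleGraph α} {f : α → α} (hf : IsMate B f) {v w : α}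
    (hv : f v = v) (hw : f w = w) (h : B.Adj v w) : IsMate B (join f v w) := by
  have hne := h.ne
  constructor
  · intro y
    have := hf.invol y
    unfold FallColouring.join
    grind
  · intro y
    have := hf.adj y
    have := h.symm
    unfold FallColouring.join
    grind

variable {α : Type*} {B : SimpleGraph α} {mate : α → α} {r : α} {S : Search α}

/-- The initial state of the search. -/
def Search.single (mate : α → α) (r : α) (p : α → α) : Search α where
  even y := y = r
  odd _ := False
  M _ := mate
  P _ _ := False
  p := p

theorem Search.inv_single (hm : IsMate B mate) (hr : mate r = r) (p : α → α) :
    (Search.single mate r p).Inv B mate r := by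
  constructor <;> simp_all [Search.single]
  intro y; by_cases h : y = r <;> simp_all

/-- The matching that is found if an even vertex `v` has an uncovered neighbour `w`. -/
theorem Search.Inv.augment (h : S.Inv B mate r) {v w : α} (hv : S.even v) (hvw : B.Adj v w)
    (hw : ¬ S.even w) (hw' : ¬ S.odd w) (hmw : mate w = w) :
    IsMate B (join (S.M v) v w) ∧
      ∀ y, join (S.M v) v w y = y ↔ mate y = y ∧ y ≠ r ∧ y ≠ w := by
  have hvv : S.M v v = v := (h.fixed hv v).2 (Or.inl rfl)
  have hww : S.M v w = w := (h.outside hv hw hw').trans hmw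
  refine ⟨(h.isMate hv).join hvv hww hvw, fun y => ?_⟩
  have h1 := h.fixed hv y
  have h2 := h.mate_root
  have h3 := @Search.Inv.covered _ _ _ _ _ h v (Or.inl hv)
  have hne := hvw.ne
  have h4 : r ≠ w := fun e => hw (e ▸ h.even_root)
  unfold FallColouring.join
  grind

open Classical in
/-- The search after the step from the even vertex `v` to the new vertex `w`. -/
noncomputable def Search.grow (mate : α → α) (S : Search α) (v w : α) : Search α where
  even y := S.even y ∨ y = mate w
  odd y := S.odd y ∨ y = w
  M x y := if x = mate w then (if y = mate w then mate w else join (S.M v) v w y) else S.M x y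
  P y a := if y = mate w then S.P v a ∨ a = w else S.P y a
  p y := if y = w then v else S.p y

/-- The path to `v` is prolonged by the edge to `w` and the matching edge to `mate w`. Matching `v`
with `w` in `M v` releases `mate w`, which becomes the new even vertex. -/
theorem Search.Inv.grow (h : S.Inv B mate r) {v w : α} (hv : S.even v) (hvw : B.Adj v w)
    (hw : ¬ S.even w) (hw' : ¬ S.odd w) (hmw : mate w ≠ w) :
    (S.grow mate v w).Inv B mate r := by
  have hmm := h.mate_mate.invol w
  -- The explored vertices are closed under `mate`, so the partner of a new vertex is new.
  have hx : ¬ S.even (mate w) ∧ ¬ S.odd (mate w) := by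
    have := @Search.Inv.closed _ _ _ _ _ h (mate w)
    rw [hmm] at this
    tauto
  obtain ⟨hx, hx'⟩ := hx
  have hrw : mate w ≠ r := fun e => hx (e ▸ h.even_root)
  have hrw' : w ≠ r := fun e => hw (e ▸ h.even_root)
  have hvm : v ≠ mate w := fun e => hx (e ▸ hv)
  have hne := hvw.ne
  have hMw := h.outside hv hw hw'
  have hMm := h.outside hv hx hx'
  have hvv : S.M v v = v := (h.fixed hv v).2 (Or.inl rfl)
  have hinv := (h.isMate hv).invol
  have hadj := (h.isMate hv).adj
  have hsymm := hvw.symm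
  constructor
  · exact h.mate_mate
  · exact h.mate_root
  · exact Or.inl h.even_root
  · intro y
    have := @h.not_odd y
    simp only [Search.grow]; grind
  · intro u hu
    simp only [Search.grow] at hu ⊢
    by_cases hu' : u = mate w
    · subst hu'
      simp only [if_true]
      constructor
      · intro y
        have := hinv y
        unfold FallColouring.join
        grind
      · intro y
        have := hadj y
        unfold FallColouring.join
        grind
    · simp only [if_neg hu']
      exact h.isMate (by tauto)
  · intro u hu y
    simp only [Search.grow] at hu ⊢
    by_cases hu' : u = mate w
    · subst hu'
      simp only [if_true]
      have h1 := h.fixed hv y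
      have h2 := @h.covered v (Or.inl hv)
      have h3 := h.mate_root
      unfold FallColouring.join
      grind
    · simp only [if_neg hu']
      exact h.fixed (by tauto) y
  · intro y
    have := @h.covered y
    simp only [Search.grow]
    grind
  · intro u y
    have := @h.outside v y hv
    have := @h.outside u y
    simp only [Search.grow]
    unfold FallColouring.join
    grind
  · intro y
    have := @h.closed y
    simp only [Search.grow]
    grind
  · intro a
    have := @h.even_p a
    simp only [Search.grow]
    grind
  · intro a
    have := @h.even_mate a
    simp only [Search.grow]
    grind
  · intro u a
    have := @h.odd_of_P u a
    have := @h.odd_of_P v a hv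
    simp only [Search.grow]
    grind
  · intro u a
    have := @h.M_of_P u a
    have := @h.M_of_P v a hv
    have := @h.odd_of_P u a
    have := @h.odd_of_P v a hv
    have := @h.not_odd v hv
    simp only [Search.grow]
    unfold FallColouring.join
    grind
  · intro u a
    have := @h.M_of_not_P u a
    have := @h.M_of_not_P v a hv
    have := @h.outside u w
    have := @h.not_odd v hv
    simp only [Search.grow]
    unfold FallColouring.join
    grind
  · intro a
    have := h.not_P_root a
    simp only [Search.grow]
    grind
  · intro a ha z
    simp only [Search.grow] at ha ⊢
    have := @h.P_mate a
    have := @h.even_mate a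
    have := @h.even_p a
    grind
  · intro a ha
    simp only [Search.grow] at ha ⊢
    have := @h.not_P_p a
    have := @h.even_p a
    have := @h.odd_of_P v w hv
    grind
  · intro y a z
    simp only [Search.grow]
    have := @h.P_trans y a z
    have := @h.P_trans v a z hv
    have := @h.odd_of_P v a hv
    have := @h.odd_of_P y a
    have := @h.even_p a
    grind
  · intro y a z
    simp only [Search.grow]
    have := @h.P_linear y a z
    have := @h.P_linear v a z hv
    have := @h.odd_of_P v a hv
    have := @h.odd_of_P y a
    have := @h.even_p a
    have := @h.odd_of_P v z hv
    have := @h.odd_of_P y z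
    have := @h.even_p z
    grind
  · intro u y hu hy hm z
    simp only [Search.grow] at hu hy hm ⊢
    have := @h.P_congr u y
    have := @h.P_congr v y hv
    have := @h.outside u (mate w)
    have h5 := fun hu => (@h.isMate u hu).invol y
    have h6 := (@h.isMate v hv).invol y
    have := @h.outside u w
    unfold FallColouring.join at hm ⊢
    grind

end FallColouring

/-! ### Forming a blossom, and the barrier of a stuck search -/

namespace FallColouring

variable {α : Type*} {B : SimpleGraph α} {mate : α → α} {r : α} {S : Search α}

/-- The vertex `y` is a proper descendant of the odd vertex `x` in the search tree. -/
def Search.below (S : Search α) (x y : α) : Prop :=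
  (S.even y ∧ S.P y x) ∨ (S.odd y ∧ S.P (S.p y) x)

open Classical in
/-- The matching that misses the odd vertex `x`, which is on the path to `u` but not on the path to
the neighbour `v` of `u`. -/
noncomputable def Search.cycleMate (S : Search α) (u v x : α) : α → α :=
  fun y => if y = u then v else if y = v then u else if y = x then x else
    if S.below x y then S.M u y else S.M v y

/-- The paths to `u` and to `v` differ at `x`. -/
def Search.diff (S : Search α) (u v x : α) : Prop :=
  ¬ (S.P u x ↔ S.P v x)

theorem Search.diff_comm (S : Search α) (u v x : α) : S.diff u v x ↔ S.diff v u x := by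
  unfold Search.diff; tauto

/-- Outside the explored set `M u` agrees with `mate`, under which the explored set is closed; an
involution cannot enter that set there, hence cannot leave it either. -/
theorem Search.Inv.even_or_odd_M (h : S.Inv B mate r) {u y : α} (hu : S.even u)
    (hy : S.even y ∨ S.odd y) : S.even (S.M u y) ∨ S.odd (S.M u y) := by
  by_contra hc
  push Not at hc
  have h1 := h.outside hu hc.1 hc.2
  rw [(h.isMate hu).invol] at h1
  have h2 := h.closed hy
  rw [h1, h.mate_mate.invol] at h2
  tauto

theorem Search.Inv.M_odd (h : S.Inv B mate r) {u a : α} (hu : S.even u) (ha : S.odd a) :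
    (S.P u a ∧ S.M u a = S.p a) ∨ (¬ S.P u a ∧ S.M u a = mate a) := by
  by_cases hP : S.P u a
  · exact Or.inl ⟨hP, h.M_of_P hu hP⟩
  · exact Or.inr ⟨hP, h.M_of_not_P hu ha hP⟩

/-- The only matched edge that can leave the subtree below `x` is the one from `mate x` up to `x`,
and `M u` uses it only if the path to `u` avoids `x`. -/
theorem Search.Inv.below_M (h : S.Inv B mate r) {u x y : α} (hu : S.even u)
    (hy : S.below x y) : S.below x (S.M u y) ∨ (S.M u y = x ∧ ¬ S.P u x) := by
  have hT := h.even_or_odd_M hu (y := y) (by unfold Search.below at hy; tauto)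
  have hinv := (h.isMate hu).invol y
  rcases hy with ⟨he, hP⟩ | ⟨ho, hP⟩
  · rcases hT with hT | hT
    · exact Or.inl (Or.inl ⟨hT, (h.P_congr hu he hT x).1 hP⟩)
    · rcases h.M_odd hu hT with ⟨h1, h2⟩ | ⟨h1, h2⟩
      · rw [hinv] at h2
        exact Or.inl (Or.inr ⟨hT, h2 ▸ hP⟩)
      · rw [hinv] at h2
        rw [h2] at hP
        rw [← h2] at hP
        have := (h.P_mate hT x).1 (h2 ▸ hP)
        rcases this with h3 | h3
        · exact Or.inl (Or.inr ⟨hT, h3⟩)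
        · exact Or.inr ⟨h3.symm, h3 ▸ h1⟩
  · left
    rcases h.M_odd hu ho with ⟨h1, h2⟩ | ⟨h1, h2⟩
    · exact Or.inl (h2 ▸ ⟨h.even_p ho, hP⟩)
    · exact Or.inl (h2 ▸ ⟨h.even_mate ho, (h.P_mate ho x).2 (Or.inl hP)⟩)

/-- This flips the even path to `x` that runs to `v`, crosses to `u` and descends the path of `u`
back to `x`. Apart from `x`, the vertices split into those below `x`, where `M u` misses only `u`
among explored vertices, and the rest, where `M v` misses `v`. Both regions are invariant under
their matchings, and the edge between `u` and `v` covers the two gaps. -/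
theorem Search.Inv.isMate_cycleMate (h : S.Inv B mate r) {u v x : α} (hu : S.even u)
    (hv : S.even v) (huv : B.Adj u v) (hx : S.P u x) (hx' : ¬ S.P v x) :
    IsMate B (S.cycleMate u v x) ∧
    ∀ y, S.cycleMate u v x y = y ↔ y = x ∨ (mate y = y ∧ y ≠ r) := by
  have ho := h.odd_of_P hu hx
  have bu : S.below x u := Or.inl ⟨hu, hx⟩
  have bv : ¬ S.below x v := by
    have := h.not_odd hv
    unfold Search.below; tauto
  have bx : ¬ S.below x x := by
    have := @h.not_odd x
    have := h.not_P_p ho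
    unfold Search.below; tauto
  have hMu : ∀ y, S.below x y → S.below x (S.M u y) := fun y hy => by
    rcases h.below_M hu hy with h1 | ⟨-, h1⟩
    · exact h1
    · exact absurd hx h1
  -- As `x` is not on the path to `v`, `M v` matches it with `mate x`, which is below `x`. So
  -- nothing else outside the subtree is matched with `x`.
  have hMv : ∀ y, ¬ S.below x y → y ≠ x → ¬ S.below x (S.M v y) ∧ S.M v y ≠ x := by
    intro y hy hyx
    constructor
    · intro hb
      have := h.below_M hv hb
      rw [(h.isMate hv).invol] at this
      tauto
    · intro he
      have h1 := (h.isMate hv).invol y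
      rw [he, h.M_of_not_P hv ho hx'] at h1
      exact hy (Or.inl (h1 ▸ ⟨h.even_mate ho, (h.P_mate ho x).2 (Or.inr rfl)⟩))
  have huu : S.M u u = u := (h.fixed hu u).2 (Or.inl rfl)
  have hvv : S.M v v = v := (h.fixed hv v).2 (Or.inl rfl)
  have hne := huv.ne
  have hxu : x ≠ u := fun e => h.not_odd hu (e ▸ ho)
  have hxv : x ≠ v := fun e => h.not_odd hv (e ▸ ho)
  refine ⟨⟨fun y => ?_, fun y => ?_⟩, fun y => ?_⟩
  · have h1 := (h.isMate hu).invol y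
    have h2 := (h.isMate hv).invol y
    have := hMu y
    have := hMv y
    unfold Search.cycleMate
    grind
  · have := (h.isMate hu).adj y
    have := (h.isMate hv).adj y
    have := huv.symm
    unfold Search.cycleMate
    grind
  · have := h.fixed hu y
    have := h.fixed hv y
    have := h.covered (Or.inl hu)
    have := h.covered (Or.inl hv)
    have := h.mate_root
    unfold Search.cycleMate
    grind

theorem Search.Inv.cycleMate_outside (h : S.Inv B mate r) {u v x y : α} (hu : S.even u)
    (hv : S.even v) (hx : S.P u x) (he : ¬ S.even y) (ho : ¬ S.odd y) :
    S.cycleMate u v x y = mate y := by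
  have := h.outside hu he ho
  have := h.outside hv he ho
  have := h.odd_of_P hu hx
  unfold Search.cycleMate
  grind

theorem Search.Inv.cycleMate_odd (h : S.Inv B mate r) {u v x a : α} (hu : S.even u)
    (hv : S.even v) (ha : S.odd a) (hax : a ≠ x) :
    S.cycleMate u v x a = S.M u a ∨ S.cycleMate u v x a = S.M v a := by
  have := @h.not_odd u
  have := @h.not_odd v
  unfold Search.cycleMate
  grind

theorem Search.cycleMate_cases (S : Search α) (u v x y : α) :
    (y = u ∧ S.cycleMate u v x y = v) ∨ (y = v ∧ S.cycleMate u v x y = u) ∨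
    (y = x ∧ S.cycleMate u v x y = x) ∨
      S.cycleMate u v x y = S.M u y ∨ S.cycleMate u v x y = S.M v y := by
  unfold Search.cycleMate
  grind

/-- On the path to `u` the vertices shared with `v` come before all others: if `y` preceded a shared
`z`, it would also lie on the path to `v` by transitivity. -/
theorem Search.Inv.P_p_of_diff (h : S.Inv B mate r) {u v y z : α} (hu : S.even u) (hv : S.even v)
    (hy : S.P u y) (hy' : ¬ S.P v y) (hz : ¬ S.diff u v z) :
    (S.P (S.p y) z ↔ S.P u z) ∧ (S.P (mate y) z ↔ S.P u z) := by
  have h1 : S.P (S.p y) z ↔ S.P u z := by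
    refine ⟨h.P_trans hu hy, fun hz' => ?_⟩
    unfold Search.diff at hz
    rcases h.P_linear hu hy hz' with rfl | h1 | h1
    · tauto
    · exact h1
    · exact absurd (h.P_trans hv (by tauto) h1) hy'
  refine ⟨h1, ?_⟩
  rw [h.P_mate (h.odd_of_P hu hy), h1]
  refine ⟨?_, Or.inl⟩
  rintro (h2 | rfl)
  · exact h2
  · exact hy

open Classical in
/-- The search after the blossom of the edge between the even vertices `u` and `v` is formed. -/
noncomputable def Search.merge (S : Search α) (u v : α) : Search α where
  even y := S.even y ∨ S.diff u v y
  odd y := S.odd y ∧ ¬ S.diff u v y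
  M x := if S.diff u v x then (if S.P u x then S.cycleMate u v x else S.cycleMate v u x) else S.M x
  P y a := ¬ S.diff u v a ∧ (if S.diff u v y then S.P u a else S.P y a)
  p := S.p

/-- The odd vertices of the cycle become even and are removed from all paths. Every vertex of the
cycle is left with the common part of the paths to `u` and `v`, which is what puts them into one
blossom. -/
theorem Search.Inv.merge (h : S.Inv B mate r) {u v : α} (hu : S.even u) (hv : S.even v)
    (huv : B.Adj u v) : (S.merge u v).Inv B mate r := by
  have hodd : ∀ {x}, S.diff u v x → S.odd x := fun {x} hx => by
    have := @h.odd_of_P u x hu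
    have := @h.odd_of_P v x hv
    unfold Search.diff at hx
    tauto
  have hne : ∀ {x}, S.even x → ¬ S.diff u v x := fun hx hd => h.not_odd hx (hodd hd)
  have hPp : ∀ {y z}, S.diff u v y → ¬ S.diff u v z →
      (S.P (S.p y) z ↔ S.P u z) ∧ (S.P (mate y) z ↔ S.P u z) := fun {y z} hy hz => by
    by_cases hP : S.P u y
    · exact h.P_p_of_diff hu hv hP (by unfold Search.diff at hy; tauto) hz
    · have := h.P_p_of_diff (y := y) (z := z) hv hu (by unfold Search.diff at hy; tauto) hP
        (by rwa [S.diff_comm])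
      unfold Search.diff at hz
      tauto
  -- Collects what is needed about the new matchings in a form symmetric in `u` and `v`, so that the
  -- two sides of the cycle need not be distinguished below.
  have hcyc : ∀ {x}, S.diff u v x →
      (IsMate B ((S.merge u v).M x) ∧
        ∀ y, (S.merge u v).M x y = y ↔ y = x ∨ (mate y = y ∧ y ≠ r)) ∧
      (∀ y, ¬ S.even y → ¬ S.odd y → (S.merge u v).M x y = mate y) ∧
      (∀ a, S.odd a → a ≠ x → (S.merge u v).M x a = S.M u a ∨ (S.merge u v).M x a = S.M v a) ∧
      ∀ y, (y = u ∧ (S.merge u v).M x y = v) ∨ (y = v ∧ (S.merge u v).M x y = u) ∨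
        (y = x ∧ (S.merge u v).M x y = x) ∨
        (S.merge u v).M x y = S.M u y ∨ (S.merge u v).M x y = S.M v y := by
    intro x hx
    by_cases hP : S.P u x
    · have hP' : ¬ S.P v x := by unfold Search.diff at hx; tauto
      simp only [Search.merge, if_pos hx, if_pos hP]
      exact ⟨h.isMate_cycleMate hu hv huv hP hP',
        fun y => h.cycleMate_outside hu hv hP,
        fun y => h.cycleMate_odd hu hv, S.cycleMate_cases u v x⟩
    · have hP' : S.P v x := by unfold Search.diff at hx; tauto
      simp only [Search.merge, if_pos hx, if_neg hP]
      refine ⟨h.isMate_cycleMate hv hu huv.symm hP' hP,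
        fun y => h.cycleMate_outside hv hu hP', fun y h1 h2 => ?_, fun y => ?_⟩
      · exact (h.cycleMate_odd hv hu h1 h2).symm
      · have := S.cycleMate_cases v u x y
        tauto
  have hold : ∀ {x}, ¬ S.diff u v x → (S.merge u v).M x = S.M x := fun hx => by
    simp only [Search.merge, if_neg hx]
  -- a matching edge between an old even vertex and a vertex of the cycle
  have hPm : ∀ {w y}, S.even w → S.diff u v y → ∀ z, (S.merge u v).P y z ↔
      (S.merge u v).P (S.M w y) z := by
    intro w y hw hy z
    simp only [Search.merge, if_pos hy]
    by_cases hz : S.diff u v z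
    · simp [hz]
    · have hP := hPp hy hz
      rcases h.M_odd hw (hodd hy) with ⟨-, h2⟩ | ⟨-, h2⟩
      · rw [h2, if_neg (hne (h.even_p (hodd hy)))]
        tauto
      · rw [h2, if_neg (hne (h.even_mate (hodd hy)))]
        tauto
  have hPm' : ∀ {w y}, S.even w → S.even y ∨ S.diff u v y →
      S.even (S.M w y) ∨ S.diff u v (S.M w y) → ∀ z, (S.merge u v).P y z ↔
      (S.merge u v).P (S.M w y) z := by
    intro w y hw hy hm z
    rcases hy with hy | hy
    · rcases hm with hm | hm
      · have := h.P_congr hw hy hm z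
        simp only [Search.merge, if_neg (hne hy), if_neg (hne hm)]
        tauto
      · have := hPm hw hm z
        rw [(h.isMate hw).invol] at this
        exact this.symm
    · exact hPm hw hy z
  constructor
  · exact h.mate_mate
  · exact h.mate_root
  · exact Or.inl h.even_root
  · intro y hy ho
    rcases hy with hy | hy
    · exact h.not_odd hy ho.1
    · exact ho.2 hy
  · intro x hx
    by_cases hd : S.diff u v x
    · exact (hcyc hd).1.1
    · rw [hold hd]; exact h.isMate (hx.resolve_right hd)
  · intro x hx
    by_cases hd : S.diff u v x
    · exact (hcyc hd).1.2
    · rw [hold hd]; exact h.fixed (hx.resolve_right hd)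
  · intro y hy
    refine h.covered ?_
    have := @hodd y
    simp only [Search.merge] at hy
    tauto
  · intro x y hx hy hy'
    have h1 : ¬ S.even y := fun e => hy (Or.inl e)
    have h2 : ¬ S.odd y := fun e => hy' ⟨e, fun e => hy (Or.inr e)⟩
    by_cases hd : S.diff u v x
    · exact (hcyc hd).2.1 y h1 h2
    · rw [hold hd]; exact h.outside (hx.resolve_right hd) h1 h2
  · intro y hy
    have := @hodd y
    have := @h.closed y
    simp only [Search.merge] at hy ⊢
    tauto
  · intro a ha
    exact Or.inl (h.even_p ha.1)
  · intro a ha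
    exact Or.inl (h.even_mate ha.1)
  · intro x a hx hP
    refine ⟨?_, hP.1⟩
    by_cases hd : S.diff u v x
    · have := hP.2
      rw [if_pos hd] at this
      exact h.odd_of_P hu this
    · have := hP.2
      rw [if_neg hd] at this
      exact h.odd_of_P (hx.resolve_right hd) this
  · intro x a hx hP
    obtain ⟨ha, hP⟩ := hP
    by_cases hd : S.diff u v x
    · rw [if_pos hd] at hP
      have hP' : S.P v a := by unfold Search.diff at ha; tauto
      rcases (hcyc hd).2.2.1 a (h.odd_of_P hu hP) (fun e => ha (e ▸ hd)) with h1 | h1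
      · rw [h1, h.M_of_P hu hP]; rfl
      · rw [h1, h.M_of_P hv hP']; rfl
    · rw [if_neg hd] at hP
      rw [hold hd]
      exact h.M_of_P (hx.resolve_right hd) hP
  · rintro x a hx ⟨ho, ha⟩ hP
    simp only [Search.merge, not_and] at hP
    replace hP := hP ha
    by_cases hd : S.diff u v x
    · rw [if_pos hd] at hP
      have hP' : ¬ S.P v a := by unfold Search.diff at ha; tauto
      rcases (hcyc hd).2.2.1 a ho (fun e => ha (e ▸ hd)) with h1 | h1
      · rw [h1, h.M_of_not_P hu ho hP]
      · rw [h1, h.M_of_not_P hv ho hP']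
    · rw [if_neg hd] at hP
      rw [hold hd]
      exact h.M_of_not_P (hx.resolve_right hd) ho hP
  · intro a hP
    have := hP.2
    rw [if_neg (hne h.even_root)] at this
    exact h.not_P_root a this
  · rintro a ⟨ho, ha⟩ z
    simp only [Search.merge, if_neg (hne (h.even_mate ho)), if_neg (hne (h.even_p ho)),
      h.P_mate ho]
    constructor
    · tauto
    · rintro (h1 | rfl) <;> tauto
  · rintro a ⟨ho, ha⟩ hP
    simp only [Search.merge, if_neg (hne (h.even_p ho))] at hP
    exact h.not_P_p ho hP.2
  · rintro x a z hx ⟨ha, hP⟩ ⟨hz, hP'⟩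
    refine ⟨hz, ?_⟩
    by_cases hd : S.diff u v x
    · rw [if_pos hd] at hP ⊢
      have hpe : ¬ S.diff u v ((S.merge u v).p a) := hne (h.even_p (h.odd_of_P hu hP))
      rw [if_neg hpe] at hP'
      exact h.P_trans hu hP hP'
    · have hx := hx.resolve_right hd
      rw [if_neg hd] at hP ⊢
      have hpe : ¬ S.diff u v ((S.merge u v).p a) := hne (h.even_p (h.odd_of_P hx hP))
      rw [if_neg hpe] at hP'
      exact h.P_trans hx hP hP'
  · rintro x a z hx ⟨ha, hP⟩ ⟨hz, hP'⟩
    simp only [Search.merge]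
    by_cases hd : S.diff u v x
    · rw [if_pos hd] at hP hP'
      rw [if_neg (hne (h.even_p (h.odd_of_P hu hP))), if_neg (hne (h.even_p (h.odd_of_P hu hP')))]
      have := h.P_linear hu hP hP'
      tauto
    · have hx := hx.resolve_right hd
      rw [if_neg hd] at hP hP'
      rw [if_neg (hne (h.even_p (h.odd_of_P hx hP))), if_neg (hne (h.even_p (h.odd_of_P hx hP')))]
      have := h.P_linear hx hP hP'
      tauto
  · intro x y hx hy hm z
    -- Every edge of a new matching is the edge between `u` and `v` or belongs to `M u` or `M v`;
    -- this treats the first kind, and `hPm'` the others.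
    have hPuv : (S.merge u v).P u z ↔ (S.merge u v).P v z := by
      simp only [Search.merge, if_neg (hne hu), if_neg (hne hv)]
      unfold Search.diff
      tauto
    by_cases hd : S.diff u v x
    · rcases (hcyc hd).2.2.2 y with ⟨rfl, h1⟩ | ⟨rfl, h1⟩ | ⟨rfl, h1⟩ | h1 | h1
      · rw [h1]; exact hPuv
      · rw [h1]; exact hPuv.symm
      · rw [h1]
      · rw [h1] at hm ⊢; exact hPm' hu hy hm z
      · rw [h1] at hm ⊢; exact hPm' hv hy hm z
    · rw [hold hd] at hm ⊢
      exact hPm' (hx.resolve_right hd) hy hm z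

/-- An involution without fixed points on a finite set of odd size leaves the set. -/
theorem even_card_of_invol {s : Finset α} (f : α → α) (hf : ∀ y ∈ s, f (f y) = y)
    (hs : ∀ y ∈ s, f y ∈ s) (hne : ∀ y ∈ s, f y ≠ y) : Even s.card := by
  have h := Finset.sum_involution (s := s) (f := fun _ => (1 : ZMod 2)) (fun a _ => f a)
    (fun a _ => by decide) (fun a ha _ => hne a ha) (fun a ha => hs a ha) (fun a ha => hf a ha)
  simp only [Finset.sum_const, nsmul_eq_mul, mul_one] at h
  exact (ZMod.natCast_eq_zero_iff_even).1 h

/-- Tutte's parity argument with the odd vertices as barrier. Each blossom has odd size, so a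
matching covering it sends one of its vertices outside, and in a stuck search this can only be to an
odd vertex. The root and the partners of the odd vertices lie in different blossoms, so there is one
blossom more than there are odd vertices. -/
theorem Search.Inv.not_perfect [Fintype α] (h : S.Inv B mate r)
    (hT : ∀ u v, S.even u → B.Adj u v → S.even v ∨ S.odd v)
    (hP : ∀ u v, S.even u → S.even v → B.Adj u v → ∀ z, S.P u z ↔ S.P v z)
    {f : α → α} (hf : IsMate B f) (hE : ∀ y, S.even y → f y ≠ y) : False := by
  classical
  let cls : α → Finset α := fun u => Finset.univ.filter fun y => S.even y ∧ ∀ z, S.P y z ↔ S.P u z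
  have hself : ∀ u, S.even u → u ∈ cls u := fun u hu => by simp [cls, hu]
  have hodd : ∀ u, S.even u → ¬ Even (cls u).card := by
    intro u hu hev
    -- `M u` pairs up the rest of the blossom.
    have h1 : Even ((cls u).erase u).card := by
      refine even_card_of_invol (S.M u) (fun y _ => (h.isMate hu).invol y) ?_ ?_
      · intro y hy
        obtain ⟨hyu, hy⟩ := Finset.mem_erase.1 hy
        obtain ⟨hye, hyP⟩ : S.even y ∧ ∀ z, S.P y z ↔ S.P u z := by simpa [cls] using hy
        have hinv := (h.isMate hu).invol y
        refine Finset.mem_erase.2 ⟨fun e => ?_, ?_⟩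
        · rw [e, (h.fixed hu u).2 (Or.inl rfl)] at hinv
          exact hyu hinv.symm
        · rcases h.even_or_odd_M hu (Or.inl hye) with h2 | h2
          · have := h.P_congr hu hye h2
            simp only [cls, Finset.mem_filter, Finset.mem_univ, true_and]
            exact ⟨h2, fun z => (this z).symm.trans (hyP z)⟩
          · exfalso
            -- If `y` were matched with an odd vertex `a`, it would be `S.p a` or `mate a`. In the
            -- first case `a` is in `P u` but not in `P y`, in the second it is the other way round.
            rcases h.M_odd hu h2 with ⟨h3, h4⟩ | ⟨h3, h4⟩
            · rw [hinv] at h4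
              have := h.not_P_p h2
              rw [← h4] at this
              exact this ((hyP _).2 h3)
            · have h5 := (h.P_mate h2 (S.M u y)).2 (Or.inr rfl)
              rw [← h4, hinv] at h5
              exact h3 ((hyP _).1 h5)
      · intro y hy e
        obtain ⟨hyu, hy⟩ := Finset.mem_erase.1 hy
        obtain ⟨hye, -⟩ : S.even y ∧ ∀ z, S.P y z ↔ S.P u z := by simpa [cls] using hy
        rcases (h.fixed hu y).1 e with h1 | ⟨h1, h2⟩
        · exact hyu h1
        · exact h2 (h.covered (Or.inl hye) h1)
    rw [← Finset.card_erase_add_one (hself u hu)] at hev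
    exact (Nat.even_add_one.1 hev) h1
  have hex : ∀ u, S.even u → ∃ y, (S.even y ∧ ∀ z, S.P y z ↔ S.P u z) ∧ S.odd (f y) := by
    intro u hu
    by_contra hc
    push Not at hc
    refine hodd u hu (even_card_of_invol f (fun y _ => hf.invol y) ?_ ?_)
    · intro y hy
      have hy' : S.even y ∧ ∀ z, S.P y z ↔ S.P u z := by simpa [cls] using hy
      have hadj := hf.adj y (hE y hy'.1)
      have he : S.even (f y) := (hT y _ hy'.1 hadj).resolve_right (hc y hy')
      simp only [cls, Finset.mem_filter, Finset.mem_univ, true_and]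
      exact ⟨he, fun z => (hP y _ hy'.1 he hadj z).symm.trans (hy'.2 z)⟩
    · intro y hy
      exact hE y (by simpa [cls] using (Finset.mem_filter.1 hy).2.1)
  choose g hg using hex
  let A := {a : α // S.odd a}
  have hbase : ∀ o : Option A, S.even (o.elim r fun a => mate a.1) := by
    rintro (_ | a)
    · exact h.even_root
    · exact h.even_mate a.2
  let F : Option A → A := fun o => ⟨f (g _ (hbase o)), (hg _ (hbase o)).2⟩
  have hF : Function.Injective F := by
    intro o o' he
    have h1 : g _ (hbase o) = g _ (hbase o') := by
      have := congrArg f (Subtype.ext_iff.1 he)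
      simpa only [F, hf.invol] using this
    have h2 : ∀ z, S.P (o.elim r fun a => mate a.1) z ↔ S.P (o'.elim r fun a => mate a.1) z := by
      intro z
      rw [← (hg _ (hbase o)).1.2 z, h1, (hg _ (hbase o')).1.2 z]
    rcases o with _ | a <;> rcases o' with _ | a'
    · rfl
    · exact absurd ((h2 a').2 ((h.P_mate a'.2 _).2 (Or.inr rfl))) (h.not_P_root _)
    · exact absurd ((h2 a).1 ((h.P_mate a.2 _).2 (Or.inr rfl))) (h.not_P_root _)
    · congr 1
      by_contra hne
      have hne' : a.1 ≠ a'.1 := fun e => hne (Subtype.ext e)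
      have h3 : S.P (S.p a') a := by
        have := (h.P_mate a'.2 _).1 ((h2 a).1 ((h.P_mate a.2 _).2 (Or.inr rfl)))
        exact this.resolve_right hne'
      have h4 : S.P (S.p a) a' := by
        have := (h.P_mate a.2 _).1 ((h2 a').2 ((h.P_mate a'.2 _).2 (Or.inr rfl)))
        exact this.resolve_right (Ne.symm hne')
      -- Two odd vertices whose partners share a blossom would precede each other.
      exact h.not_P_p a'.2 (h.P_trans (h.even_p a'.2) h3 h4)
  have := Fintype.card_le_of_injective F hF
  simp at this

end FallColouring

/-! ### Derived terms: connectives, minimisation, access by a stored index -/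

namespace RAM.Tm

/-- The negation of a condition. -/
def not (t : Tm) : Tm := .ite t (.lit 0) (.lit 1)

/-- The conjunction of two conditions. -/
def and (t u : Tm) : Tm := .ite t u (.lit 0)

/-- The disjunction of two conditions. -/
def or (t u : Tm) : Tm := .ite t (.lit 1) u

/-- Equality of two numbers. -/
def eq (t u : Tm) : Tm := not (.add (.sub t u) (.sub u t))

/-- The number `t` is less than the number `u`. -/
def lt (t u : Tm) : Tm := .sub u t

/-- A condition holds for some element. -/
def ex (x : ℕ) (t : Tm) : Tm := .sum x t

/-- The least element `x` with `φ x`. -/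
def least (x y : ℕ) (φ : ℕ → Tm) : Tm :=
  .sum x (.ite (and (φ x) (not (ex y (and (φ y) (lt (.idx y) (.idx x)))))) (.idx x) (.lit 0))

/-- The entry of the array `a` in the row with number `t` and the column `y`. -/
def row (z a : ℕ) (t : Tm) (y : ℕ) : Tm :=
  .sum z (.ite (eq (.idx z) t) (.get a z y) (.lit 0))

variable {n : ℕ} {X : Arrays n} {e : ℕ → Fin n}

/-- The condition `t` is satisfied. -/
def Holds (X : Arrays n) (e : ℕ → Fin n) (t : Tm) : Prop := t.eval X e ≠ 0

instance {t : Tm} : Decidable (Holds X e t) := inferInstanceAs (Decidable (t.eval X e ≠ 0))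

@[simp] theorem holds_get {a x y : ℕ} : Holds X e (.get a x y) ↔ X a (e x) (e y) ≠ 0 := Iff.rfl

@[simp] theorem holds_not {t : Tm} : Holds X e (not t) ↔ ¬ Holds X e t := by
  simp [Holds, not, Tm.eval]

@[simp] theorem holds_and {t u : Tm} : Holds X e (and t u) ↔ Holds X e t ∧ Holds X e u := by
  by_cases h : t.eval X e = 0 <;> simp [Holds, and, Tm.eval, h]

@[simp] theorem holds_or {t u : Tm} : Holds X e (or t u) ↔ Holds X e t ∨ Holds X e u := by
  by_cases h : t.eval X e = 0 <;> simp [Holds, or, Tm.eval, h]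

@[simp] theorem holds_eq {t u : Tm} : Holds X e (eq t u) ↔ t.eval X e = u.eval X e := by
  rw [eq, holds_not]
  simp only [Holds, Tm.eval]
  omega

@[simp] theorem holds_lt {t u : Tm} : Holds X e (lt t u) ↔ t.eval X e < u.eval X e := by
  simp only [Holds, lt, Tm.eval]
  omega

@[simp] theorem holds_ex {x : ℕ} {t : Tm} :
    Holds X e (ex x t) ↔ ∃ i, Holds X (Function.update e x i) t := by
  simp [Holds, ex, Tm.eval]

@[simp] theorem eval_ite {c t u : Tm} :
    (Tm.ite c t u).eval X e = if Holds X e c then t.eval X e else u.eval X e := rfl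

@[simp] theorem eval_lit {c : ℕ} : (Tm.lit c).eval X e = c := rfl

@[simp] theorem eval_idx {x : ℕ} : (Tm.idx x).eval X e = e x := rfl

@[simp] theorem eval_get {a x y : ℕ} : (Tm.get a x y).eval X e = X a (e x) (e y) := rfl

/-- Only the minimum survives in the sum. The condition is a function of the variable name so that
it can be tested at a candidate and at a competitor; the quantification over `e` in `hx` and `hy`
says that no other variable matters. -/
theorem eval_least {x y : ℕ} {φ : ℕ → Tm} (p : Fin n → Prop)
    (hx : ∀ (e : ℕ → Fin n) i, Holds X (Function.update e x i) (φ x) ↔ p i)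
    (hy : ∀ (e : ℕ → Fin n) i, Holds X (Function.update e y i) (φ y) ↔ p i)
    (hxy : x ≠ y) (h : ∃ i, p i) : ∃ i, p i ∧ ∀ e, (least x y φ).eval X e = i := by
  classical
  have hne : (Finset.univ.filter p).Nonempty := by
    obtain ⟨i, hi⟩ := h
    exact ⟨i, by simpa using hi⟩
  let i := (Finset.univ.filter p).min' hne
  have hi : p i := by simpa using (Finset.univ.filter p).min'_mem hne
  have hmin : ∀ j, p j → i ≤ j := fun j hj => Finset.min'_le _ _ (by simpa using hj)
  refine ⟨i, hi, fun e => ?_⟩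
  simp only [least, Tm.eval]
  rw [Finset.sum_eq_single i]
  · rw [if_pos]
    · simp
    · change Holds _ _ _
      simp only [holds_and, hx, hi, holds_not, holds_ex, hy, holds_lt, eval_idx]
      simp only [Function.update_self, Function.update_of_ne hxy, true_and, not_exists, not_and,
        not_lt]
      exact hmin
  · intro j _ hj
    rw [if_neg]
    change ¬ Holds _ _ _
    simp only [holds_and, hx, holds_not, holds_ex, hy, holds_lt, eval_idx]
    simp only [Function.update_self, Function.update_of_ne hxy, not_and, not_not]
    intro hj'
    exact ⟨i, hi, Fin.lt_def.1 (lt_of_le_of_ne (hmin j hj') (Ne.symm hj))⟩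
  · simp

/-- A term can index an array only by variables; summing over the row variable gives access by a
computed number. -/
theorem eval_row {z a y : ℕ} {t : Tm} {u : Fin n}
    (ht : ∀ i, t.eval X (Function.update e z i) = u) (hz : y ≠ z) :
    (row z a t y).eval X e = X a u (e y) := by
  simp only [row, Tm.eval]
  rw [Finset.sum_eq_single u]
  · rw [if_pos]
    · simp [Function.update_of_ne hz]
    · change Holds _ _ _
      rw [holds_eq, ht]
      simp
  · intro j _ hj
    rw [if_neg]
    change ¬ Holds _ _ _
    rw [holds_eq, ht]
    simpa [Fin.ext_iff] using hj
  · simp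

end RAM.Tm

/-! ### Choosing the next step of the search -/

namespace FallColouring

open RAM RAM.Tm

/-- The arrays hold the graph `B` (array `1`), the matching `mate` (array `2`) and the components
of the search state `S` (arrays `3` to `7`). Unary functions are stored as binary ones. -/
structure Encodes {n : ℕ} (B : SimpleGraph (Fin n)) (mate : Fin n → Fin n) (S : Search (Fin n))
    (X : Arrays n) : Prop where
  graph : ∀ i j, X 1 i j ≠ 0 ↔ B.Adj i j
  mate : ∀ i j, X 2 i j = mate i
  even : ∀ i j, X 3 i j ≠ 0 ↔ S.even i
  odd : ∀ i j, X 4 i j ≠ 0 ↔ S.odd i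
  M : ∀ i j, X 5 i j = S.M i j
  P : ∀ i j, X 6 i j ≠ 0 ↔ S.P i j
  p : ∀ i j, X 7 i j = S.p i

/-- An edge that allows the next step of the search: an edge of an even vertex that leads to a new
vertex or to an even vertex of another blossom, or, if no search is under way, any edge of an
uncovered vertex. -/
def Candidate {n : ℕ} (B : SimpleGraph (Fin n)) (mate : Fin n → Fin n) (S : Search (Fin n))
    (u v : Fin n) : Prop :=
  B.Adj u v ∧ ((S.even u ∧ ((¬ S.even v ∧ ¬ S.odd v) ∨ (S.even v ∧ ∃ z, S.diff u v z))) ∨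
    ((∀ y, ¬ S.even y) ∧ mate u = u))

/-- The condition of `Candidate`. -/
def candidateTm : Tm :=
  and (.get 1 0 1) (or
    (and (.get 3 0 0) (or (and (not (.get 3 1 1)) (not (.get 4 1 1)))
      (and (.get 3 1 1) (ex 2 (or (and (.get 6 0 2) (not (.get 6 1 2)))
        (and (.get 6 1 2) (not (.get 6 0 2))))))))
    (and (not (ex 2 (.get 3 2 2))) (eq (.get 2 0 0) (.idx 0))))

/-- Choose a candidate `(U, V)`; array `9` holds `U`, array `10` holds `V`, array `11` tells what to
do (`0` nothing, `1` start a search, `2` augment, `3` grow, `4` merge), and the arrays `12` to `16`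
hold `M U`, `M V`, `P U`, `P V` and the partner of `V`. -/
def chooseCmd : Cmd :=
  .seq (.set 8 candidateTm) <|
  .seq (.set 9 (least 2 3 fun x => ex 4 (.get 8 x 4))) <|
  .seq (.set 10 (least 2 3 fun y => row 4 8 (.get 9 0 0) y)) <|
  .seq (.set 12 (row 2 5 (.get 9 0 0) 0)) <|
  .seq (.set 13 (row 2 5 (.get 10 0 0) 0)) <|
  .seq (.set 14 (row 2 6 (.get 9 0 0) 0)) <|
  .seq (.set 15 (row 2 6 (.get 10 0 0) 0)) <|
  .seq (.set 16 (row 2 2 (.get 10 0 0) 0)) <|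
  .set 11 (.ite (ex 2 (ex 3 (.get 8 2 3)))
    (.ite (not (ex 2 (.get 3 2 2))) (.lit 1)
      (.ite (row 2 3 (.get 10 0 0) 0) (.lit 4)
        (.ite (eq (.get 16 0 0) (.get 10 0 0)) (.lit 2) (.lit 3))))
    (.lit 0))

/-- The state chosen by `chooseCmd`. -/
structure Chosen {n : ℕ} (mate : Fin n → Fin n) (S : Search (Fin n)) (u v : Fin n) (k : ℕ)
    (X : Arrays n) : Prop where
  U : ∀ i j, X 9 i j = u
  V : ∀ i j, X 10 i j = v
  kind : ∀ i j, X 11 i j = k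
  MU : ∀ i j, X 12 i j = S.M u i
  MV : ∀ i j, X 13 i j = S.M v i
  PU : ∀ i j, X 14 i j ≠ 0 ↔ S.P u i
  PV : ∀ i j, X 15 i j ≠ 0 ↔ S.P v i
  W : ∀ i j, X 16 i j = mate v

variable {n : ℕ} {B : SimpleGraph (Fin n)} {mate : Fin n → Fin n} {S : Search (Fin n)}
  {X : Arrays n}

theorem chooseCmd_of_lt {a : ℕ} (ha : a < 8) : chooseCmd.eval X a = X a := by
  simp only [chooseCmd, Cmd.eval]
  repeat rw [Function.update_of_ne (by omega)]

theorem Encodes.congr (h : Encodes B mate S X) {Y : Arrays n} (hY : ∀ a < 8, Y a = X a) :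
    Encodes B mate S Y := by
  constructor
  · rw [hY 1 (by omega)]; exact h.graph
  · rw [hY 2 (by omega)]; exact h.mate
  · rw [hY 3 (by omega)]; exact h.even
  · rw [hY 4 (by omega)]; exact h.odd
  · rw [hY 5 (by omega)]; exact h.M
  · rw [hY 6 (by omega)]; exact h.P
  · rw [hY 7 (by omega)]; exact h.p

theorem Encodes.holds_candidate (h : Encodes B mate S X) (i j : Fin n) :
    Holds X (pairEnv i j) candidateTm ↔ Candidate B mate S i j := by
  simp [candidateTm, pairEnv, h.graph, h.mate, h.even, h.odd, h.P, Candidate, Search.diff,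
    Function.update_apply, Fin.ext_iff, -ne_eq]
  grind

open Classical in
/-- What is done with the candidate `(u, v)`. -/
noncomputable def kindOf (mate : Fin n → Fin n) (S : Search (Fin n)) (v : Fin n) : ℕ :=
  if ∀ y, ¬ S.even y then 1 else if S.even v then 4 else if mate v = v then 2 else 3

-- The new arrays 8 to 16 are disjoint from the encoding in the arrays 1 to 7, so every intermediate
-- stage still encodes `S`.
open Classical in
theorem Encodes.choose (h : Encodes B mate S X) (hc : ∃ u v, Candidate B mate S u v) :
    ∃ u v, Candidate B mate S u v ∧ Chosen mate S u v (kindOf mate S v) (chooseCmd.eval X) := by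
  simp only [chooseCmd, Cmd.eval]
  set X₁ : Arrays n := Function.update X 8 fun i j => candidateTm.eval X (pairEnv i j) with hX₁
  have h8 : ∀ i j, X₁ 8 i j ≠ 0 ↔ Candidate B mate S i j := fun i j => by
    simp only [hX₁, Function.update_self]
    exact h.holds_candidate i j
  obtain ⟨u, hu, hu'⟩ := eval_least (X := X₁) (x := 2) (y := 3) (φ := fun x => ex 4 (.get 8 x 4))
    (fun u => ∃ v, Candidate B mate S u v)
    (fun e i => by simp [Function.update_apply, h8, -ne_eq])
    (fun e i => by simp [Function.update_apply, h8, -ne_eq]) (by omega) hc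
  simp only [hu']
  set X₂ : Arrays n := Function.update X₁ 9 fun _ _ => (u : ℕ) with hX₂
  have h9 : ∀ i j, X₂ 9 i j = u := fun i j => by simp [hX₂]
  have h8' : ∀ i j, X₂ 8 i j ≠ 0 ↔ Candidate B mate S i j := fun i j => by
    rw [← h8]; simp [hX₂]
  -- The first minimisation was over vertices that have a candidate edge, so this one is not over
  -- the empty set.
  obtain ⟨v, hv, hv'⟩ := eval_least (X := X₂) (x := 2) (y := 3)
    (φ := fun y => row 4 8 (.get 9 0 0) y)
    (fun v => Candidate B mate S u v)
    (fun e i => by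
      rw [Holds, eval_row (u := u) (fun _ => by simp [h9]) (by omega), h8']
      simp)
    (fun e i => by
      rw [Holds, eval_row (u := u) (fun _ => by simp [h9]) (by omega), h8']
      simp) (by omega) hu
  simp only [hv']
  refine ⟨u, v, hv, ?_⟩
  set X₃ : Arrays n := Function.update X₂ 10 fun _ _ => (v : ℕ) with hX₃
  have hU : ∀ i j, X₃ 9 i j = u := fun i j => by simp [hX₃, h9]
  have hV : ∀ i j, X₃ 10 i j = v := fun i j => by simp [hX₃]
  have h8'' : ∀ i j, X₃ 8 i j ≠ 0 ↔ Candidate B mate S i j := fun i j => by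
    rw [← h8']; simp [hX₃]
  have hX : Encodes B mate S X₃ := h.congr fun a ha => by
    simp only [hX₃, hX₂, hX₁]
    repeat rw [Function.update_of_ne (by omega)]
  have e12 : ∀ i j, (row 2 5 (.get 9 0 0) 0).eval X₃ (pairEnv i j) = S.M u i := fun i j => by
    rw [eval_row (u := u) (fun _ => by simp [hU]) (by omega), hX.M]; rfl
  simp only [e12]
  set X₄ : Arrays n := Function.update X₃ 12 fun i _ => (S.M u i : ℕ) with hX₄
  have e13 : ∀ i j, (row 2 5 (.get 10 0 0) 0).eval X₄ (pairEnv i j) = S.M v i := fun i j => by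
    rw [eval_row (u := v) (fun _ => by simp [hX₄, hV]) (by omega)]
    simp [hX₄, hX.M, pairEnv]
  simp only [e13]
  set X₅ : Arrays n := Function.update X₄ 13 fun i _ => (S.M v i : ℕ) with hX₅
  have e14 : ∀ i j, (row 2 6 (.get 9 0 0) 0).eval X₅ (pairEnv i j) = X₃ 6 u i := fun i j => by
    rw [eval_row (u := u) (fun _ => by simp [hX₅, hX₄, hU]) (by omega)]
    simp [hX₅, hX₄, pairEnv]
  simp only [e14]
  set X₆ : Arrays n := Function.update X₅ 14 fun i _ => X₃ 6 u i with hX₆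
  have e15 : ∀ i j, (row 2 6 (.get 10 0 0) 0).eval X₆ (pairEnv i j) = X₃ 6 v i := fun i j => by
    rw [eval_row (u := v) (fun _ => by simp [hX₆, hX₅, hX₄, hV]) (by omega)]
    simp [hX₆, hX₅, hX₄, pairEnv]
  simp only [e15]
  set X₇ : Arrays n := Function.update X₆ 15 fun i _ => X₃ 6 v i with hX₇
  have e16 : ∀ i j, (row 2 2 (.get 10 0 0) 0).eval X₇ (pairEnv i j) = mate v := fun i j => by
    rw [eval_row (u := v) (fun _ => by simp [hX₇, hX₆, hX₅, hX₄, hV]) (by omega)]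
    simp [hX₇, hX₆, hX₅, hX₄, hX.mate]
  simp only [e16]
  set X₈ : Arrays n := Function.update X₇ 16 fun _ _ => (mate v : ℕ) with hX₈
  have hX' : Encodes B mate S X₈ := hX.congr fun a ha => by
    simp only [hX₈, hX₇, hX₆, hX₅, hX₄]
    repeat rw [Function.update_of_ne (by omega)]
  have hr : ∀ i j, Holds X₈ (pairEnv i j) (row 2 3 (.get 10 0 0) 0) ↔ S.even v := fun i j => by
    rw [Holds, eval_row (u := v) (fun _ => by simp [hX₈, hX₇, hX₆, hX₅, hX₄, hV]) (by omega),
      hX'.even]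
  have h8₈ : ∀ i j, X₈ 8 i j ≠ 0 ↔ Candidate B mate S i j := fun i j => by
    rw [← h8'']; simp [hX₈, hX₇, hX₆, hX₅, hX₄]
  constructor
  · simp [hX₈, hX₇, hX₆, hX₅, hX₄, hU]
  · simp [hX₈, hX₇, hX₆, hX₅, hX₄, hV]
  · intro i j
    have h16 : ∀ i j, X₈ 16 i j = mate v := by simp [hX₈]
    have h10 : ∀ i j, X₈ 10 i j = v := by simp [hX₈, hX₇, hX₆, hX₅, hX₄, hV]
    have c₀ : Holds X₈ (pairEnv i j) (ex 2 (ex 3 (.get 8 2 3))) := by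
      obtain ⟨u, v, huv⟩ := hc
      rw [holds_ex]
      refine ⟨u, ?_⟩
      rw [holds_ex]
      exact ⟨v, (h8₈ u v).2 huv⟩
    have c₁ : Holds X₈ (pairEnv i j) (not (ex 2 (.get 3 2 2))) ↔ ∀ y, ¬ S.even y := by
      rw [holds_not, holds_ex, not_exists]
      exact forall_congr' fun y => not_congr (hX'.even y y)
    have c₃ : Holds X₈ (pairEnv i j) (eq (.get 16 0 0) (.get 10 0 0)) ↔ mate v = v := by
      rw [holds_eq, eval_get, eval_get, h16, h10, Fin.ext_iff]
    rw [Function.update_self, eval_ite, if_pos c₀, eval_ite, eval_ite, eval_ite]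
    exact if_congr c₁ rfl (if_congr (hr i j) rfl (if_congr c₃ rfl rfl))
  · simp [hX₈, hX₇, hX₆, hX₅, hX₄]
  · simp [hX₈, hX₇, hX₆, hX₅, hX₄]
  · intro i j; rw [← hX.P u i]; simp [hX₈, hX₇, hX₆]
  · intro i j; rw [← hX.P v i]; simp [hX₈, hX₇]
  · simp [hX₈]

theorem Encodes.choose_none (h : Encodes B mate S X) (hc : ¬ ∃ u v, Candidate B mate S u v)
    (i j : Fin n) : chooseCmd.eval X 11 i j = 0 := by
  simp only [chooseCmd, Cmd.eval, Function.update_self]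
  rw [eval_ite, if_neg]
  · rfl
  · simp only [holds_ex, holds_get]
    rintro ⟨u, v, huv⟩
    refine hc ⟨u, v, (h.holds_candidate u v).1 ?_⟩
    rw [Holds]
    simpa [Function.update_apply] using huv

end FallColouring

/-! ### Carrying out the chosen step -/

namespace FallColouring

open RAM RAM.Tm

/-- Distinguish what is to be done. -/
def byKind (t₀ t₁ t₂ t₃ t₄ : Tm) : Tm :=
  .ite (eq (.get 11 0 0) (.lit 1)) t₁ (.ite (eq (.get 11 0 0) (.lit 2)) t₂
    (.ite (eq (.get 11 0 0) (.lit 3)) t₃ (.ite (eq (.get 11 0 0) (.lit 4)) t₄ t₀)))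

/-- The condition `Search.diff` for the chosen vertices. -/
def diffTm (x : ℕ) : Tm :=
  or (and (.get 14 x x) (not (.get 15 x x))) (and (.get 15 x x) (not (.get 14 x x)))

/-- The condition `Search.below`. -/
def belowTm (x y : ℕ) : Tm :=
  or (and (.get 3 y y) (.get 6 y x)) (and (.get 4 y y) (row 2 6 (.get 7 y y) x))

/-- The partner of `y` after the chosen vertices have been matched, if it was `t` before. -/
def joinTm (y : ℕ) (t : Tm) : Tm :=
  .ite (eq (.idx y) (.get 9 0 0)) (.get 10 0 0)
    (.ite (eq (.idx y) (.get 10 0 0)) (.get 9 0 0) t)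

/-- The new value of `M`. -/
def matchingTm : Tm :=
  byKind (.get 5 0 1) (.get 2 1 1) (.get 5 0 1)
    (.ite (eq (.idx 0) (.get 16 0 0))
      (.ite (eq (.idx 1) (.get 16 0 0)) (.get 16 0 0) (joinTm 1 (.get 12 1 1)))
      (.get 5 0 1))
    (.ite (diffTm 0)
      (joinTm 1 (.ite (eq (.idx 1) (.idx 0)) (.idx 0)
        (.ite (belowTm 0 1) (.ite (.get 14 0 0) (.get 12 1 1) (.get 13 1 1))
          (.ite (.get 14 0 0) (.get 13 1 1) (.get 12 1 1)))))
      (.get 5 0 1))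

/-- Carry out the step that has been chosen. -/
def updateCmd : Cmd :=
  -- The matchings come first since `matchingTm` needs the old arrays 2 to 7. Each later command
  -- reads only the array that it rewrites and the arrays 9 to 16.
  .seq (.set 5 matchingTm) <|
  .seq (.set 6 (byKind (.get 6 0 1) (.lit 0) (.get 6 0 1)
    (.ite (eq (.idx 0) (.get 16 0 0)) (or (.get 14 1 1) (eq (.idx 1) (.get 10 0 0))) (.get 6 0 1))
    (and (not (diffTm 1)) (.ite (diffTm 0) (.get 14 1 1) (.get 6 0 1))))) <|
  .seq (.set 7 (byKind (.get 7 0 0) (.get 7 0 0) (.get 7 0 0)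
    (.ite (eq (.idx 0) (.get 10 0 0)) (.get 9 0 0) (.get 7 0 0)) (.get 7 0 0))) <|
  .seq (.set 3 (byKind (.get 3 0 0) (eq (.idx 0) (.get 9 0 0)) (.lit 0)
    (or (.get 3 0 0) (eq (.idx 0) (.get 16 0 0))) (or (.get 3 0 0) (diffTm 0)))) <|
  .seq (.set 4 (byKind (.get 4 0 0) (.lit 0) (.lit 0)
    (or (.get 4 0 0) (eq (.idx 0) (.get 10 0 0))) (and (.get 4 0 0) (not (diffTm 0))))) <|
  .set 2 (byKind (.get 2 0 0) (.get 2 0 0) (joinTm 0 (.get 12 0 0)) (.get 2 0 0) (.get 2 0 0))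

variable {n : ℕ} {B : SimpleGraph (Fin n)} {mate : Fin n → Fin n} {S : Search (Fin n)}
  {X : Arrays n} {u v : Fin n}

theorem holds_ite {e : ℕ → Fin n} {c t u : Tm} :
    Holds X e (.ite c t u) ↔ if Holds X e c then Holds X e t else Holds X e u := by
  simp only [Holds, eval_ite]
  split_ifs <;> simp_all

theorem Encodes.even_eq_zero (h : Encodes B mate S X) (i j : Fin n) : X 3 i j = 0 ↔ ¬ S.even i :=
  (not_iff_comm.1 (h.even i j)).symm

theorem Encodes.odd_eq_zero (h : Encodes B mate S X) (i j : Fin n) : X 4 i j = 0 ↔ ¬ S.odd i :=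
  (not_iff_comm.1 (h.odd i j)).symm

theorem Encodes.P_eq_zero (h : Encodes B mate S X) (i j : Fin n) : X 6 i j = 0 ↔ ¬ S.P i j :=
  (not_iff_comm.1 (h.P i j)).symm

theorem Chosen.PU_eq_zero {k : ℕ} (h : Chosen mate S u v k X) (i j : Fin n) :
    X 14 i j = 0 ↔ ¬ S.P u i :=
  (not_iff_comm.1 (h.PU i j)).symm

theorem Chosen.PV_eq_zero {k : ℕ} (h : Chosen mate S u v k X) (i j : Fin n) :
    X 15 i j = 0 ↔ ¬ S.P v i :=
  (not_iff_comm.1 (h.PV i j)).symm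

theorem holds_belowTm (h : Encodes B mate S X) (i j : Fin n) :
    Holds X (pairEnv i j) (belowTm 0 1) ↔ S.below i j := by
  have hr : Holds X (pairEnv i j) (row 2 6 (.get 7 1 1) 0) ↔ S.P (S.p j) i := by
    rw [Holds, eval_row (u := S.p j) (fun _ => by simp [h.p, pairEnv]) (by omega), h.P]
    rfl
  simp [belowTm, hr, pairEnv, h.even_eq_zero, h.odd_eq_zero, h.P_eq_zero, Search.below]

theorem Encodes.update_none (h : Encodes B mate S X) (hk : ∀ i j, X 11 i j = 0) :
    Encodes B mate S (updateCmd.eval X) := by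
  constructor
  · intro i j; rw [← h.graph]; simp [updateCmd, Cmd.eval]
  · intro i j; simp [updateCmd, Cmd.eval, byKind, hk, h.mate, pairEnv]
  · intro i j
    simp [updateCmd, Cmd.eval, byKind, hk, h.even_eq_zero, pairEnv]
  · intro i j
    simp [updateCmd, Cmd.eval, byKind, hk, h.odd_eq_zero, pairEnv]
  · intro i j
    simp [updateCmd, Cmd.eval, byKind, hk, h.M, pairEnv, matchingTm]
  · intro i j
    simp [updateCmd, Cmd.eval, byKind, hk, h.P_eq_zero, pairEnv]
  · intro i j
    simp [updateCmd, Cmd.eval, byKind, hk, h.p, pairEnv]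

theorem Encodes.update_single (h : Encodes B mate S X) (hc : Chosen mate S u v 1 X) :
    Encodes B mate (Search.single mate u S.p) (updateCmd.eval X) := by
  constructor
  · intro i j; rw [← h.graph]; simp [updateCmd, Cmd.eval]
  · intro i j; simp [updateCmd, Cmd.eval, byKind, hc.kind, h.mate, pairEnv]
  · intro i j
    simp only [updateCmd, Cmd.eval]
    -- The entry is a truth value, so the goal is a `Holds` statement and the lemmas on connectives
    -- apply.
    change Holds _ _ _ ↔ _
    simp [byKind, holds_ite, hc.kind, pairEnv, hc.U, Search.single, Fin.ext_iff]
  · intro i j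
    simp [updateCmd, Cmd.eval, byKind, hc.kind, pairEnv, Search.single]
  · intro i j
    simp [updateCmd, Cmd.eval, byKind, hc.kind, pairEnv, matchingTm, h.mate, Search.single]
  · intro i j
    simp [updateCmd, Cmd.eval, byKind, hc.kind, pairEnv, Search.single]
  · intro i j
    simp [updateCmd, Cmd.eval, byKind, hc.kind, h.p, pairEnv, Search.single]

theorem Encodes.update_augment (h : Encodes B mate S X) (hc : Chosen mate S u v 2 X) :
    Encodes B (join (S.M u) u v) ⟨fun _ => False, fun _ => False, S.M, S.P, S.p⟩
      (updateCmd.eval X) := by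
  constructor
  · intro i j; rw [← h.graph]; simp [updateCmd, Cmd.eval]
  · intro i j
    simp [updateCmd, Cmd.eval, byKind, hc.kind, pairEnv, joinTm, join, hc.U, hc.V, hc.MU,
      Fin.ext_iff]
    split_ifs <;> rfl
  · intro i j
    simp [updateCmd, Cmd.eval, byKind, hc.kind, pairEnv]
  · intro i j
    simp [updateCmd, Cmd.eval, byKind, hc.kind, pairEnv]
  · intro i j
    simp [updateCmd, Cmd.eval, byKind, hc.kind, pairEnv, matchingTm, h.M]
  · intro i j
    simp [updateCmd, Cmd.eval, byKind, hc.kind, pairEnv, h.P_eq_zero]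
  · intro i j
    simp [updateCmd, Cmd.eval, byKind, hc.kind, h.p, pairEnv]

theorem Encodes.update_grow (h : Encodes B mate S X) (hc : Chosen mate S u v 3 X) :
    Encodes B mate (S.grow mate u v) (updateCmd.eval X) := by
  constructor
  · intro i j; rw [← h.graph]; simp [updateCmd, Cmd.eval]
  · intro i j; simp [updateCmd, Cmd.eval, byKind, hc.kind, h.mate, pairEnv]
  · intro i j
    simp only [updateCmd, Cmd.eval]
    change Holds _ _ _ ↔ _
    simp [byKind, holds_ite, hc.kind, pairEnv, hc.W, h.even_eq_zero, Search.grow, Fin.ext_iff]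
  · intro i j
    simp only [updateCmd, Cmd.eval]
    change Holds _ _ _ ↔ _
    simp [byKind, holds_ite, hc.kind, pairEnv, hc.V, h.odd_eq_zero, Search.grow, Fin.ext_iff]
  · intro i j
    simp [updateCmd, Cmd.eval, byKind, hc.kind, matchingTm, hc.W, h.M, joinTm, hc.U, hc.V, hc.MU,
      pairEnv, Search.grow, join, Fin.ext_iff]
    split_ifs <;> simp_all
  · intro i j
    simp only [updateCmd, Cmd.eval]
    change Holds _ _ _ ↔ _
    simp [byKind, holds_ite, hc.kind, pairEnv, hc.V, hc.W, hc.PU_eq_zero, h.P_eq_zero, Search.grow,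
      Fin.ext_iff]
  · intro i j
    simp [updateCmd, Cmd.eval, byKind, hc.kind, h.p, pairEnv, hc.U, hc.V, Search.grow, Fin.ext_iff]
    split_ifs <;> rfl

theorem Chosen.holds_diffTm {k : ℕ} (hc : Chosen mate S u v k X) (e : ℕ → Fin n) (x : ℕ) :
    Holds X e (diffTm x) ↔ S.diff u v (e x) := by
  simp [diffTm, hc.PU_eq_zero, hc.PV_eq_zero, Search.diff]
  tauto

-- For `i` on the path to `v`, `Search.cycleMate` tests `v` before `u`, whereas the program always
-- tests `u` first. The two orders agree because `u ≠ v`.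
open Classical in
theorem Encodes.update_merge (h : Encodes B mate S X) (hc : Chosen mate S u v 4 X) (huv : u ≠ v) :
    Encodes B mate (S.merge u v) (updateCmd.eval X) := by
  have huv' : (u : ℕ) ≠ v := fun e => huv (Fin.ext e)
  constructor
  · intro i j; rw [← h.graph]; simp [updateCmd, Cmd.eval]
  · intro i j; simp [updateCmd, Cmd.eval, byKind, hc.kind, h.mate, pairEnv]
  · intro i j
    simp only [updateCmd, Cmd.eval]
    change Holds _ _ _ ↔ _
    simp [byKind, holds_ite, hc.kind, pairEnv, diffTm, hc.PU_eq_zero, hc.PV_eq_zero,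
      h.even_eq_zero, Search.merge, Search.diff]
    tauto
  · intro i j
    simp only [updateCmd, Cmd.eval]
    change Holds _ _ _ ↔ _
    simp [byKind, holds_ite, hc.kind, pairEnv, diffTm, hc.PU_eq_zero, hc.PV_eq_zero,
      h.odd_eq_zero, Search.merge, Search.diff]
    tauto
  · intro i j
    simp [updateCmd, Cmd.eval, byKind, hc.kind, matchingTm, h.M, joinTm, hc.U, hc.V, hc.MU, hc.MV,
      hc.PU_eq_zero, hc.holds_diffTm, holds_belowTm h]
    simp only [pairEnv, Search.merge, if_true, zero_ne_one, if_false]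
    by_cases hd : S.diff u v i
    · by_cases hP : S.P u i
      · simp only [hd, hP, Search.cycleMate, if_true, Fin.ext_iff]
        split_ifs <;> simp_all
      · simp only [hd, hP, Search.cycleMate, if_true, if_false, Fin.ext_iff]
        split_ifs <;> simp_all
    · simp only [hd, if_false]
  · intro i j
    simp only [updateCmd, Cmd.eval]
    change Holds _ _ _ ↔ _
    simp [byKind, holds_ite, hc.kind, pairEnv, diffTm, hc.PU_eq_zero, hc.PV_eq_zero, h.P_eq_zero,
      Search.merge, Search.diff]
    by_cases h1 : S.P u i <;> by_cases h2 : S.P v i <;> simp only [h1, h2] <;> simp <;> tauto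
  · intro i j
    simp [updateCmd, Cmd.eval, byKind, hc.kind, h.p, pairEnv, Search.merge]

end FallColouring

/-! ### Termination and correctness of the matching algorithm -/

namespace FallColouring

open RAM RAM.Tm

variable {n : ℕ} {B : SimpleGraph (Fin n)} {mate : Fin n → Fin n} {S : Search (Fin n)}
  {X : Arrays n}

/-- One step of the matching algorithm. -/
def stepCmd : Cmd := .seq chooseCmd updateCmd

/-- The states that the matching algorithm can reach. -/
def Valid (B : SimpleGraph (Fin n)) (mate : Fin n → Fin n) (S : Search (Fin n)) : Prop :=
  IsMate B mate ∧ ((∀ y, ¬ S.even y) ∨ ∃ r, S.Inv B mate r ∧ ∃ j, B.Adj r j)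

open Classical in
/-- A quantity that increases with every step of the matching algorithm. -/
noncomputable def progress (mate : Fin n → Fin n) (S : Search (Fin n)) : ℕ :=
  (Finset.univ.filter fun y => mate y ≠ y).card * (n + 1) +
    (Finset.univ.filter fun y => S.even y).card

theorem progress_le (mate : Fin n → Fin n) (S : Search (Fin n)) :
    progress mate S ≤ n * (n + 1) + n := by
  classical
  have h1 := Finset.card_le_univ (Finset.univ.filter fun y => mate y ≠ y)
  have h2 := Finset.card_le_univ (Finset.univ.filter fun y => S.even y)
  simp only [Fintype.card_fin] at h1 h2
  have := Nat.mul_le_mul_right (n + 1) h1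
  unfold progress
  convert Nat.add_le_add this h2

theorem progress_lt_of_even {S' : Search (Fin n)} (h : ∀ y, S.even y → S'.even y) {x : Fin n}
    (hx : ¬ S.even x) (hx' : S'.even x) : progress mate S < progress mate S' := by
  classical
  unfold progress
  refine Nat.add_lt_add_left (Finset.card_lt_card ?_) _
  rw [Finset.ssubset_iff_of_subset (fun y => by simpa using h y)]
  exact ⟨x, by simpa using hx', by simpa using hx⟩

/-- A newly covered vertex gains `n + 1`, while giving up the search loses at most `n`. -/
theorem progress_lt_of_mate {mate' : Fin n → Fin n} {S' : Search (Fin n)}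
    (h : ∀ y, mate y ≠ y → mate' y ≠ y) {x : Fin n} (hx : mate x = x) (hx' : mate' x ≠ x) :
    progress mate S < progress mate' S' := by
  classical
  have h1 : (Finset.univ.filter fun y => mate y ≠ y).card <
      (Finset.univ.filter fun y => mate' y ≠ y).card := by
    refine Finset.card_lt_card ?_
    rw [Finset.ssubset_iff_of_subset (fun y => by simpa using h y)]
    exact ⟨x, by simpa using hx', by simpa using hx⟩
  have h2 := Finset.card_le_univ (Finset.univ.filter fun y => S.even y)
  simp only [Fintype.card_fin] at h2
  have h3 := Nat.mul_le_mul_right (n + 1) (Nat.succ_le_of_lt h1)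
  unfold progress
  rw [Nat.succ_mul] at h3
  refine lt_of_lt_of_le ?_ (Nat.le_add_right _ _)
  refine lt_of_lt_of_le ?_ h3
  refine Nat.add_lt_add_left ?_ _
  convert Nat.lt_succ_of_le h2

theorem Encodes.step_none (h : Encodes B mate S X) (hc : ¬ ∃ u v, Candidate B mate S u v) :
    Encodes B mate S (stepCmd.eval X) :=
  (h.congr fun _ ha => chooseCmd_of_lt ha).update_none (h.choose_none hc)

/-- Starting a search, growing and merging each add an even vertex; augmenting covers another
vertex. In a merge the new even vertex is one at which the paths differ, and it was odd before. -/
theorem Encodes.step (h : Encodes B mate S X) (hV : Valid B mate S)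
    (hc : ∃ u v, Candidate B mate S u v) :
    ∃ mate' S', Encodes B mate' S' (stepCmd.eval X) ∧ Valid B mate' S' ∧
      progress mate S < progress mate' S' := by
  obtain ⟨u, v, ⟨hadj, hcand⟩, hch⟩ := h.choose hc
  have h' : Encodes B mate S (chooseCmd.eval X) := h.congr fun _ ha => chooseCmd_of_lt ha
  have hm := hV.1
  rw [stepCmd, Cmd.eval]
  by_cases hact : ∀ y, ¬ S.even y
  · simp only [kindOf, if_pos hact] at hch
    have hu : mate u = u := by
      rcases hcand with ⟨h1, -⟩ | ⟨-, h1⟩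
      · exact absurd h1 (hact u)
      · exact h1
    exact ⟨mate, _, h'.update_single hch, ⟨hm, Or.inr ⟨u, Search.inv_single hm hu _, v, hadj⟩⟩,
      progress_lt_of_even (fun y hy => absurd hy (hact y)) (hact u) rfl⟩
  · obtain ⟨r, hI, hr⟩ := hV.2.resolve_left hact
    obtain ⟨hu, hcand⟩ := hcand.resolve_right (fun h => hact h.1)
    by_cases hv : S.even v
    · simp only [kindOf, if_neg hact, if_pos hv] at hch
      have hd : ∃ z, S.diff u v z := by tauto
      obtain ⟨z, hz⟩ := hd
      refine ⟨mate, _, h'.update_merge hch hadj.ne, ⟨hm, Or.inr ⟨r, hI.merge hu hv hadj, hr⟩⟩,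
        progress_lt_of_even (fun y hy => Or.inl hy) (x := z) ?_ (Or.inr hz)⟩
      intro hze
      have := @Search.Inv.odd_of_P _ _ _ _ _ hI u z hu
      have := @Search.Inv.odd_of_P _ _ _ _ _ hI v z hv
      have := hI.not_odd hze
      unfold Search.diff at hz
      tauto
    · have hv' : ¬ S.odd v := by tauto
      by_cases hmv : mate v = v
      · simp only [kindOf, if_neg hact, if_neg hv, if_pos hmv] at hch
        obtain ⟨h1, h2⟩ := hI.augment hu hadj hv hv' hmv
        refine ⟨_, _, h'.update_augment hch, ⟨h1, Or.inl fun _ => id⟩,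
          progress_lt_of_mate (fun y hy => ?_) (x := v) hmv ?_⟩
        · rw [Ne, h2]; tauto
        · rw [Ne, h2]; tauto
      · simp only [kindOf, if_neg hact, if_neg hv, if_neg hmv] at hch
        refine ⟨mate, _, h'.update_grow hch, ⟨hm, Or.inr ⟨r, hI.grow hu hadj hv hv' hmv, hr⟩⟩,
          progress_lt_of_even (fun y hy => Or.inl hy) (x := mate v) ?_ (Or.inr rfl)⟩
        intro he
        have := hI.closed (Or.inl he)
        rw [hm.invol] at this
        tauto

theorem Encodes.iterate (N : ℕ) (h : Encodes B mate S X) (hV : Valid B mate S)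
    (hN : n * (n + 1) + n ≤ progress mate S + N) :
    ∃ mate' S', Encodes B mate' S' (stepCmd.eval^[N] X) ∧ Valid B mate' S' ∧
      ¬ ∃ u v, Candidate B mate' S' u v := by
  induction N generalizing mate S X with
  | zero =>
    refine ⟨mate, S, h, hV, fun hc => ?_⟩
    obtain ⟨mate', S', -, -, hlt⟩ := h.step hV hc
    have := progress_le mate' S'
    omega
  | succ N ih =>
    by_cases hc : ∃ u v, Candidate B mate S u v
    · obtain ⟨mate', S', h', hV', hlt⟩ := h.step hV hc
      rw [Function.iterate_succ_apply]
      exact ih h' hV' (by omega)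
    -- Without a candidate the remaining steps change nothing in the encoded state.
    · refine ⟨mate, S, ?_, hV, hc⟩
      clear ih hN
      induction N + 1 generalizing X with
      | zero => exact h
      | succ N ih =>
        rw [Function.iterate_succ_apply]
        exact ih (h.step_none hc)

/-- The matching algorithm. -/
def matchCmd : Cmd := .iter (.iter (.seq stepCmd (.seq stepCmd stepCmd)))

theorem matchCmd_eval : matchCmd.eval X = stepCmd.eval^[3 * (n * n)] X := by
  have h : (Cmd.seq stepCmd (.seq stepCmd stepCmd)).eval (n := n) = stepCmd.eval^[3] := by
    funext Y; rfl
  have h2 : (Cmd.iter (.seq stepCmd (.seq stepCmd stepCmd))).eval (n := n)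
      = stepCmd.eval^[3 * n] := by
    funext Y
    rw [Function.iterate_mul, ← h]; rfl
  rw [← mul_assoc, Function.iterate_mul, ← h2]; rfl

/-- The matching algorithm finds a matching that covers all vertices with a neighbour, if there is
one. -/
theorem Encodes.matchCmd (h : Encodes B mate S X) (hV : Valid B mate S) :
    ∃ mate' S', Encodes B mate' S' (matchCmd.eval X) ∧ IsMate B mate' ∧
      ((∃ f, IsMate B f ∧ ∀ y, (∃ z, B.Adj y z) → f y ≠ y) →
        ∀ y, (∃ z, B.Adj y z) → mate' y ≠ y) := by
  rw [matchCmd_eval]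
  -- The bound on `progress` is `n² + 2n ≤ 3n²`, which is why each round performs three steps.
  obtain ⟨mate', S', h', hV', hc⟩ := h.iterate (3 * (n * n)) hV (by nlinarith)
  refine ⟨mate', S', h', hV'.1, ?_⟩
  rintro ⟨f, hf, hf'⟩ y ⟨z, hyz⟩ hy
  rcases hV'.2 with hact | ⟨r, hI, hr⟩
  · exact hc ⟨y, z, hyz, Or.inr ⟨hact, hy⟩⟩
  · refine hI.not_perfect (fun u v hu huv => ?_) (fun u v hu hv huv => ?_) hf fun y hy => ?_
    · by_contra hn
      exact hc ⟨u, v, huv, Or.inl ⟨hu, Or.inl (by tauto)⟩⟩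
    · by_contra hn
      push Not at hn
      obtain ⟨z, hz⟩ := hn
      exact hc ⟨u, v, huv, Or.inl ⟨hu, Or.inr ⟨hv, z, by unfold Search.diff; tauto⟩⟩⟩
    -- An even vertex has a neighbour: the root by `Valid`, any other one because `mate` covers it.
    -- So the assumed matching covers all even vertices.
    · refine hf' y ?_
      by_cases hyr : y = r
      · exact hyr ▸ hr
      · exact ⟨mate' y, hV'.1.adj y fun e => hyr (hI.covered (Or.inl hy) e)⟩

end FallColouring

namespace FallColouring

/-! ### Fall spectra -/

variable {V : Type*} {G : SimpleGraph V}

/-- Frees later constructions from `Fin k`: colours may be images, dependent pairs or orbits. -/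
theorem card_mem_fallSpectrum {α : Type*} [Finite α] (c : V → α)
    (hadj : ∀ v w, G.Adj v w → c v ≠ c w) (hsurj : Function.Surjective c)
    (hfall : ∀ v j, j ≠ c v → ∃ w, G.Adj v w ∧ c w = j) : Nat.card α ∈ fallSpectrum G := by
  let e := Finite.equivFin α
  refine ⟨Coloring.mk (fun v => e (c v)) fun {v w} h he => hadj v w h (e.injective he),
    e.surjective.comp hsurj, fun v j hj => ?_⟩
  obtain ⟨w, hw, hwj⟩ := hfall v (e.symm j) fun h => hj (by
    change j = e (c v)
    rw [← h, e.apply_symm_apply])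
  exact ⟨w, hw, (congrArg e hwj).trans (e.apply_symm_apply j)⟩

theorem adj_of_component_ne {v w : V}
    (h : Gᶜ.connectedComponentMk v ≠ Gᶜ.connectedComponentMk w) : G.Adj v w := by
  by_contra hn
  refine h (ConnectedComponent.sound (Adj.reachable ?_))
  rw [compl_adj]
  exact ⟨fun e => h (e ▸ rfl), hn⟩

/-- The fall colourings of a graph are composed of fall colourings of its co-components. -/
theorem mem_fallSpectrum_iff [Finite V] (G : SimpleGraph V) (k : ℕ) :
    k ∈ fallSpectrum G ↔ ∃ κ : Gᶜ.ConnectedComponent → ℕ,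
      (∀ C, κ C ∈ fallSpectrum (coComponent G C)) ∧ ∑ᶠ C, κ C = k := by
  classical
  have : Finite Gᶜ.ConnectedComponent := Quot.finite _
  have := Fintype.ofFinite Gᶜ.ConnectedComponent
  constructor
  · rintro ⟨c, hsurj, hfall⟩
    -- No colour occurs in two co-components, since these are completely joined.
    have hcomp : ∀ v w, c v = c w →
        Gᶜ.connectedComponentMk v = Gᶜ.connectedComponentMk w := fun v w h => by
      by_contra hn
      exact c.valid (adj_of_component_ne hn) h
    refine ⟨fun C => Nat.card (c '' C.supp), fun C => ?_, ?_⟩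
    · refine card_mem_fallSpectrum (fun v => ⟨c v, v, v.2, rfl⟩)
        (fun v w h he => c.valid h (Subtype.ext_iff.1 he)) ?_ ?_
      · rintro ⟨_, v, hv, rfl⟩
        exact ⟨⟨v, hv⟩, rfl⟩
      · rintro v ⟨_, w, hw, rfl⟩ hne
        obtain ⟨x, hx, hxc⟩ := hfall v (c w) fun h => hne (Subtype.ext h)
        refine ⟨⟨x, ?_⟩, hx, Subtype.ext hxc⟩
        rw [ConnectedComponent.mem_supp_iff] at hw ⊢
        rw [hcomp x w hxc, hw]
    · rw [finsum_eq_sum_of_fintype, ← Nat.card_sigma]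
      refine (Nat.card_eq_of_bijective (β := Fin k) (fun x => x.2.1) ⟨?_, ?_⟩).trans
        (Nat.card_fin k)
      · rintro ⟨C, _, v, hv, rfl⟩ ⟨D, _, w, hw, rfl⟩ h
        rw [ConnectedComponent.mem_supp_iff] at hv hw
        have h' := hcomp v w h
        rw [hv, hw] at h'
        subst h'
        simp only at h
        simp [h]
      · intro j
        obtain ⟨v, rfl⟩ := hsurj j
        exact ⟨⟨Gᶜ.connectedComponentMk v, c v, v, rfl, rfl⟩, rfl⟩
  · rintro ⟨κ, hκ, rfl⟩
    choose c hc using hκ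
    have hcard : ∑ᶠ C, κ C = Nat.card (Σ C, Fin (κ C)) := by
      rw [finsum_eq_sum_of_fintype, Nat.card_sigma]
      simp
    rw [hcard]
    -- Replacing the component of `v` by an equal `C` here avoids casts between the colour sets of
    -- different components.
    have hcol : ∀ (C : Gᶜ.ConnectedComponent) (v : C.supp),
        (⟨Gᶜ.connectedComponentMk v, c _ ⟨v, rfl⟩⟩ : Σ C, Fin (κ C)) = ⟨C, c C v⟩ := by
      rintro C ⟨v, rfl⟩
      rfl
    refine card_mem_fallSpectrum
      (fun v => (⟨Gᶜ.connectedComponentMk v, c _ ⟨v, rfl⟩⟩ : Σ C, Fin (κ C))) ?_ ?_ ?_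
    · intro v w hadj he
      have h1 := congrArg Sigma.fst he
      simp only at h1
      have h2 := hcol (Gᶜ.connectedComponentMk v) ⟨w, h1.symm⟩
      rw [← he] at h2
      have h3 := sigma_mk_injective h2
      exact (c _).valid (v := ⟨v, rfl⟩) (w := ⟨w, h1.symm⟩) hadj h3
    · rintro ⟨C, j⟩
      obtain ⟨v, rfl⟩ := (hc C).1 j
      exact ⟨v, hcol C v⟩
    · rintro v ⟨C, j⟩ hne
      by_cases hC : Gᶜ.connectedComponentMk v = C
      · subst hC
        obtain ⟨w, hw, rfl⟩ := (hc _).2 ⟨v, rfl⟩ j fun h => hne (by rw [h])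
        exact ⟨w, hw, hcol _ w⟩
      · obtain ⟨w, rfl⟩ := (hc C).1 j
        refine ⟨w, adj_of_component_ne fun h => hC ?_, hcol C w⟩
        rw [h]; exact w.2

/-! ### The structure of `(P₃ + P₁)`-free graphs -/

/-- If both adjacencies failed, then in `G` the path with ends `x`, `z` and middle vertex `y` would
form an induced `P₃ + P₁` together with `w`. In the complement this is the paw with triangle `w`,
`x`, `z` and pendant vertex `y`. -/
theorem IsFree.adj_or_adj (hG : IsFree P3addP1 G) {x z w y : V} (hxz : Gᶜ.Adj x z)
    (hwx : Gᶜ.Adj w x) (hwz : Gᶜ.Adj w z) (hwy : Gᶜ.Adj w y) (hyx : y ≠ x) (hyz : y ≠ z) :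
    Gᶜ.Adj y x ∨ Gᶜ.Adj y z := by
  by_contra hn
  push Not at hn
  have h1 : G.Adj y x := by
    by_contra h; exact hn.1 ((compl_adj _ _ _).2 ⟨hyx, h⟩)
  have h2 : G.Adj y z := by
    by_contra h; exact hn.2 ((compl_adj _ _ _).2 ⟨hyz, h⟩)
  rw [compl_adj] at hxz hwx hwz hwy
  refine hG ⟨⟨⟨Sum.elim ![x, y, z] ![w], ?_⟩, ?_⟩⟩
  · rintro (i | i) (j | j) <;> fin_cases i <;> fin_cases j <;>
      simp [hyx, hyz, hxz.1, hwx.1, hwz.1, hwy.1, hyx.symm, hyz.symm, hxz.1.symm, Ne.symm hwx.1,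
        Ne.symm hwz.1, Ne.symm hwy.1]
  · intro i j
    change G.Adj (Sum.elim ![x, y, z] ![w] i) (Sum.elim ![x, y, z] ![w] j) ↔ _
    rcases i with i | i <;> rcases j with j | j <;> fin_cases i <;> fin_cases j <;>
      simp [pathGraph_adj, h1, h2, h1.symm, h2.symm, hxz.2, hwx.2, hwz.2, hwy.2, G.adj_comm z x,
        G.adj_comm x w, G.adj_comm z w, G.adj_comm y w]

/-- Three pairwise adjacent vertices. -/
def IsTriangle (H : SimpleGraph V) (a b c : V) : Prop :=
  H.Adj a b ∧ H.Adj b c ∧ H.Adj a c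

/-- Induction along a walk. If `s` sees the corners `a` and `b`, its neighbour `y` sees one of them
by the triangle `s`, `a`, `b`, and then a second corner by the triangle `a`, `b`, `c`. -/
theorem IsFree.adj_two (hG : IsFree P3addP1 G) {a b c y : V} (h : IsTriangle Gᶜ a b c)
    (hy : Gᶜ.Reachable a y) : (Gᶜ.Adj y a ∧ Gᶜ.Adj y b) ∨ (Gᶜ.Adj y b ∧ Gᶜ.Adj y c) ∨
      (Gᶜ.Adj y a ∧ Gᶜ.Adj y c) := by
  have key : ∀ {a b c s y : V}, IsTriangle Gᶜ a b c → Gᶜ.Adj s a → Gᶜ.Adj s b → Gᶜ.Adj s y →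
      (Gᶜ.Adj y a ∧ Gᶜ.Adj y b) ∨ (Gᶜ.Adj y b ∧ Gᶜ.Adj y c) ∨ (Gᶜ.Adj y a ∧ Gᶜ.Adj y c) := by
    rintro a b c s y ⟨hab, hbc, hac⟩ hsa hsb hsy
    by_cases e1 : y = a
    · subst e1; exact Or.inr (Or.inl ⟨hab, hac⟩)
    by_cases e2 : y = b
    · subst e2; exact Or.inr (Or.inr ⟨hab.symm, hbc⟩)
    by_cases e3 : y = c
    · subst e3; exact Or.inl ⟨hac.symm, hbc.symm⟩
    rcases hG.adj_or_adj hab hsa hsb hsy e1 e2 with h | h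
    · rcases hG.adj_or_adj hbc hab hac h.symm e2 e3 with h' | h' <;> tauto
    · rcases hG.adj_or_adj hac hab.symm hbc h.symm e1 e3 with h' | h' <;> tauto
  obtain ⟨hab, hbc, hac⟩ := h
  rw [reachable_iff_reflTransGen] at hy
  induction hy with
  | refl => exact Or.inr (Or.inl ⟨hab, hac⟩)
  | tail _ hsy ih =>
    rcases ih with ⟨h1, h2⟩ | ⟨h1, h2⟩ | ⟨h1, h2⟩
    · exact key ⟨hab, hbc, hac⟩ h1 h2 hsy
    · have := key ⟨hbc, hac.symm, hab.symm⟩ h1 h2 hsy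
      tauto
    · have := key ⟨hac, hbc.symm, hab⟩ h1 h2 hsy
      tauto

/-- The vertex `i` is in a triangle. -/
def InTriangle (H : SimpleGraph V) (i : V) : Prop :=
  ∃ j k, IsTriangle H i j k

theorem IsFree.inTriangle (hG : IsFree P3addP1 G) {i y : V} (h : InTriangle Gᶜ i)
    (hy : Gᶜ.Reachable i y) : InTriangle Gᶜ y := by
  obtain ⟨b, c, ht⟩ := h
  have := hG.adj_two ht hy
  obtain ⟨hab, hbc, hac⟩ := ht
  rcases this with ⟨h1, h2⟩ | ⟨h1, h2⟩ | ⟨h1, h2⟩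
  · exact ⟨i, b, h1, hab, h2⟩
  · exact ⟨b, c, h1, hbc, h2⟩
  · exact ⟨i, c, h1, hac, h2⟩

/-- In the complement, every edge of a component with a triangle dominates the component. -/
theorem IsFree.adj_of_inTriangle (hG : IsFree P3addP1 G) {x z y : V} (h : InTriangle Gᶜ x)
    (hxz : Gᶜ.Adj x z) (hy : Gᶜ.Reachable x y) : Gᶜ.Adj y x ∨ Gᶜ.Adj y z := by
  obtain ⟨b, c, hab, hbc, hac⟩ := h
  have key : ∀ {b}, Gᶜ.Adj x b → Gᶜ.Adj z b → Gᶜ.Adj y x ∨ Gᶜ.Adj y z := fun {b} h1 h2 => by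
    have := hG.adj_two (a := x) (b := z) (c := b) ⟨hxz, h2, h1⟩ hy
    tauto
  -- `z` sees a corner other than `x`, so the edge lies in a triangle itself, and `y` sees two of
  -- its three corners.
  rcases hG.adj_two ⟨hab, hbc, hac⟩ hxz.reachable with h1 | h1 | h1
  · exact key hab h1.2
  · exact key hab h1.1
  · exact key hac h1.2

theorem isFree_threeP1_iff : IsFree threeP1 G ↔ ∀ a b c, ¬ IsTriangle Gᶜ a b c := by
  constructor
  · rintro h a b c ⟨h1, h2, h3⟩
    rw [compl_adj] at h1 h2 h3
    refine h ⟨⟨⟨![a, b, c], ?_⟩, ?_⟩⟩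
    · intro i j
      fin_cases i <;> fin_cases j <;>
        simp [h1.1, h2.1, h3.1, Ne.symm h1.1, Ne.symm h2.1, Ne.symm h3.1]
    · intro i j
      change G.Adj (![a, b, c] i) (![a, b, c] j) ↔ _
      fin_cases i <;> fin_cases j <;>
        simp [h1.2, h2.2, h3.2, G.adj_comm b a, G.adj_comm c a, G.adj_comm c b]
  · rintro h ⟨f⟩
    have key : ∀ i j : Fin 3, i ≠ j → Gᶜ.Adj (f i) (f j) := fun i j hij => by
      rw [compl_adj, f.map_adj_iff]
      exact ⟨f.injective.ne hij, id⟩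
    exact h (f 0) (f 1) (f 2) ⟨key _ _ (by decide), key _ _ (by decide), key _ _ (by decide)⟩

theorem reachable_of_mem_supp {C : Gᶜ.ConnectedComponent} {x y : V} (hx : x ∈ C.supp)
    (hy : y ∈ C.supp) : Gᶜ.Reachable x y :=
  ConnectedComponent.exact (hx.trans hy.symm)

/-- A co-component without triangle in the complement is `3P₁`-free. -/
theorem isFree_threeP1_coComponent {C : Gᶜ.ConnectedComponent}
    (h : ∀ i ∈ C.supp, ¬ InTriangle Gᶜ i) : IsFree threeP1 (coComponent G C) := by
  rw [isFree_threeP1_iff]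
  rintro a b c ⟨h1, h2, h3⟩
  simp only [compl_adj, comap_adj, Function.Embedding.subtype_apply, ne_eq,
    Subtype.ext_iff] at h1 h2 h3
  exact h a a.2 ⟨b, c, (compl_adj _ _ _).2 h1, (compl_adj _ _ _).2 h2, (compl_adj _ _ _).2 h3⟩

/-- In a co-component with a triangle in the complement, adjacency is transitive. -/
theorem IsFree.reachable_coComponent (hG : IsFree P3addP1 G) {C : Gᶜ.ConnectedComponent}
    {i : V} (hi : i ∈ C.supp) (h : InTriangle Gᶜ i) {x y : C.supp} :
    (coComponent G C).Reachable x y ↔ ¬ Gᶜ.Adj x y := by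
  constructor
  · intro hr
    rw [reachable_iff_reflTransGen] at hr
    induction hr with
    | refl => exact Gᶜ.loopless.irrefl _
    | @tail b c _ hbc ih =>
      intro hadj
      have hbc' : G.Adj b c := hbc
      have := hG.adj_of_inTriangle (y := b) (hG.inTriangle h (reachable_of_mem_supp hi x.2)) hadj
        (reachable_of_mem_supp x.2 b.2)
      rcases this with h1 | h1
      · exact ih h1.symm
      · exact ((compl_adj _ _ _).1 h1).2 hbc'
  · intro hn
    by_cases he : x = y
    · rw [he]
    · refine Adj.reachable ?_
      change G.Adj x y
      by_contra hn'
      exact hn ((compl_adj _ _ _).2 ⟨fun e => he (Subtype.ext e), hn'⟩)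

theorem IsFree.isDisjointUnionOfCliques (hG : IsFree P3addP1 G) {C : Gᶜ.ConnectedComponent}
    {i : V} (hi : i ∈ C.supp) (h : InTriangle Gᶜ i) :
    IsDisjointUnionOfCliques (coComponent G C) := by
  intro D x hx y hy hne
  have hr : (coComponent G C).Reachable x y := ConnectedComponent.exact (hx.trans hy.symm)
  rw [hG.reachable_coComponent hi h, compl_adj] at hr
  by_contra hn
  exact hr ⟨fun e => hne (Subtype.ext e), hn⟩

theorem IsFree.coComponent (hG : IsFree P3addP1 G) (C : Gᶜ.ConnectedComponent) :
    IsFree threeP1 (coComponent G C) ∨ IsDisjointUnionOfCliques (coComponent G C) := by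
  by_cases h : ∃ i ∈ C.supp, InTriangle Gᶜ i
  · obtain ⟨i, hi, h⟩ := h
    exact Or.inr (hG.isDisjointUnionOfCliques hi h)
  · push Not at h
    exact Or.inl (isFree_threeP1_coComponent h)

end FallColouring

namespace FallColouring

variable {V : Type*} {G : SimpleGraph V}

/-! ### Graphs without three pairwise non-adjacent vertices -/

/-- If the fibres of `c` are the orbits of the involution `f`, then `c` has as many values as `f`
has orbits. -/
theorem two_mul_card_of_orbits [Finite V] {α : Type*} [Finite α] {c : V → α}
    (hsurj : Function.Surjective c) {f : V → V} (hf : ∀ y, f (f y) = y)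
    (hc : ∀ y z, c y = c z ↔ z = y ∨ z = f y) :
    2 * Nat.card α = Nat.card V + Nat.card {y // f y = y} := by
  classical
  have := Fintype.ofFinite V
  have := Fintype.ofFinite α
  simp only [Nat.card_eq_fintype_card, Fintype.card_subtype]
  rw [← Finset.card_univ, ← Finset.card_univ (α := V),
    Finset.card_eq_sum_card_fiberwise (f := c) (t := Finset.univ) (by simp),
    Finset.card_eq_sum_card_fiberwise (s := Finset.univ.filter fun y => f y = y) (f := c)
      (t := Finset.univ) (by simp), ← Finset.sum_add_distrib, mul_comm, ← smul_eq_mul,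
    ← Finset.sum_const]
  -- Each fibre counts 2: a fibre with one element is counted again as a fixed point.
  refine Finset.sum_congr rfl fun j _ => ?_
  obtain ⟨y, rfl⟩ := hsurj j
  have h1 : (Finset.univ.filter fun z => c z = c y) = {y, f y} := by
    ext z
    simp only [Finset.mem_filter, Finset.mem_univ, true_and, Finset.mem_insert,
      Finset.mem_singleton]
    rw [eq_comm, hc]
  rw [Finset.filter_filter, h1]
  by_cases hy : f y = y
  · have h2 : (Finset.univ.filter fun z => f z = z ∧ c z = c y) = {y} := by
      ext z
      simp only [Finset.mem_filter, Finset.mem_univ, true_and, Finset.mem_singleton]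
      rw [eq_comm (a := c z), hc, hy, or_self]
      exact ⟨fun h => h.2, fun h => by subst h; exact ⟨hy, rfl⟩⟩
    rw [h2, hy]
    simp
  · have h2 : (Finset.univ.filter fun z => f z = z ∧ c z = c y) = ∅ := by
      ext z
      simp only [Finset.mem_filter, Finset.mem_univ, true_and, Finset.notMem_empty, iff_false]
      rw [eq_comm (a := c z), hc]
      rintro ⟨h3, rfl | rfl⟩
      · exact hy h3
      · exact hy (by rw [hf] at h3; exact h3.symm)
    rw [h2, Finset.card_pair (Ne.symm hy)]
    simp

/-- An involution that matches every vertex with a vertex not adjacent to it, except for the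
dominating vertices, which are fixed. -/
structure IsCoMatching (G : SimpleGraph V) (f : V → V) : Prop where
  invol : ∀ y, f (f y) = y
  not_adj : ∀ y, ¬ G.Adj y (f y)
  universal : ∀ y, f y = y → G.IsUniversal y

theorem IsCoMatching.fixed_iff {f : V → V} (hf : IsCoMatching G f) (y : V) :
    f y = y ↔ y ∈ G.universalVerts := by
  refine ⟨hf.universal y, fun h => ?_⟩
  by_contra hne
  exact hf.not_adj y (h (Ne.symm hne))

/-- Colour classes are independent, hence of size at most two, and `f` swaps the vertices of each
pair. If `y` is alone in its class, every other vertex needs a neighbour of that colour, which can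
only be `y`. -/
theorem exists_isCoMatching [Finite V] (hG : IsFree threeP1 G) {k : ℕ} (hk : k ∈ fallSpectrum G) :
    ∃ f, IsCoMatching G f ∧ 2 * k = Nat.card V + Nat.card {y // f y = y} := by
  classical
  rw [isFree_threeP1_iff] at hG
  obtain ⟨c, hsurj, hfall⟩ := hk
  have hnadj : ∀ {x y}, c x = c y → x ≠ y → Gᶜ.Adj x y := fun {x y} h hne =>
    (compl_adj _ _ _).2 ⟨hne, fun ha => c.valid ha h⟩
  let f : V → V := fun y => if h : ∃ w, w ≠ y ∧ c w = c y then h.choose else y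
  have hfc : ∀ y, c (f y) = c y := fun y => by
    simp only [f]
    split_ifs with h
    · exact h.choose_spec.2
    · rfl
  have hfne : ∀ y w, w ≠ y → c w = c y → w = f y := fun y w hne hc => by
    have h : ∃ w, w ≠ y ∧ c w = c y := ⟨w, hne, hc⟩
    have hf1 : f y ≠ y := by simp only [f, dif_pos h]; exact h.choose_spec.1
    by_contra hw
    refine hG y w (f y) ⟨hnadj hc.symm hne.symm, hnadj ?_ hw, hnadj (hfc y).symm hf1.symm⟩
    rw [hfc, hc]
  have hinv : ∀ y, f (f y) = y := fun y => by
    by_cases hy : f y = y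
    · rw [hy, hy]
    · exact (hfne (f y) y (Ne.symm hy) (hfc y).symm).symm
  refine ⟨f, ⟨hinv, fun y ha => c.valid ha (hfc y).symm, fun y hy w hne => ?_⟩, ?_⟩
  · have hcw : c y ≠ c w := fun h => hne (by rw [hfne y w hne.symm h.symm, hy])
    obtain ⟨x, hx, hxc⟩ := hfall w (c y) hcw
    have : x = y := by
      by_contra hxy
      rw [hfne y x hxy hxc, hy] at hxy
      exact hxy rfl
    rw [← this]; exact hx.symm
  · rw [← two_mul_card_of_orbits hsurj hinv, Nat.card_fin]
    intro y z
    constructor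
    · intro h
      by_cases hz : z = y
      · exact Or.inl hz
      · exact Or.inr (hfne y z hz h.symm)
    · rintro (rfl | rfl)
      · rfl
      · exact (hfc y).symm

/-- The colour classes are the orbits. A vertex without a neighbour in a two-element orbit would
form an independent triple with it, and one-element orbits are dominating. -/
theorem IsCoMatching.mem_fallSpectrum [Finite V] (hG : IsFree threeP1 G) {f : V → V}
    (hf : IsCoMatching G f) :
    ∃ k ∈ fallSpectrum G, 2 * k = Nat.card V + Nat.card {y // f y = y} := by
  rw [isFree_threeP1_iff] at hG
  let s : Setoid V :=
    { r := fun y z => z = y ∨ z = f y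
      iseqv := ⟨fun y => Or.inl rfl, by
        rintro y z (rfl | rfl)
        · exact Or.inl rfl
        · exact Or.inr (hf.invol y).symm, by
        rintro x y z (rfl | rfl) (rfl | rfl)
        · exact Or.inl rfl
        · exact Or.inr rfl
        · exact Or.inr rfl
        · exact Or.inl (hf.invol x)⟩ }
  have hc : ∀ y z, (Quotient.mk s y = Quotient.mk s z) ↔ z = y ∨ z = f y :=
    fun y z => Quotient.eq
  have hsurj : Function.Surjective (Quotient.mk s) := Quotient.mk_surjective
  refine ⟨Nat.card (Quotient s), card_mem_fallSpectrum (Quotient.mk s) ?_ hsurj ?_,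
    two_mul_card_of_orbits hsurj hf.invol hc⟩
  · intro v w ha he
    rcases (hc v w).1 he with rfl | rfl
    · exact G.loopless.irrefl _ ha
    · exact hf.not_adj v ha
  · intro v j hj
    obtain ⟨z, rfl⟩ := hsurj j
    have hvz : v ≠ z := fun h => hj (by rw [h])
    have hvf : v ≠ f z := fun h => hj ((hc z v).2 (Or.inr h))
    by_cases hz : f z = z
    · exact ⟨z, (hf.universal z hz hvz.symm).symm, rfl⟩
    · by_contra hn
      push Not at hn
      have h1 : ¬ G.Adj v z := fun h => hn z h rfl
      have h2 : ¬ G.Adj v (f z) := fun h => hn (f z) h ((hc z (f z)).2 (Or.inr rfl)).symm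
      exact hG v z (f z) ⟨(compl_adj _ _ _).2 ⟨hvz, h1⟩,
        (compl_adj _ _ _).2 ⟨Ne.symm hz, hf.not_adj z⟩, (compl_adj _ _ _).2 ⟨hvf, h2⟩⟩

theorem hasPerfectMatching_iff :
    HasPerfectMatching (deleteDominating G)ᶜ ↔ ∃ f, IsCoMatching G f := by
  classical
  constructor
  · rintro ⟨M, hM, hspan⟩
    have hex : ∀ v, ∃! w, M.Adj v w := fun v => hM (hspan v)
    choose g hg hg' using hex
    have hgg : ∀ v, g (g v) = v := fun v => (hg' _ _ (hg v).symm).symm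
    have hadj : ∀ v : ↥(G.universalVertsᶜ), ¬ G.Adj v (g v) ∧ v.1 ≠ (g v).1 := fun v => by
      have := (hg v).adj_sub
      rw [compl_adj] at this
      exact ⟨this.2, fun e => this.1 (Subtype.ext e)⟩
    refine ⟨fun y => if h : y ∈ G.universalVertsᶜ then (g ⟨y, h⟩).1 else y, fun y => ?_,
      fun y => ?_, fun y => ?_⟩
    · by_cases h : y ∈ G.universalVertsᶜ
      · simp only [dif_pos h, (g ⟨y, h⟩).2, dite_true, Subtype.coe_eta, hgg]
      · simp only [dif_neg h]
    · by_cases h : y ∈ G.universalVertsᶜ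
      · simp only [dif_pos h]
        exact (hadj ⟨y, h⟩).1
      · simp only [dif_neg h]
        exact G.loopless.irrefl y
    · by_cases h : y ∈ G.universalVertsᶜ
      · simp only [dif_pos h]
        exact fun e => absurd e.symm (hadj ⟨y, h⟩).2
      · intro _
        exact not_not.1 h
  · rintro ⟨f, hf⟩
    refine ⟨{ verts := Set.univ
              Adj := fun a b => f a = b
              adj_sub := fun {a b} h => ?_
              edge_vert := fun _ => trivial
              symm := ⟨fun a b h => ?_⟩ }, fun v _ => ?_, fun v => trivial⟩
    · rw [compl_adj]
      refine ⟨fun e => a.2 ((hf.fixed_iff a).1 (by rw [h, e])), fun ha => ?_⟩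
      exact hf.not_adj a (by rw [h]; exact ha)
    · rw [← h, hf.invol]
    · have hv : f v ∈ G.universalVertsᶜ := fun h => by
        have := (hf.fixed_iff _).2 h
        rw [hf.invol] at this
        exact v.2 ((hf.fixed_iff _).1 this.symm)
      exact ⟨⟨f v, hv⟩, rfl, fun w hw => Subtype.ext (Eq.symm hw)⟩

theorem fallSpectrum_of_hasPerfectMatching [Finite V] (hG : IsFree threeP1 G)
    (hM : HasPerfectMatching (deleteDominating G)ᶜ) :
    fallSpectrum G = {G.universalVerts.ncard + G.universalVertsᶜ.ncard / 2} := by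
  have hcard : ∀ {f : V → V} {k : ℕ}, IsCoMatching G f →
      2 * k = Nat.card V + Nat.card {y // f y = y} →
      k = G.universalVerts.ncard + G.universalVertsᶜ.ncard / 2 := by
    intro f k hf hk
    have h1 : Nat.card {y // f y = y} = G.universalVerts.ncard := by
      rw [← Nat.card_coe_set_eq]
      exact Nat.card_congr (Equiv.subtypeEquivRight hf.fixed_iff)
    have h2 := Set.ncard_add_ncard_compl G.universalVerts
    omega
  ext k
  rw [Set.mem_singleton_iff]
  constructor
  · intro hk
    obtain ⟨f, hf, h⟩ := exists_isCoMatching hG hk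
    exact hcard hf h
  · obtain ⟨f, hf⟩ := hasPerfectMatching_iff.1 hM
    obtain ⟨k', hk', h⟩ := hf.mem_fallSpectrum hG
    rintro rfl
    rwa [← hcard hf h]

theorem fallSpectrum_of_not_hasPerfectMatching [Finite V] (hG : IsFree threeP1 G)
    (hM : ¬ HasPerfectMatching (deleteDominating G)ᶜ) : fallSpectrum G = ∅ := by
  rw [Set.eq_empty_iff_forall_notMem]
  intro k hk
  obtain ⟨f, hf, -⟩ := exists_isCoMatching hG hk
  exact hM (hasPerfectMatching_iff.2 ⟨f, hf⟩)

/-! ### Disjoint unions of complete graphs -/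

/-- A vertex finds every other colour among its neighbours, thus within its component, and a clique
repeats no colour. -/
theorem IsDisjointUnionOfCliques.ncard_supp (hG : IsDisjointUnionOfCliques G) {k : ℕ}
    (hk : k ∈ fallSpectrum G) (D : G.ConnectedComponent) : D.supp.ncard = k := by
  obtain ⟨c, -, hfall⟩ := hk
  rw [← Nat.card_coe_set_eq]
  refine (Nat.card_eq_of_bijective (fun v : D.supp => c v) ⟨?_, ?_⟩).trans (Nat.card_fin k)
  · intro v w h
    by_contra hne
    exact c.valid (hG D v.2 w.2 fun e => hne (Subtype.ext e)) h
  · intro j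
    obtain ⟨v, hv⟩ := D.nonempty_supp
    by_cases hj : j = c v
    · exact ⟨⟨v, hv⟩, hj.symm⟩
    · obtain ⟨w, hw, rfl⟩ := hfall v j hj
      refine ⟨⟨w, ?_⟩, rfl⟩
      exact (ConnectedComponent.sound hw.reachable.symm).trans hv

/-- Without vertices `hp` would hold for every `p`; `Nonempty V` is what makes the colouring
surjective. -/
theorem IsDisjointUnionOfCliques.mem_fallSpectrum [Finite V] [Nonempty V]
    (hG : IsDisjointUnionOfCliques G) {p : ℕ}
    (hp : ∀ D : G.ConnectedComponent, D.supp.ncard = p) : p ∈ fallSpectrum G := by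
  have e : ∀ D : G.ConnectedComponent, D.supp ≃ Fin p := fun D =>
    Finite.equivFinOfCardEq (by rw [Nat.card_coe_set_eq, hp])
  let c : V → Fin p := fun v => e (G.connectedComponentMk v) ⟨v, rfl⟩
  have hc : ∀ (D : G.ConnectedComponent) (v : D.supp), c v = e D v := by
    rintro D ⟨v, rfl⟩
    rfl
  rw [← Nat.card_fin p]
  refine card_mem_fallSpectrum c ?_ ?_ ?_
  · intro v w ha he
    have hw : w ∈ (G.connectedComponentMk v).supp := ConnectedComponent.sound ha.reachable.symm
    have h1 := hc _ ⟨w, hw⟩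
    have h2 := hc (G.connectedComponentMk v) ⟨v, rfl⟩
    simp only at h1 h2
    rw [← he, h2] at h1
    exact ha.ne (Subtype.ext_iff.1 ((e _).injective h1))
  · intro j
    obtain ⟨v⟩ := ‹Nonempty V›
    exact ⟨(e (G.connectedComponentMk v)).symm j, by rw [hc, Equiv.apply_symm_apply]⟩
  · intro v j hj
    refine ⟨(e (G.connectedComponentMk v)).symm j, hG (G.connectedComponentMk v) rfl
      (Subtype.coe_prop _) fun he => hj ?_, by rw [hc, Equiv.apply_symm_apply]⟩
    rw [he, hc, Equiv.apply_symm_apply]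

theorem IsDisjointUnionOfCliques.fallSpectrum_eq [Finite V] [Nonempty V]
    (hG : IsDisjointUnionOfCliques G) {p : ℕ}
    (hp : ∀ D : G.ConnectedComponent, D.supp.ncard = p) : fallSpectrum G = {p} := by
  ext k
  rw [Set.mem_singleton_iff]
  constructor
  · intro hk
    obtain ⟨v⟩ := ‹Nonempty V›
    rw [← hp (G.connectedComponentMk v), hG.ncard_supp hk]
  · rintro rfl
    exact hG.mem_fallSpectrum hp

theorem IsDisjointUnionOfCliques.fallSpectrum_eq_empty (hG : IsDisjointUnionOfCliques G)
    (hp : ¬ ∃ p : ℕ, ∀ D : G.ConnectedComponent, D.supp.ncard = p) : fallSpectrum G = ∅ := by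
  rw [Set.eq_empty_iff_forall_notMem]
  intro k hk
  exact hp ⟨k, hG.ncard_supp hk⟩

/-! ### Uniqueness -/

theorem IsFree.subsingleton_coComponent [Finite V] (hG : IsFree P3addP1 G)
    (C : Gᶜ.ConnectedComponent) : (fallSpectrum (FallColouring.coComponent G C)).Subsingleton := by
  have : Nonempty C.supp := C.nonempty_supp.to_subtype
  rcases hG.coComponent C with h | h
  · by_cases hM : HasPerfectMatching (deleteDominating (FallColouring.coComponent G C))ᶜ
    · rw [fallSpectrum_of_hasPerfectMatching h hM]
      exact Set.subsingleton_singleton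
    · rw [fallSpectrum_of_not_hasPerfectMatching h hM]
      exact Set.subsingleton_empty
  · by_cases hp : ∃ p : ℕ, ∀ D : (FallColouring.coComponent G C).ConnectedComponent,
        D.supp.ncard = p
    · obtain ⟨p, hp⟩ := hp
      rw [h.fallSpectrum_eq hp]
      exact Set.subsingleton_singleton
    · rw [h.fallSpectrum_eq_empty hp]
      exact Set.subsingleton_empty

theorem IsFree.fallSpectrum_eq_singleton [Finite V] (hG : IsFree P3addP1 G) {k : ℕ}
    (hk : k ∈ fallSpectrum G) : fallSpectrum G = {k} := by
  refine (Set.eq_singleton_iff_unique_mem).2 ⟨hk, fun l hl => ?_⟩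
  obtain ⟨κ, hκ, rfl⟩ := (mem_fallSpectrum_iff G k).1 hk
  obtain ⟨μ, hμ, rfl⟩ := (mem_fallSpectrum_iff G l).1 hl
  congr 1
  funext C
  exact hG.subsingleton_coComponent C (hμ C) (hκ C)

end FallColouring

namespace FallColouring

/-! ### The fall spectrum from a matching and the sizes of the parts -/

section

variable {V : Type*} {G : SimpleGraph V}

/-- The edges between vertices that are in no triangle. -/
def offTriangles (H : SimpleGraph V) : SimpleGraph V where
  Adj i j := H.Adj i j ∧ ¬ InTriangle H i ∧ ¬ InTriangle H j
  symm := ⟨fun _ _ h => ⟨h.1.symm, h.2.2, h.2.1⟩⟩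
  loopless := ⟨fun i h => H.loopless.irrefl i h.1⟩

/-- The vertices `i` and `j` are not adjacent but have a common neighbour. In a complete
multipartite component this means that they are in the same part. -/
def SamePart (H : SimpleGraph V) (i j : V) : Prop :=
  ¬ H.Adj i j ∧ ∃ z, H.Adj i z ∧ H.Adj z j

/-- The size of the part of `i`. -/
noncomputable def partSize (H : SimpleGraph V) (i : V) : ℕ :=
  {j | SamePart H i j}.ncard

/-- Three vertices of one colour form a triangle of the complement, so outside triangles the colour
classes have at most two vertices and define `f`. An unpaired vertex there is the only one of its
colour, so the fall condition makes it adjacent in `G` to all others. -/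
theorem IsFree.exists_cover (hG : IsFree P3addP1 G) (h : (fallSpectrum G).Nonempty) :
    ∃ f, IsMate (offTriangles Gᶜ) f ∧ ∀ y, (∃ z, (offTriangles Gᶜ).Adj y z) → f y ≠ y := by
  classical
  obtain ⟨k, c, -, hfall⟩ := h
  have hnadj : ∀ {x y}, c x = c y → x ≠ y → Gᶜ.Adj x y := fun {x y} h hne =>
    (compl_adj _ _ _).2 ⟨hne, fun ha => c.valid ha h⟩
  have htri : ∀ {x y}, Gᶜ.Adj x y → ¬ InTriangle Gᶜ x → ¬ InTriangle Gᶜ y :=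
    fun hxy hx hy => hx (hG.inTriangle hy hxy.reachable.symm)
  let f : V → V := fun y =>
    if h : ¬ InTriangle Gᶜ y ∧ ∃ w, w ≠ y ∧ c w = c y then h.2.choose else y
  have hfc : ∀ y, c (f y) = c y := fun y => by
    simp only [f]
    split_ifs with h
    · exact h.2.choose_spec.2
    · rfl
  have hft : ∀ y, f y ≠ y → ¬ InTriangle Gᶜ y := fun y hy => by
    by_contra ht
    refine hy ?_
    simp only [f]
    rw [dif_neg (by tauto)]
  have hfne : ∀ y w, ¬ InTriangle Gᶜ y → w ≠ y → c w = c y → w = f y := fun y w ht hne hc => by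
    have h : ¬ InTriangle Gᶜ y ∧ ∃ w, w ≠ y ∧ c w = c y := ⟨ht, w, hne, hc⟩
    have hf1 : f y ≠ y := by simp only [f, dif_pos h]; exact h.2.choose_spec.1
    by_contra hw
    refine ht ⟨w, f y, hnadj hc.symm hne.symm, hnadj ?_ hw, hnadj (hfc y).symm hf1.symm⟩
    rw [hfc, hc]
  refine ⟨f, ⟨fun y => ?_, fun y hy => ?_⟩, ?_⟩
  · by_cases hy : f y = y
    · rw [hy, hy]
    · have hadj := hnadj (hfc y).symm (Ne.symm hy)
      exact (hfne (f y) y (htri hadj (hft y hy)) (Ne.symm hy) (hfc y).symm).symm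
  · have hadj := hnadj (hfc y).symm (Ne.symm hy)
    exact ⟨hadj, hft y hy, htri hadj (hft y hy)⟩
  · rintro y ⟨z, hyz, hy, hz⟩ hfy
    have hcz : c y ≠ c z := fun h => hyz.ne (by rw [hfne y z hy hyz.ne.symm h.symm, hfy])
    obtain ⟨x, hx, hxc⟩ := hfall z (c y) hcz
    have : x = y := by
      by_contra hxy
      rw [hfne y x hy hxy hxc, hfy] at hxy
      exact hxy rfl
    rw [this] at hx
    exact ((compl_adj _ _ _).1 hyz).2 hx.symm

/-- Replaces reachability by a common neighbour. An edge at `i` dominates the component, so a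
non-neighbour `j` of `i` is adjacent to the other end of the edge. -/
theorem IsFree.samePart_iff (hG : IsFree P3addP1 G) {i : V} (h : InTriangle Gᶜ i) (j : V) :
    SamePart Gᶜ i j ↔ Gᶜ.Reachable i j ∧ ¬ Gᶜ.Adj i j := by
  constructor
  · rintro ⟨h1, z, h2, h3⟩
    exact ⟨h2.reachable.trans h3.reachable, h1⟩
  · rintro ⟨h1, h2⟩
    refine ⟨h2, ?_⟩
    obtain ⟨z, -, hz, -⟩ := id h
    rcases hG.adj_of_inTriangle h hz h1 with h3 | h3
    · exact absurd h3.symm h2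
    · exact ⟨z, hz, h3.symm⟩

theorem IsFree.ncard_supp_eq_partSize (hG : IsFree P3addP1 G) {C : Gᶜ.ConnectedComponent}
    {x : C.supp} (h : InTriangle Gᶜ x) :
    ((FallColouring.coComponent G C).connectedComponentMk x).supp.ncard = partSize Gᶜ x := by
  rw [partSize, ← Set.ncard_image_of_injective _ Subtype.val_injective]
  congr 1
  ext j
  rw [Set.mem_ofPred_eq, hG.samePart_iff h]
  constructor
  · rintro ⟨y, hy, rfl⟩
    have hr : (FallColouring.coComponent G C).Reachable x y :=
      (ConnectedComponent.exact hy).symm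
    exact ⟨reachable_of_mem_supp x.2 y.2, (hG.reachable_coComponent x.2 h).1 hr⟩
  · rintro ⟨h1, h2⟩
    have hj : j ∈ C.supp := (ConnectedComponent.sound h1.symm).trans x.2
    refine ⟨⟨j, hj⟩, ?_, rfl⟩
    exact ConnectedComponent.sound ((hG.reachable_coComponent x.2 h (y := ⟨j, hj⟩)).2 h2).symm

theorem IsFree.partSize_eq [Finite V] (hG : IsFree P3addP1 G) (h : (fallSpectrum G).Nonempty)
    {i j : V} (hi : InTriangle Gᶜ i) (hij : Gᶜ.Adj i j) : partSize Gᶜ i = partSize Gᶜ j := by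
  obtain ⟨k, hk⟩ := h
  obtain ⟨κ, hκ, -⟩ := (mem_fallSpectrum_iff G k).1 hk
  let C := Gᶜ.connectedComponentMk i
  have hj : j ∈ C.supp := ConnectedComponent.sound hij.reachable.symm
  have hcl := hG.isDisjointUnionOfCliques (C := C) rfl hi
  have h1 := hG.ncard_supp_eq_partSize (C := C) (x := ⟨i, rfl⟩) hi
  have h2 := hG.ncard_supp_eq_partSize (C := C) (x := ⟨j, hj⟩) (hG.inTriangle hi hij.reachable)
  rw [hcl.ncard_supp (hκ C)] at h1 h2
  exact h1.symm.trans h2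

end

variable {n : ℕ} {G : SimpleGraph (Fin n)} {mate : Fin n → Fin n}

open Classical in
/-- The contribution of the vertex `i` to the number of colours. -/
noncomputable def weight (H : SimpleGraph (Fin n)) (mate : Fin n → Fin n) (i : Fin n) : ℕ :=
  if InTriangle H i then
    (if ∃ j, j < i ∧ (H.Adj i j ∨ SamePart H i j) then 0 else partSize H i)
  else if mate i = i then 1 else if i < mate i then 1 else 0

-- Only the least vertex `x₀` of the component contributes, because it is a neighbour or part-mate
-- of every other one. Its part has the common size: a vertex of any other part is adjacent to `x₀`
-- in the complement, so `hpart` applies.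
open Classical in
theorem IsFree.sum_weight_coComponent_of_inTriangle (hG : IsFree P3addP1 G)
    (hpart : ∀ i j, InTriangle Gᶜ i → Gᶜ.Adj i j → partSize Gᶜ i = partSize Gᶜ j)
    {C : Gᶜ.ConnectedComponent} {i : Fin n} (hi : i ∈ C.supp) (h : InTriangle Gᶜ i) :
    ∑ x : C.supp, weight Gᶜ mate x ∈ fallSpectrum (FallColouring.coComponent G C) := by
  have htri : ∀ x : C.supp, InTriangle Gᶜ x.1 := fun x =>
    hG.inTriangle h (reachable_of_mem_supp hi x.2)
  have : Nonempty C.supp := ⟨⟨i, hi⟩⟩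
  obtain ⟨x₀, hx₀⟩ := Finite.exists_min (fun x : C.supp => x.1)
  have hsum : ∑ x : C.supp, weight Gᶜ mate x = partSize Gᶜ x₀ := by
    rw [Finset.sum_eq_single x₀]
    · rw [weight, if_pos (htri x₀), if_neg]
      rintro ⟨j, hj, hadj⟩
      have hr : Gᶜ.Reachable x₀ j := by
        rcases hadj with h1 | h1
        · exact h1.reachable
        · exact ((hG.samePart_iff (htri x₀) j).1 h1).1
      exact absurd (hx₀ ⟨j, (ConnectedComponent.sound hr.symm).trans x₀.2⟩) (not_le.2 hj)
    · intro x _ hx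
      rw [weight, if_pos (htri x), if_pos]
      refine ⟨x₀, lt_of_le_of_ne (hx₀ x) fun e => hx (Subtype.ext e.symm), ?_⟩
      by_cases hadj : Gᶜ.Adj x x₀
      · exact Or.inl hadj
      · exact Or.inr ((hG.samePart_iff (htri x) _).2 ⟨reachable_of_mem_supp x.2 x₀.2, hadj⟩)
    · simp
  rw [hsum]
  refine (hG.isDisjointUnionOfCliques hi h).mem_fallSpectrum fun D => ?_
  obtain ⟨x, rfl⟩ := D.exists_rep
  change ((FallColouring.coComponent G C).connectedComponentMk x).supp.ncard = _
  by_cases hadj : Gᶜ.Adj x x₀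
  · rw [hG.ncard_supp_eq_partSize (htri x), hpart x x₀ (htri x) hadj]
  · rw [← hG.ncard_supp_eq_partSize (htri x₀),
      ConnectedComponent.sound ((hG.reachable_coComponent hi h).2 hadj)]

-- `mate` restricts to the component, since it moves along edges of the complement. A vertex that it
-- fixes has no neighbour in `offTriangles Gᶜ` and is therefore dominating.
open Classical in
theorem sum_weight_coComponent_of_not_inTriangle (hm : IsMate (offTriangles Gᶜ) mate)
    (hcov : ∀ y, (∃ z, (offTriangles Gᶜ).Adj y z) → mate y ≠ y)
    {C : Gᶜ.ConnectedComponent} (h : ∀ i ∈ C.supp, ¬ InTriangle Gᶜ i) :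
    ∑ x : C.supp, weight Gᶜ mate x ∈ fallSpectrum (coComponent G C) := by
  have hmem : ∀ x : C.supp, mate x ∈ C.supp := fun x => by
    by_cases hx : mate x = x
    · rw [hx]; exact x.2
    · exact (ConnectedComponent.sound (hm.adj x hx).1.reachable.symm).trans x.2
  let f : C.supp → C.supp := fun x => ⟨mate x, hmem x⟩
  have hinv : Function.Involutive f := fun x => Subtype.ext (hm.invol x)
  have hf : IsCoMatching (coComponent G C) f := by
    refine ⟨hinv, fun x hx => ?_, fun x hx y hne => ?_⟩
    · have hx' : G.Adj x (mate x) := hx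
      have := (hm.adj x hx'.ne.symm).1
      exact ((compl_adj _ _ _).1 this).2 hx'
    · by_contra hn
      have hxy : Gᶜ.Adj x y := (compl_adj _ _ _).2 ⟨fun e => hne (Subtype.ext e), hn⟩
      exact hcov x ⟨y, hxy, h x x.2, h y y.2⟩ (Subtype.ext_iff.1 hx)
  obtain ⟨k, hk, hk2⟩ := hf.mem_fallSpectrum (isFree_threeP1_coComponent h)
  -- Of a matched pair only the smaller vertex counts. Summing over `x` gives twice the weight on
  -- the left, and the vertices plus the fixed points on the right.
  have hw : ∀ x : C.supp, weight Gᶜ mate x + weight Gᶜ mate (f x) =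
      1 + if f x = x then 1 else 0 := by
    intro x
    simp only [weight, if_neg (h x x.2), if_neg (h (f x) (f x).2)]
    have h1 : mate (f x) = x := hm.invol x
    have h2 : (f x : Fin n) = mate x := rfl
    rw [h1, h2]
    by_cases hx : mate x = x
    · have hx' : f x = x := Subtype.ext hx
      simp [hx, hx']
    · have hx' : f x ≠ x := fun e => hx (Subtype.ext_iff.1 e)
      rw [if_neg hx, if_neg (Ne.symm hx), if_neg hx']
      rcases lt_or_gt_of_ne hx with h3 | h3
      · rw [if_neg (not_lt.2 h3.le), if_pos h3]
      · rw [if_pos h3, if_neg (not_lt.2 h3.le)]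
  have h2 : 2 * ∑ x : C.supp, weight Gᶜ mate x = 2 * k := by
    rw [hk2, two_mul]
    nth_rewrite 2 [← Equiv.sum_comp hinv.toPerm (fun x : C.supp => weight Gᶜ mate x)]
    rw [← Finset.sum_add_distrib]
    simp only [Function.Involutive.coe_toPerm, hw]
    rw [Finset.sum_add_distrib, Finset.sum_const, Finset.card_univ, smul_eq_mul, mul_one,
      Finset.sum_boole, Nat.card_eq_fintype_card, Nat.card_eq_fintype_card,
      Fintype.card_subtype (fun x => f x = x), Nat.cast_id]
  have h3 : ∑ x : C.supp, weight Gᶜ mate x = k := by omega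
  rwa [h3]

theorem IsFree.sum_weight_mem (hG : IsFree P3addP1 G) (hm : IsMate (offTriangles Gᶜ) mate)
    (hcov : ∀ y, (∃ z, (offTriangles Gᶜ).Adj y z) → mate y ≠ y)
    (hpart : ∀ i j, InTriangle Gᶜ i → Gᶜ.Adj i j → partSize Gᶜ i = partSize Gᶜ j) :
    ∑ i, weight Gᶜ mate i ∈ fallSpectrum G := by
  classical
  have : Finite Gᶜ.ConnectedComponent := Quot.finite _
  have := Fintype.ofFinite Gᶜ.ConnectedComponent
  refine (mem_fallSpectrum_iff G _).2 ⟨fun C => ∑ x : C.supp, weight Gᶜ mate x, fun C => ?_, ?_⟩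
  · by_cases h : ∃ i ∈ C.supp, InTriangle Gᶜ i
    · obtain ⟨i, hi, h⟩ := h
      exact hG.sum_weight_coComponent_of_inTriangle hpart hi h
    · push Not at h
      exact sum_weight_coComponent_of_not_inTriangle hm hcov h
  · rw [finsum_eq_sum_of_fintype]
    refine (Fintype.sum_sigma fun x : (C : Gᶜ.ConnectedComponent) × C.supp =>
      weight Gᶜ mate x.2).symm.trans ?_
    let e : ((C : Gᶜ.ConnectedComponent) × C.supp) ≃ Fin n :=
      Equiv.sigmaFiberEquiv Gᶜ.connectedComponentMk
    exact Equiv.sum_comp e (weight Gᶜ mate)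

end FallColouring

namespace FallColouring

open RAM RAM.Tm

/-! ### The algorithm -/

/-- Compute the complement (array `20`), the vertices in triangles of the complement (array `21`),
the graph for the matching algorithm (array `1`) and the empty matching (array `2`). -/
def prepareCmd : Cmd :=
  .seq (.set 20 (and (not (eq (.idx 0) (.idx 1))) (not (.get 0 0 1)))) <|
  .seq (.set 21 (ex 2 (ex 3 (and (.get 20 0 2) (and (.get 20 2 3) (.get 20 0 3)))))) <|
  .seq (.set 1 (and (.get 20 0 1) (and (not (.get 21 0 0)) (not (.get 21 1 1))))) <|
  .set 2 (.idx 0)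

/-- Compute the pairs of vertices in the same part (array `22`), the sizes of the parts
(array `23`), the vertices that show that there is no fall colouring (array `24`) and the
contributions of the vertices to the number of colours (array `25`). -/
def evaluateCmd : Cmd :=
  .seq (.set 22 (and (not (.get 20 0 1)) (ex 2 (and (.get 20 0 2) (.get 20 2 1))))) <|
  .seq (.set 23 (.sum 2 (.ite (.get 22 0 2) (.lit 1) (.lit 0)))) <|
  .seq (.set 24 (or (and (eq (.get 2 0 0) (.idx 0)) (ex 2 (.get 1 0 2)))
    (and (.get 21 0 0) (ex 2 (and (.get 20 0 2) (not (eq (.get 23 0 0) (.get 23 2 2)))))))) <|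
  .set 25 (.ite (.get 21 0 0)
    (.ite (ex 2 (and (lt (.idx 2) (.idx 0)) (or (.get 20 0 2) (.get 22 0 2))))
      (.lit 0) (.get 23 0 0))
    (.ite (eq (.get 2 0 0) (.idx 0)) (.lit 1)
      (.ite (lt (.idx 0) (.get 2 0 0)) (.lit 1) (.lit 0))))

/-- The whole algorithm. -/
def fallCmd : Cmd := .seq prepareCmd (.seq matchCmd evaluateCmd)

variable {n : ℕ} {H : SimpleGraph (Fin n)} {mate : Fin n → Fin n} {X : Arrays n}

/-- Protects the arrays 20 and 21, which are needed again after the matching algorithm. -/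
theorem stepCmd_of_gt {a : ℕ} (ha : 16 < a) : stepCmd.eval X a = X a := by
  simp only [stepCmd, chooseCmd, updateCmd, Cmd.eval]
  repeat rw [Function.update_of_ne (by omega)]

theorem matchCmd_of_gt {a : ℕ} (ha : 16 < a) : matchCmd.eval X a = X a := by
  rw [matchCmd_eval]
  induction 3 * (n * n) generalizing X with
  | zero => rfl
  | succ N ih => rw [Function.iterate_succ_apply, ih, stepCmd_of_gt ha]

/-- The arrays that describe the graph `H` for `evaluateCmd`. -/
structure Prepared (H : SimpleGraph (Fin n)) (X : Arrays n) : Prop where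
  graph : ∀ i j, X 20 i j ≠ 0 ↔ H.Adj i j
  triangle : ∀ i j, X 21 i j ≠ 0 ↔ InTriangle H i

/-- The search state before the first search. -/
def idle (n : ℕ) : Search (Fin n) where
  even _ := False
  odd _ := False
  -- The arrays for `M` and `p` are still zero at this point, which forces the value 0.
  M i _ := ⟨0, i.pos⟩
  P _ _ := False
  p i := ⟨0, i.pos⟩

theorem prepareCmd_spec (G : SimpleGraph (Fin n)) :
    Prepared Gᶜ (prepareCmd.eval (inputArrays (adjArray G))) ∧
      Encodes (offTriangles Gᶜ) id (idle n) (prepareCmd.eval (inputArrays (adjArray G))) := by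
  simp only [prepareCmd, Cmd.eval]
  set X₁ : Arrays n := Function.update (inputArrays (adjArray G)) 20 fun i j =>
    (and (not (eq (.idx 0) (.idx 1))) (not (.get 0 0 1))).eval _ (pairEnv i j) with hX₁
  have h20 : ∀ i j, X₁ 20 i j ≠ 0 ↔ Gᶜ.Adj i j := fun i j => by
    simp only [hX₁, Function.update_self]
    change Holds _ _ _ ↔ _
    by_cases h : G.Adj i j <;> simp [pairEnv, inputArrays, adjArray, Fin.ext_iff, h]
  set X₂ : Arrays n := Function.update X₁ 21 fun i j =>
    (ex 2 (ex 3 (and (.get 20 0 2) (and (.get 20 2 3) (.get 20 0 3))))).eval X₁ (pairEnv i j)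
    with hX₂
  have h21 : ∀ i j, X₂ 21 i j ≠ 0 ↔ InTriangle Gᶜ i := fun i j => by
    simp only [hX₂, Function.update_self]
    change Holds _ _ _ ↔ _
    simp only [holds_ex, holds_and, holds_get, h20]
    simp [pairEnv, InTriangle, IsTriangle]
  have h20' : ∀ i j, X₂ 20 i j ≠ 0 ↔ Gᶜ.Adj i j := fun i j => by rw [← h20]; simp [hX₂]
  set X₃ : Arrays n := Function.update X₂ 1 fun i j =>
    (and (.get 20 0 1) (and (not (.get 21 0 0)) (not (.get 21 1 1)))).eval X₂ (pairEnv i j)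
    with hX₃
  have h1 : ∀ i j, X₃ 1 i j ≠ 0 ↔ (offTriangles Gᶜ).Adj i j := fun i j => by
    simp only [hX₃, Function.update_self]
    change Holds _ _ _ ↔ _
    simp only [holds_and, holds_get, holds_not, h20', h21]
    rfl
  have h0 : ∀ a, 3 ≤ a → a ≤ 7 → ∀ i j, X₃ a i j = 0 := fun a h3 h7 i j => by
    simp only [hX₃, hX₂, hX₁]
    repeat rw [Function.update_of_ne (by omega)]
    exact if_neg (by omega)
  constructor
  · constructor
    · intro i j; rw [← h20']; simp [hX₃]
    · intro i j; rw [← h21 i j]; simp [hX₃]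
  · constructor
    · intro i j; rw [← h1]; simp
    · intro i j; simp [pairEnv]
    · intro i j; simp [h0, idle]
    · intro i j; simp [h0, idle]
    · intro i j; simp [h0, idle]
    · intro i j; simp [h0, idle]
    · intro i j; simp [h0, idle]

open Classical in
theorem evaluateCmd_spec {B : SimpleGraph (Fin n)} {S : Search (Fin n)} (hH : Prepared H X)
    (hE : Encodes B mate S X) :
    (∀ i, evaluateCmd.eval X 24 i i = 0 ↔ ¬ (mate i = i ∧ ∃ z, B.Adj i z) ∧
      ¬ (InTriangle H i ∧ ∃ j, H.Adj i j ∧ partSize H i ≠ partSize H j)) ∧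
    ∀ i, evaluateCmd.eval X 25 i i = weight H mate i := by
  simp only [evaluateCmd, Cmd.eval]
  set X₁ : Arrays n := Function.update X 22 fun i j =>
    (and (not (.get 20 0 1)) (ex 2 (and (.get 20 0 2) (.get 20 2 1)))).eval X (pairEnv i j)
    with hX₁
  have h22 : ∀ i j, X₁ 22 i j ≠ 0 ↔ SamePart H i j := fun i j => by
    simp only [hX₁, Function.update_self]
    change Holds _ _ _ ↔ _
    simp only [holds_ex, holds_and, holds_get, holds_not, hH.graph]
    simp [pairEnv, SamePart]
  set X₂ : Arrays n := Function.update X₁ 23 fun i j =>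
    (Tm.sum 2 (.ite (.get 22 0 2) (.lit 1) (.lit 0))).eval X₁ (pairEnv i j) with hX₂
  have h23 : ∀ i j, X₂ 23 i j = partSize H i := fun i j => by
    simp only [hX₂, Function.update_self, Tm.eval, h22]
    simp [pairEnv, partSize, Set.ncard_eq_toFinset_card']
  have h22' : ∀ i j, X₂ 22 i j ≠ 0 ↔ SamePart H i j := fun i j => by rw [← h22]; simp [hX₂]
  have h20 : ∀ i j, X₂ 20 i j ≠ 0 ↔ H.Adj i j := fun i j => by
    rw [← hH.graph]; simp [hX₂, hX₁]
  have h21 : ∀ i j, X₂ 21 i j ≠ 0 ↔ InTriangle H i := fun i j => by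
    rw [← hH.triangle i j]; simp [hX₂, hX₁]
  have h1 : ∀ i j, X₂ 1 i j ≠ 0 ↔ B.Adj i j := fun i j => by
    rw [← hE.graph]; simp [hX₂, hX₁]
  have h2 : ∀ i j, X₂ 2 i j = mate i := fun i j => by rw [← hE.mate i j]; simp [hX₂, hX₁]
  set X₃ : Arrays n := Function.update X₂ 24 _ with hX₃
  have e : ∀ a, a < 24 → X₃ a = X₂ a := fun a ha => Function.update_of_ne (by omega) _ _
  constructor
  · intro i
    rw [Function.update_of_ne (by omega), hX₃, Function.update_self, ← not_or, ← not_iff_not,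
      not_not]
    change Holds _ _ _ ↔ _
    simp only [holds_ex, holds_and, holds_or, holds_eq, holds_get, holds_not, eval_get, eval_idx,
      h20, h21, h23, h1, h2]
    simp [pairEnv, Fin.ext_iff]
  · intro i
    rw [Function.update_self]
    simp only [eval_ite, holds_ex, holds_and, holds_or, holds_eq, holds_lt, holds_get, eval_get,
      eval_idx, eval_lit, e 20 (by omega), e 21 (by omega), e 22 (by omega), e 23 (by omega),
      e 2 (by omega), h20, h21, h22', h23, h2]
    simp [pairEnv, Fin.ext_iff, weight]

/-- The two tests in array 24 are passed if a fall colouring exists (`IsFree.exists_cover`,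
`IsFree.partSize_eq`). Passing them makes the total weight a member of the spectrum
(`IsFree.sum_weight_mem`), and uniqueness identifies it with `k`. -/
theorem fallCmd_spec {G : SimpleGraph (Fin n)} (hG : IsFree P3addP1 G) (k : ℕ) :
    k ∈ fallSpectrum G ↔ ∑ i, fallCmd.eval (inputArrays (adjArray G)) 24 i i = 0 ∧
      ∑ i, fallCmd.eval (inputArrays (adjArray G)) 25 i i = k := by
  obtain ⟨hP, hE⟩ := prepareCmd_spec G
  obtain ⟨mate, S, hE', hm, hcov⟩ := hE.matchCmd
    ⟨⟨fun _ => rfl, fun _ h => absurd rfl h⟩, Or.inl fun _ => id⟩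
  have hP' : Prepared Gᶜ (matchCmd.eval (prepareCmd.eval (inputArrays (adjArray G)))) :=
    ⟨by rw [matchCmd_of_gt (by omega)]; exact hP.graph,
      by rw [matchCmd_of_gt (by omega)]; exact hP.triangle⟩
  obtain ⟨h24, h25⟩ := evaluateCmd_spec hP' hE'
  change _ ↔ ∑ i, evaluateCmd.eval _ 24 i i = 0 ∧ ∑ i, evaluateCmd.eval _ 25 i i = k
  simp only [Finset.sum_eq_zero_iff, Finset.mem_univ, true_imp_iff, h24, h25]
  have hsum : (∀ i, ¬ (mate i = i ∧ ∃ z, (offTriangles Gᶜ).Adj i z) ∧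
      ¬ (InTriangle Gᶜ i ∧ ∃ j, Gᶜ.Adj i j ∧ partSize Gᶜ i ≠ partSize Gᶜ j)) →
      ∑ i, weight Gᶜ mate i ∈ fallSpectrum G := fun h =>
    hG.sum_weight_mem hm (fun y hy hf => (h y).1 ⟨hf, hy⟩) fun i j hi hij => by
      by_contra hne
      exact (h i).2 ⟨hi, j, hij, hne⟩
  constructor
  · intro hk
    have h : ∀ i, ¬ (mate i = i ∧ ∃ z, (offTriangles Gᶜ).Adj i z) ∧
        ¬ (InTriangle Gᶜ i ∧ ∃ j, Gᶜ.Adj i j ∧ partSize Gᶜ i ≠ partSize Gᶜ j) := fun i =>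
      ⟨fun h => hcov (hG.exists_cover ⟨k, hk⟩) i h.2 h.1,
        fun ⟨hi, j, hij, hne⟩ => hne (hG.partSize_eq ⟨k, hk⟩ hi hij)⟩
    have := hsum h
    rw [hG.fallSpectrum_eq_singleton hk] at this
    exact ⟨h, this⟩
  · rintro ⟨h, rfl⟩
    exact hsum h

theorem fallSpectrum_eq_of_fallCmd {G : SimpleGraph (Fin n)} (hG : IsFree P3addP1 G) :
    fallSpectrum G = if ∑ i, fallCmd.eval (inputArrays (adjArray G)) 24 i i = 0 then
      {∑ i, fallCmd.eval (inputArrays (adjArray G)) 25 i i} else ∅ := by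
  ext k
  rw [fallCmd_spec hG]
  split_ifs with h
  · simp [h, eq_comm]
  · simp [h]

end FallColouring

/-! ### Assembly of the main theorem -/

open FallColouring in
theorem mainTheorem7 :
    -- Fall Colouring, Fall Chromatic Number and Fall Achromatic Number are polynomial-time solvable
    -- for (P₃ + P₁)-free graphs
    RAM.PolyTimeDecidableOn (fun x : InputGraph × ℕ => IsFree P3addP1 x.1.2) encodeGraphNat
      (fun x => x.2 ∈ fallSpectrum x.1.2) ∧
    RAM.PolyTimeOn (fun G : InputGraph => IsFree P3addP1 G.2) encodeGraph
      (fun G => fallChromaticNumber G.2) ∧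
    RAM.PolyTimeOn (fun G : InputGraph => IsFree P3addP1 G.2) encodeGraph
      (fun G => fallAchromaticNumber G.2) ∧
    ∀ (V : Type*) [Finite V] (G : SimpleGraph V), IsFree P3addP1 G →
      -- a graph with a fall colouring is fall-unique
      ((fallSpectrum G).Nonempty → FallUnique G) ∧
      -- the spectrum is determined by those of the co-components
      (∀ k, k ∈ fallSpectrum G ↔ ∃ κ : Gᶜ.ConnectedComponent → ℕ,
        (∀ C, κ C ∈ fallSpectrum (coComponent G C)) ∧ ∑ᶠ C, κ C = k) ∧
      ∀ C : Gᶜ.ConnectedComponent,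
        (IsFree threeP1 (coComponent G C) ∨ IsDisjointUnionOfCliques (coComponent G C)) ∧
        -- the spectrum of a 3P₁-free co-component
        (IsFree threeP1 (coComponent G C) →
          (HasPerfectMatching (deleteDominating (coComponent G C))ᶜ →
            fallSpectrum (coComponent G C) =
              {(coComponent G C).universalVerts.ncard +
                (coComponent G C).universalVertsᶜ.ncard / 2}) ∧
          (¬ HasPerfectMatching (deleteDominating (coComponent G C))ᶜ →
            fallSpectrum (coComponent G C) = ∅)) ∧
        -- the spectrum of a co-component that is a disjoint union of complete graphs
        (IsDisjointUnionOfCliques (coComponent G C) →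
          (∀ p : ℕ, (∀ D : (coComponent G C).ConnectedComponent, D.supp.ncard = p) →
            fallSpectrum (coComponent G C) = {p}) ∧
          ((¬ ∃ p : ℕ, ∀ D : (coComponent G C).ConnectedComponent, D.supp.ncard = p) →
            fallSpectrum (coComponent G C) = ∅)) := by
  refine ⟨polyTimeDecidableOn_of_cmd fallCmd 24 25 fun G k hG => fallCmd_spec hG k,
    polyTimeOn_of_cmd fallCmd 24 25 fun G hG => ?_,
    polyTimeOn_of_cmd fallCmd 24 25 fun G hG => ?_, fun V _ G hG => ⟨?_, ?_, fun C => ?_⟩⟩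
  · rw [fallChromaticNumber, fallSpectrum_eq_of_fallCmd hG]
    -- In `ℕ` the infimum of the empty set is 0, as wanted without fall colourings; the same holds
    -- for the supremum below.
    split_ifs <;> simp
  · rw [fallAchromaticNumber, fallSpectrum_eq_of_fallCmd hG]
    split_ifs <;> simp
  · rintro ⟨k, hk⟩
    exact ⟨k, hG.fallSpectrum_eq_singleton hk⟩
  · exact mem_fallSpectrum_iff G
  · have : Nonempty C.supp := C.nonempty_supp.to_subtype
    exact ⟨hG.coComponent C,
      fun h => ⟨fallSpectrum_of_hasPerfectMatching h, fallSpectrum_of_not_hasPerfectMatching h⟩,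
      fun h => ⟨fun _ => h.fallSpectrum_eq, h.fallSpectrum_eq_empty⟩⟩
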